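/- Let $p>2$ be a prime and let $R$ be a commutative ring without $\mathbb Z$-torsion (for instance a domain of characteristic zero) which is $p$-adically separated and complete. Let $\sigma:R\to R$ be a $p$th power Frobenius lift, i.e. a ring endomorphism with $\sigma(r)\equiv r^p \bmod p$ for all $r\in R$. Let $f\in R[x_1^{\pm1},\dots,x_n^{\pm1}]$ have Newton polytope $\Delta\subset\mathbb R^n$, let $f^\sigma$ be $f$ with $\sigma$ applied to its coefficients, and let $C(\Delta)=\{\lambda(1,v): v\in\Delta,\lambda\ge0\}\subset\mathbb R^{n+1}$, $C(\Delta)_{\mathbb Z}=C(\Delta)\cap\mathbb Z^{n+1}$. For $u=(u_0,\dots,u_n)\in C(\Delta)_{\mathbb Z}$ write $X^u=x_0^{u_0}\cdots x_n^{u_n}$ and $x^u=x_1^{u_1}\cdots x_n^{u_n}$. Let $R[[\Delta]]$ be the ring of formal power series $\sum_{u\in C(\Delta)_{\mathbb Z}}a_uX^u$ with $a_u\in R$, and let $\widehat{R[\Delta]}\subset R[[\Delta]]$ be the submodule of series with $a_u\to0$ $p$-adically as $u_0\to\infty$ (the $p$-adic completion of the span $R[\Delta]$ of the $X^u$). A superscript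 $+$ denotes the series with zero constant term. For a Laurent polynomial $g$ put $\mathscr D_{i,g}=\theta_i+\theta_i(x_0g)$ with $\theta_i=x_i\,\partial/\partial x_i$, $0\le i\le n$. Put $F=x_0f$, $F^\sigma=x_0f^\sigma$, $$V_p\Bigl(\sum_u a_uX^u\Bigr)=\sum_u(-p)^{u_0}a_{pu}X^u,\qquad \mathscr V_\sigma=e^{-F^\sigma}\circ V_p\circ e^{F},$$ an operator on power series with coefficients in $R\otimes\mathbb Q$ (or in any commutative $\mathbb Q$-algebra containing $R$). Then: 1. $\mathscr V_\sigma$ maps $R[[\Delta]]$ to itself; it preserves $R[[\Delta]]^+$ and is divisible by $p$ on it. 2. $\mathscr V_\sigma\circ\mathscr D_{i,f}=p\,\mathscr D_{i,f^\sigma}\circ\mathscr V_\sigma$ for $0\le i\le n$. 3. $\mathscr V_\sigma$ preserves $\widehat{R[\Delta]}$, and $p^{-1}\mathscr V_\sigma$ maps $\widehat{R[\Delta]}^+$ to itself. 4. Assume that the coefficient of $f$ at some vertex $b$ of $\Delta$ is a unit of $R$. For $g\in\{f,f^\sigma\}$ let $\Omega_g$ be the $R$-module generated by the rational functions $\omega_u=(u_0-1)!\,x^u/g^{u_0}$,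 $0\neq u\in C(\Delta)_{\mathbb Z}$, and let $\widehat\Omega_g=\varprojlim\Omega_g/p^s\Omega_g$. The Laplace transform $\sum a_uX^u\mapsto\sum a_u(-1)^{u_0}\omega_u$ identifies $\widehat{R[\Delta]}^+/\mathscr D_{0,g}(\widehat{R[\Delta]}^+)$ with $\widehat\Omega_g$. There is exactly one $R$-linear map $\mathscr C_p:\widehat\Omega_f\to\widehat\Omega_{f^\sigma}$ (the Cartier operator) which on formal expansions at $b$, in the module of Laurent series $\sum a_kx^k$ with support in the cone generated by $\Delta-b$, is given by $\sum a_kx^k\mapsto\sum a_{pk}x^k$. The map $\widehat\Omega_f\to\widehat\Omega_{f^\sigma}$ induced by $p^{-1}\mathscr V_\sigma$ coincides with $\mathscr C_p$. -/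

import Mathlib

noncomputable section

namespace DworkCrystal

/-! ### Laurent polynomials and polytopes -/

/-- Laurent polynomials `A[x₁^{±1}, …, xₙ^{±1}]`. -/
abbrev LaurentPoly (A : Type*) [CommRing A] (n : ℕ) : Type _ :=
  AddMonoidAlgebra A (Fin n → ℤ)

/-- An integral vector, seen in `ℝⁿ`. -/
def toReal {n : ℕ} (k : Fin n → ℤ) : Fin n → ℝ := fun i => (k i : ℝ)

/-- The Newton polytope: the convex hull of the support. -/
def newtonPolytope {A : Type*} [CommRing A] {n : ℕ} (g : LaurentPoly A n) : Set (Fin n → ℝ) :=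
  convexHull ℝ (toReal '' (g.coeff.support : Set (Fin n → ℤ)))

/-- The cone `C(Δ) = {r (1, v) | v ∈ Δ, r ≥ 0}` in `ℝ × ℝⁿ = ℝ^{n+1}`. -/
def coneOver {n : ℕ} (Δ : Set (Fin n → ℝ)) : Set (ℝ × (Fin n → ℝ)) :=
  {w | ∃ r : ℝ, 0 ≤ r ∧ ∃ v ∈ Δ, w = r • ((1 : ℝ), v)}

/-- The integral points `u = (u₀, u₁, …, uₙ)` of the cone `C(Δ)`; the coordinate `u₀` is never
negative on the cone, so it is recorded as a natural number. -/
def latticeCone {n : ℕ} (Δ : Set (Fin n → ℝ)) : Set (ℕ × (Fin n → ℤ)) :=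
  {u | ((u.1 : ℝ), toReal u.2) ∈ coneOver Δ}

/-- The cone `C(Δ - b) = {r (v - b) | v ∈ Δ, r ≥ 0}` in `ℝⁿ`. -/
def tangentCone {n : ℕ} (Δ : Set (Fin n → ℝ)) (b : Fin n → ℤ) : Set (Fin n → ℝ) :=
  {w | ∃ r : ℝ, 0 ≤ r ∧ ∃ v ∈ Δ, w = r • (v - toReal b)}

/-- `f^σ`: the ring homomorphism `σ` applied to the coefficients of `f`. -/
def mapCoeff {A B : Type*} [CommRing A] [CommRing B] (σ : A →+* B) {n : ℕ} :
    LaurentPoly A n →+* LaurentPoly B n :=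
  AddMonoidAlgebra.mapRingHom (Fin n → ℤ) σ

/-! ### Power series supported in the cone

A formal power series `∑ a_u X^u` over `u = (u₀, …, uₙ) ∈ C(Δ)_ℤ` has, for each `u₀ = N`, only
finitely many terms (the lattice points of the polytope `N Δ`).  It is therefore the same thing as
a power series in `x₀` whose coefficient at `x₀^N` is a Laurent polynomial in `x₁, …, xₙ` with
support in `N Δ`. -/

/-- Power series in `x₀` with coefficients in the Laurent polynomials in `x₁, …, xₙ`. -/
abbrev Series (A : Type*) [CommRing A] (n : ℕ) : Type _ := PowerSeries (LaurentPoly A n)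

/-- The coefficient `a_u` of `∑ a_u X^u`, where `u = (N, k)`. -/
def coeffAt {A : Type*} [CommRing A] {n : ℕ} (h : Series A n) (u : ℕ × (Fin n → ℤ)) : A :=
  (PowerSeries.coeff u.1 h).coeff u.2

lemma coeffAt_zero {A : Type*} [CommRing A] {n : ℕ} (u : ℕ × (Fin n → ℤ)) :
    coeffAt (0 : Series A n) u = 0 := by simp [coeffAt]

lemma coeffAt_add {A : Type*} [CommRing A] {n : ℕ} (h₁ h₂ : Series A n) (u : ℕ × (Fin n → ℤ)) :
    coeffAt (h₁ + h₂) u = coeffAt h₁ u + coeffAt h₂ u := by simp [coeffAt]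

lemma coeffAt_smul {A : Type*} [CommRing A] {n : ℕ} (c : A) (h : Series A n)
    (u : ℕ × (Fin n → ℤ)) : coeffAt (c • h) u = c * coeffAt h u := by simp [coeffAt]

/-- `A⟦Δ⟧`: formal power series with coefficients in `A` and support in `C(Δ)`. -/
def coneSeries (A : Type*) [CommRing A] {n : ℕ} (Δ : Set (Fin n → ℝ)) :
    Submodule A (Series A n) where
  carrier := {h | ∀ u, coeffAt h u ≠ 0 → u ∈ latticeCone Δ}
  zero_mem' := fun u hu => absurd (coeffAt_zero u) hu
  add_mem' := by
    intro h₁ h₂ hh₁ hh₂ u hu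
    by_cases h0 : coeffAt h₁ u = 0
    · exact hh₂ u fun h0' => hu (by rw [coeffAt_add, h0, h0', add_zero])
    · exact hh₁ u h0
  smul_mem' := fun c h hh u hu => hh u fun h0 => hu (by rw [coeffAt_smul, h0, mul_zero])

/-- `A⟦Δ⟧⁺`: the series in `A⟦Δ⟧` with zero constant term. -/
def coneSeriesPlus (A : Type*) [CommRing A] {n : ℕ} (Δ : Set (Fin n → ℝ)) :
    Submodule A (Series A n) where
  carrier := {h | h ∈ coneSeries A Δ ∧ coeffAt h 0 = 0}
  zero_mem' := ⟨zero_mem _, coeffAt_zero 0⟩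
  add_mem' := by
    rintro h₁ h₂ ⟨hh₁, h₁0⟩ ⟨hh₂, h₂0⟩
    exact ⟨add_mem hh₁ hh₂, by rw [coeffAt_add, h₁0, h₂0, add_zero]⟩
  smul_mem' := by
    rintro c h ⟨hh, h0⟩
    exact ⟨Submodule.smul_mem _ c hh, by rw [coeffAt_smul, h0, mul_zero]⟩

/-- The series whose coefficients tend to `0` `p`-adically as `u₀ → ∞`. -/
def nullSeries (p : ℕ) (A : Type*) [CommRing A] (n : ℕ) : Submodule A (Series A n) where
  carrier := {h | ∀ s : ℕ, ∃ N₀ : ℕ, ∀ u : ℕ × (Fin n → ℤ), N₀ ≤ u.1 →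
    (p : A) ^ s ∣ coeffAt h u}
  zero_mem' := fun s => ⟨0, fun u _ => by rw [coeffAt_zero]; exact dvd_zero _⟩
  add_mem' := by
    intro h₁ h₂ hh₁ hh₂ s
    obtain ⟨N₁, hN₁⟩ := hh₁ s
    obtain ⟨N₂, hN₂⟩ := hh₂ s
    refine ⟨max N₁ N₂, fun u hu => ?_⟩
    rw [coeffAt_add]
    exact dvd_add (hN₁ u (le_trans (le_max_left _ _) hu)) (hN₂ u (le_trans (le_max_right _ _) hu))
  smul_mem' := by
    intro c h hh s
    obtain ⟨N, hN⟩ := hh s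
    refine ⟨N, fun u hu => ?_⟩
    rw [coeffAt_smul]
    exact Dvd.dvd.mul_left (hN u hu) c

/-- The `p`-adic completion of `A[Δ]`, as the module of power series in `A⟦Δ⟧` whose coefficients
tend to `0` `p`-adically as `u₀ → ∞`. -/
def completedSeries (p : ℕ) (A : Type*) [CommRing A] {n : ℕ} (Δ : Set (Fin n → ℝ)) :
    Submodule A (Series A n) :=
  coneSeries A Δ ⊓ nullSeries p A n

/-- The series with zero constant term in the completion of `A[Δ]`. -/
def completedSeriesPlus (p : ℕ) (A : Type*) [CommRing A] {n : ℕ} (Δ : Set (Fin n → ℝ)) :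
    Submodule A (Series A n) :=
  coneSeriesPlus A Δ ⊓ nullSeries p A n

/-- A ring homomorphism applied to the coefficients of a series. -/
def mapSeries {A B : Type*} [CommRing A] [CommRing B] (τ : A →+* B) {n : ℕ} :
    Series A n →+* Series B n :=
  PowerSeries.map (mapCoeff τ)

/-! ### Twisted derivatives and the operator `e^{-F^σ} ∘ V_p ∘ e^F` -/

/-- `F(X) = x₀ g(x)`. -/
def phase {A : Type*} [CommRing A] {n : ℕ} (g : LaurentPoly A n) : Series A n :=
  PowerSeries.X * PowerSeries.C g

/-- `θ_i = x_i ∂/∂x_i`, i.e. `X^u ↦ u_i X^u`, for `0 ≤ i ≤ n`. -/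
def theta {A : Type*} [CommRing A] {n : ℕ} (i : Fin (n + 1)) (h : Series A n) : Series A n :=
  PowerSeries.mk fun N => (PowerSeries.coeff N h).coeff.sum fun k c =>
    AddMonoidAlgebra.single k ((((Fin.cons (N : ℤ) k : Fin (n + 1) → ℤ) i : ℤ) : A) * c)

/-- The twisted derivative `D_{i,g} = x_i ∂/∂x_i + x_i ∂F/∂x_i`, with `F = x₀ g`. -/
def twistedDeriv {A : Type*} [CommRing A] {n : ℕ} (i : Fin (n + 1)) (g : LaurentPoly A n)
    (h : Series A n) : Series A n :=
  theta i h + theta i (phase g) * h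

/-- The series `e^{x₀ g} = ∑ g^N x₀^N / N!` over a `ℚ`-algebra. -/
def expPhase {K : Type*} [CommRing K] [Algebra ℚ K] {n : ℕ} (g : LaurentPoly K n) : Series K n :=
  PowerSeries.mk fun N => ((N.factorial : ℚ)⁻¹) • g ^ N

lemma nsmul_injective (p : ℕ) [hp : Fact p.Prime] (n : ℕ) :
    Function.Injective (fun k : Fin n → ℤ => p • k) := by
  intro k l h
  funext i
  have := congrFun h i
  simpa [hp.out.ne_zero] using this

/-- `∑ a_k x^k ↦ ∑ a_{pk} x^k` on Laurent polynomials. -/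
def cartierPoly {A : Type*} [CommRing A] (p : ℕ) [Fact p.Prime] {n : ℕ} (g : LaurentPoly A n) :
    LaurentPoly A n :=
  AddMonoidAlgebra.comapDomain (fun k : Fin n → ℤ => p • k) (nsmul_injective p n) g

/-- `V_p (∑ a_u X^u) = ∑ (-p)^{u₀} a_{pu} X^u`. -/
def Vp {A : Type*} [CommRing A] (p : ℕ) [Fact p.Prime] {n : ℕ} (h : Series A n) : Series A n :=
  PowerSeries.mk fun N => ((-(p : A)) ^ N) • cartierPoly p (PowerSeries.coeff (p * N) h)

/-- The operator `e^{-F₂} ∘ V_p ∘ e^{F₁}` with `F₁ = x₀ g₁` and `F₂ = x₀ g₂`. -/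
def dworkOperator {K : Type*} [CommRing K] [Algebra ℚ K] (p : ℕ) [Fact p.Prime] {n : ℕ}
    (g₁ g₂ : LaurentPoly K n) (h : Series K n) : Series K n :=
  expPhase (-g₂) * Vp p (expPhase g₁ * h)

/-! ### The module `Ω` of regular functions -/

/-- `ω_u = (u₀ - 1)! x^u / g^{u₀}`. -/
def omega {A : Type*} [CommRing A] {n : ℕ} (g : LaurentPoly A n) (u : ℕ × (Fin n → ℤ)) :
    Localization.Away g :=
  ((u.1 - 1).factorial : A) •
    Localization.mk (AddMonoidAlgebra.single u.2 (1 : A))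
      (⟨g ^ u.1, u.1, rfl⟩ : Submonoid.powers g)

/-- `Ω_g`: the `A`-module generated by the `ω_u`, where `u` runs over the non-zero integral points
of `C(Δ)`. -/
def Omega {A : Type*} [CommRing A] {n : ℕ} (Δ : Set (Fin n → ℝ)) (g : LaurentPoly A n) :
    Submodule A (Localization.Away g) :=
  Submodule.span A (omega g '' (latticeCone Δ \ {0}))

open Classical in
/-- `ω_u` as an element of `Ω_g`, for `u` a non-zero integral point of `C(Δ)` (and `0` for all
other `u`). -/
def omegaIn {A : Type*} [CommRing A] {n : ℕ} (Δ : Set (Fin n → ℝ)) (g : LaurentPoly A n)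
    (u : ℕ × (Fin n → ℤ)) : Omega Δ g :=
  if hu : u ∈ latticeCone Δ \ {0} then
    ⟨omega g u, Submodule.subset_span (Set.mem_image_of_mem _ hu)⟩
  else 0

/-- The `p`-adic completion `lim M / p^s M`. -/
abbrev PCompletion (p : ℕ) (A : Type*) [CommRing A] (M : Type*) [AddCommGroup M] [Module A M] :
    Type _ :=
  AdicCompletion (Ideal.span {(p : A)}) M

/-! ### The Laplace transform -/

/-- The part of degree `N` in `x₀` of the Laplace transform, `X^u ↦ (-1)^{u₀} ω_u`. -/
def laplaceTerm {A : Type*} [CommRing A] {n : ℕ} (Δ : Set (Fin n → ℝ)) (g : LaurentPoly A n)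
    (N : ℕ) : Series A n →ₗ[A] Omega Δ g :=
  (Finsupp.lsum A fun k => LinearMap.toSpanSingleton A (Omega Δ g)
      ((-1 : A) ^ N • omegaIn Δ g (N, k))) ∘ₗ
    (AddMonoidAlgebra.coeffLinearEquiv A).toLinearMap ∘ₗ
    ((PowerSeries.coeff N).restrictScalars A)

lemma laplaceTerm_apply {A : Type*} [CommRing A] {n : ℕ} (Δ : Set (Fin n → ℝ))
    (g : LaurentPoly A n) (N : ℕ) (h : Series A n) :
    laplaceTerm Δ g N h = ∑ k ∈ (PowerSeries.coeff N h).coeff.support,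
      coeffAt h (N, k) • ((-1 : A) ^ N • omegaIn Δ g (N, k)) := by
  rfl

lemma laplaceTerm_mem {A : Type*} [CommRing A] {n : ℕ} (p : ℕ) (Δ : Set (Fin n → ℝ))
    (g : LaurentPoly A n) (N s : ℕ) (h : Series A n)
    (hh : ∀ k, (p : A) ^ s ∣ coeffAt h (N, k)) :
    laplaceTerm Δ g N h ∈
      (Ideal.span {(p : A)} ^ s • ⊤ : Submodule A (Omega Δ g)) := by
  rw [laplaceTerm_apply]
  refine Submodule.sum_mem _ fun k _ => Submodule.smul_mem_smul ?_ trivial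
  rw [Ideal.span_singleton_pow, Ideal.mem_span_singleton]
  exact hh k

lemma laplace_finite {A : Type*} [CommRing A] {n : ℕ} (p : ℕ) (Δ : Set (Fin n → ℝ))
    (g : LaurentPoly A n) (s : ℕ) (h : Series A n) (hh : h ∈ nullSeries p A n) :
    (Function.support fun N => (Ideal.span {(p : A)} ^ s • ⊤ : Submodule A (Omega Δ g)).mkQ
      (laplaceTerm Δ g N h)).Finite := by
  obtain ⟨N₀, hN₀⟩ := hh s
  refine (Set.finite_lt_nat N₀).subset fun N hN => ?_
  by_contra hlt
  refine hN ((Submodule.Quotient.mk_eq_zero _).2 (laplaceTerm_mem p Δ g N s h fun k => ?_))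
  exact hN₀ (N, k) (not_lt.1 hlt)

/-- The Laplace transform modulo `p^s`. -/
def laplaceMod (p : ℕ) {A : Type*} [CommRing A] {n : ℕ} (Δ : Set (Fin n → ℝ))
    (g : LaurentPoly A n) (s : ℕ) : completedSeriesPlus p A Δ →ₗ[A]
      (Omega Δ g ⧸ (Ideal.span {(p : A)} ^ s • ⊤ : Submodule A (Omega Δ g))) where
  toFun h := ∑ᶠ N, (Ideal.span {(p : A)} ^ s • ⊤ : Submodule A (Omega Δ g)).mkQ
    (laplaceTerm Δ g N h)
  map_add' h₁ h₂ := by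
    rw [← finsum_add_distrib (laplace_finite p Δ g s _ h₁.2.2) (laplace_finite p Δ g s _ h₂.2.2)]
    simp only [Submodule.coe_add, map_add]
  map_smul' c h := by
    rw [RingHom.id_apply, smul_finsum' c (laplace_finite p Δ g s _ h.2.2)]
    simp only [Submodule.coe_smul, map_smul]

/-- The `A`-linear extension `∑ a_u X^u ↦ ∑ a_u (-1)^{u₀} ω_u` of the Laplace transform to the
`p`-adic completions. -/
def laplace (p : ℕ) {A : Type*} [CommRing A] {n : ℕ} (Δ : Set (Fin n → ℝ))
    (g : LaurentPoly A n) : completedSeriesPlus p A Δ →ₗ[A] PCompletion p A (Omega Δ g) :=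
  AdicCompletion.lift (Ideal.span {(p : A)}) (fun s => laplaceMod p Δ g s) (by
    intro s t hst
    ext h
    change AdicCompletion.transitionMap _ _ hst (∑ᶠ N, _) = ∑ᶠ N, _
    have := (AdicCompletion.transitionMap (Ideal.span {(p : A)}) (Omega Δ g) hst).toAddMonoidHom.map_finsum
      (laplace_finite p Δ g t h h.2.2)
    exact this)

/-! ### Formal expansion at a vertex -/

/-- `b` is a vertex of the lattice polytope `Δ`, the support of `g` lies in `Δ`, and the
coefficient of `g` at `x^b` is a unit. -/
structure IsUnitVertex {A : Type*} [CommRing A] {n : ℕ} (Δ : Set (Fin n → ℝ))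
    (g : LaurentPoly A n) (b : Fin n → ℤ) : Prop where
  polytope : ∃ S : Finset (Fin n → ℤ), Δ = convexHull ℝ (toReal '' (S : Set (Fin n → ℤ)))
  support_subset : ∀ a, g.coeff a ≠ 0 → toReal a ∈ Δ
  vertex : toReal b ∈ Δ.extremePoints ℝ
  unit : IsUnit (g.coeff b)

lemma IsUnitVertex.of_newtonPolytope {A : Type*} [CommRing A] {n : ℕ} {g : LaurentPoly A n}
    {b : Fin n → ℤ} (hb : toReal b ∈ (newtonPolytope g).extremePoints ℝ)
    (hu : IsUnit (g.coeff b)) : IsUnitVertex (newtonPolytope g) g b where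
  polytope := ⟨g.coeff.support, rfl⟩
  support_subset a ha := subset_convexHull ℝ _ ⟨a, Finsupp.mem_support_iff.2 ha, rfl⟩
  vertex := hb
  unit := hu

lemma IsUnitVertex.map {A B : Type*} [CommRing A] [CommRing B] {n : ℕ} {Δ : Set (Fin n → ℝ)}
    {g : LaurentPoly A n} {b : Fin n → ℤ} (h : IsUnitVertex Δ g b) (σ : A →+* B) :
    IsUnitVertex Δ (mapCoeff σ g) b where
  polytope := h.polytope
  support_subset a ha := by
    refine h.support_subset a fun h0 => ha ?_
    simp [mapCoeff, h0]
  vertex := h.vertex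
  unit := by
    have := h.unit.map σ
    simpa [mapCoeff] using this

/-- `Ω_formal`: formal Laurent series `∑ a_k x^k` with support in `C(Δ - b)`. -/
def OmegaFormal (A : Type*) [CommRing A] {n : ℕ} (Δ : Set (Fin n → ℝ)) (b : Fin n → ℤ) :
    Submodule A ((Fin n → ℤ) → A) where
  carrier := {φ | ∀ k, φ k ≠ 0 → toReal k ∈ tangentCone Δ b}
  zero_mem' := fun k hk => absurd rfl hk
  add_mem' := by
    intro φ ψ hφ hψ k hk
    by_cases h0 : φ k = 0
    · exact hψ k fun h0' => hk (by simp [h0, h0'])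
    · exact hφ k h0
  smul_mem' := fun c φ hφ k hk => hφ k fun h0 => hk (by simp [h0])

/-- The Cartier operator `∑ a_k x^k ↦ ∑ a_{pk} x^k` on `Ω_formal`. -/
def cartierFormal (p : ℕ) [hp : Fact p.Prime] (A : Type*) [CommRing A] {n : ℕ}
    (Δ : Set (Fin n → ℝ)) (b : Fin n → ℤ) : OmegaFormal A Δ b →ₗ[A] OmegaFormal A Δ b where
  toFun φ := ⟨fun k => φ.1 (p • k), by
    intro k hk
    obtain ⟨r, hr, v, hv, e⟩ := φ.2 (p • k) hk
    have hp0 : (p : ℝ) ≠ 0 := Nat.cast_ne_zero.2 hp.out.ne_zero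
    refine ⟨(p : ℝ)⁻¹ * r, by positivity, v, hv, ?_⟩
    rw [mul_smul, ← e]
    funext i
    simp [toReal, hp0]⟩
  map_add' _ _ := rfl
  map_smul' _ _ := rfl

/-- Multiplication of (arbitrarily supported) formal Laurent series by Laurent polynomials:
`x^a` sends `∑ φ_k x^k` to `∑ φ_{k-a} x^k`. -/
def act {A : Type*} [CommRing A] {n : ℕ} :
    LaurentPoly A n →ₐ[A] Module.End A ((Fin n → ℤ) → A) :=
  AddMonoidAlgebra.lift A (Module.End A ((Fin n → ℤ) → A)) (Fin n → ℤ)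
    { toFun := fun a => LinearMap.funLeft A A fun k => k - a.toAdd
      map_one' := by ext; simp [LinearMap.funLeft]
      map_mul' := fun a b => by
        ext φ k
        simp [LinearMap.funLeft, sub_sub] }

lemma act_apply {A : Type*} [CommRing A] {n : ℕ} (g : LaurentPoly A n) (φ : (Fin n → ℤ) → A)
    (k : Fin n → ℤ) : act g φ k = ∑ a ∈ g.coeff.support, g.coeff a * φ (k - a) := by
  rw [act, AddMonoidAlgebra.lift_apply, Finsupp.sum]
  simp [LinearMap.sum_apply, LinearMap.funLeft]

lemma toReal_injective (n : ℕ) : Function.Injective (toReal (n := n)) := by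
  intro k l h
  funext i
  have := congrFun h i
  simpa [toReal] using this

lemma toReal_sub {n : ℕ} (k l : Fin n → ℤ) : toReal (k - l) = toReal k - toReal l := by
  funext i; simp [toReal]

lemma toReal_add {n : ℕ} (k l : Fin n → ℤ) : toReal (k + l) = toReal k + toReal l := by
  funext i; simp [toReal]

section Expansion

variable {A : Type*} [CommRing A] {n : ℕ} {Δ : Set (Fin n → ℝ)} {g : LaurentPoly A n}
  {b : Fin n → ℤ}

lemma IsUnitVertex.exists_weight (h : IsUnitVertex Δ g b) :
    ∃ (w : (Fin n → ℝ) →ₗ[ℝ] ℝ) (ε : ℝ), 0 < ε ∧ (∀ v ∈ Δ, 0 ≤ w (v - toReal b)) ∧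
      ∀ a, g.coeff a ≠ 0 → a ≠ b → ε ≤ w (toReal a - toReal b) := by
  classical
  obtain ⟨S, hS⟩ := h.polytope
  have hconv : Convex ℝ Δ := hS ▸ convex_convexHull ℝ _
  let T : Set (Fin n → ℝ) := toReal '' (((S ∪ g.coeff.support).erase b : Finset _) : Set _)
  have hTfin : T.Finite := (Finset.finite_toSet _).image _
  have hTsub : T ⊆ Δ \ {toReal b} := by
    rintro _ ⟨a, ha, rfl⟩
    obtain ⟨hab, ha⟩ := Finset.mem_erase.1 (Finset.mem_coe.1 ha)
    refine ⟨?_, fun e => hab (toReal_injective n e)⟩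
    rcases Finset.mem_union.1 ha with ha | ha
    · exact hS ▸ subset_convexHull ℝ _ ⟨a, ha, rfl⟩
    · exact h.support_subset a (Finsupp.mem_support_iff.1 ha)
  have hb : toReal b ∉ convexHull ℝ T := fun hmem =>
    (convexHull_min hTsub (hconv.mem_extremePoints_iff_convex_sdiff.1 h.vertex).2 hmem).2 rfl
  obtain ⟨w, u, hwb, hwT⟩ := geometric_hahn_banach_point_closed (convex_convexHull ℝ T)
    (hTfin.isClosed_convexHull ℝ) hb
  refine ⟨w.toLinearMap, u - w (toReal b), sub_pos.2 hwb, ?_, ?_⟩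
  · have hsub : Δ ⊆ {v | w (toReal b) ≤ w v} := by
      rw [hS]
      refine convexHull_min ?_ (convex_halfSpace_ge w.toLinearMap.isLinear _)
      rintro _ ⟨a, ha, rfl⟩
      by_cases hab : a = b
      · simp [hab]
      · refine (hwb.trans (hwT _ (subset_convexHull ℝ T ⟨a, ?_, rfl⟩))).le
        simpa [hab] using Or.inl ha
    intro v hv
    have := hsub hv
    simpa using this
  · intro a ha hab
    have := hwT _ (subset_convexHull ℝ T ⟨a, by simp [hab, ha], rfl⟩)
    simp only [ContinuousLinearMap.coe_coe, map_sub]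
    linarith

/-- If every exponent of `l` has weight at least `ε` and every exponent of `φ` has weight at least
`c`, then every exponent of `l^j φ` has weight at least `c + j ε`. -/
lemma act_pow_eq_zero (w : (Fin n → ℝ) →ₗ[ℝ] ℝ) (ε c : ℝ) (l : LaurentPoly A n)
    (hl : ∀ a, l.coeff a ≠ 0 → ε ≤ w (toReal a)) (φ : (Fin n → ℤ) → A)
    (hφ : ∀ k, φ k ≠ 0 → c ≤ w (toReal k)) (j : ℕ) :
    ∀ k, w (toReal k) < c + j * ε → act (l ^ j) φ k = 0 := by
  induction j with
  | zero =>
    intro k hk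
    by_contra h0
    have := hφ k (by simpa using h0)
    simp at hk
    linarith
  | succ j ih =>
    intro k hk
    rw [pow_succ', map_mul, Module.End.mul_apply, act_apply]
    refine Finset.sum_eq_zero fun a ha => ?_
    have h1 := hl a (Finsupp.mem_support_iff.1 ha)
    rw [ih, mul_zero]
    rw [toReal_sub, map_sub]
    push_cast at hk
    linarith

lemma act_single_apply (a : Fin n → ℤ) (r : A) (φ : (Fin n → ℤ) → A) (k : Fin n → ℤ) :
    act (AddMonoidAlgebra.single a r) φ k = r * φ (k - a) := by
  simp [act, LinearMap.funLeft]

/-- `g = c x^b (1 - l)` where `c` is a unit and `l` has exponents of positive weight. -/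
lemma IsUnitVertex.exists_factor (h : IsUnitVertex Δ g b) :
    ∃ (w : (Fin n → ℝ) →ₗ[ℝ] ℝ) (ε : ℝ) (l : LaurentPoly A n) (c d : A),
      0 < ε ∧ (∀ v ∈ Δ, 0 ≤ w (v - toReal b)) ∧ c * d = 1 ∧
      (∀ a, l.coeff a ≠ 0 → ε ≤ w (toReal a)) ∧ (∀ a, l.coeff a ≠ 0 → toReal (a + b) ∈ Δ) ∧
      AddMonoidAlgebra.single (-b) d * g = 1 - l := by
  obtain ⟨w, ε, hε, hΔ, hg⟩ := h.exists_weight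
  obtain ⟨c, hc⟩ := h.unit
  have hl : ∀ a, (1 - AddMonoidAlgebra.single (-b) ((c⁻¹ : Aˣ) : A) * g).coeff a
      = if a = 0 then 0 else - (((c⁻¹ : Aˣ) : A) * g.coeff (a + b)) := by
    intro a
    rw [AddMonoidAlgebra.coeff_sub, Finsupp.sub_apply,
      AddMonoidAlgebra.coeff_single_mul_eq_mul_coeff (a + b) (by
        intro m _; constructor
        · rintro rfl; abel
        · rintro rfl; abel)]
    by_cases ha : a = 0
    · subst ha
      simp [AddMonoidAlgebra.one_def, ← hc]
    · simp [AddMonoidAlgebra.one_def, ha]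
  have hl' : ∀ a, (1 - AddMonoidAlgebra.single (-b) ((c⁻¹ : Aˣ) : A) * g).coeff a ≠ 0 →
      a ≠ 0 ∧ g.coeff (a + b) ≠ 0 := by
    intro a ha
    rw [hl a] at ha
    split_ifs at ha with h0
    · exact absurd rfl ha
    · exact ⟨h0, fun h1 => ha (by rw [h1]; simp)⟩
  refine ⟨w, ε, 1 - AddMonoidAlgebra.single (-b) ((c⁻¹ : Aˣ) : A) * g, c, ((c⁻¹ : Aˣ) : A), hε, hΔ,
    by simp, ?_, ?_, by abel⟩
  · intro a ha
    obtain ⟨h0, h1⟩ := hl' a ha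
    have := hg (a + b) h1 (by simpa using h0)
    simpa [toReal_add] using this
  · intro a ha
    exact h.support_subset _ (hl' a ha).2

lemma tangentCone_add (hΔ : Convex ℝ Δ) {x y : Fin n → ℝ} (hx : x ∈ tangentCone Δ b)
    (hy : y ∈ tangentCone Δ b) : x + y ∈ tangentCone Δ b := by
  obtain ⟨r, hr, v, hv, rfl⟩ := hx
  obtain ⟨s, hs, u, hu, rfl⟩ := hy
  rcases (add_nonneg hr hs).eq_or_lt with h0 | h0
  · have hr0 : r = 0 := by linarith
    have hs0 : s = 0 := by linarith
    exact ⟨0, le_rfl, v, hv, by simp [hr0, hs0]⟩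
  · refine ⟨r + s, h0.le, (r / (r + s)) • v + (s / (r + s)) • u,
      hΔ hv hu (by positivity) (by positivity) (by field_simp), ?_⟩
    funext i
    simp
    field_simp
    ring

lemma act_mem (hΔ : Convex ℝ Δ) (l : LaurentPoly A n)
    (hl : ∀ a, l.coeff a ≠ 0 → toReal a ∈ tangentCone Δ b) {φ : (Fin n → ℤ) → A}
    (hφ : φ ∈ OmegaFormal A Δ b) : act l φ ∈ OmegaFormal A Δ b := by
  intro k hk
  rw [act_apply] at hk
  obtain ⟨a, ha, h0⟩ := Finset.exists_ne_zero_of_sum_ne_zero hk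
  have h1 := hl a (Finsupp.mem_support_iff.1 ha)
  have h2 := hφ (k - a) fun h => h0 (by rw [h, mul_zero])
  have := tangentCone_add hΔ h1 h2
  rwa [← toReal_add, add_sub_cancel] at this

/-- The series whose exponents have weight bounded from below. -/
def boundedSeries (A : Type*) [CommRing A] {n : ℕ} (w : (Fin n → ℝ) →ₗ[ℝ] ℝ) :
    Submodule A ((Fin n → ℤ) → A) where
  carrier := {φ | ∃ c : ℝ, ∀ k, φ k ≠ 0 → c ≤ w (toReal k)}
  zero_mem' := ⟨0, fun k hk => absurd rfl hk⟩
  add_mem' := by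
    rintro φ ψ ⟨c, hc⟩ ⟨d, hd⟩
    refine ⟨min c d, fun k hk => ?_⟩
    by_cases h0 : φ k = 0
    · exact (min_le_right _ _).trans (hd k fun h0' => hk (by simp [h0, h0']))
    · exact (min_le_left _ _).trans (hc k h0)
  smul_mem' := fun r φ ⟨c, hc⟩ => ⟨c, fun k hk => hc k fun h0 => hk (by simp [h0])⟩

lemma act_boundedSeries (w : (Fin n → ℝ) →ₗ[ℝ] ℝ) (q : LaurentPoly A n)
    {φ : (Fin n → ℤ) → A} (hφ : φ ∈ boundedSeries A w) : act q φ ∈ boundedSeries A w := by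
  have e : act q φ = ∑ a ∈ q.coeff.support,
      act (AddMonoidAlgebra.single a (q.coeff a)) φ := by
    funext k
    rw [act_apply, Finset.sum_apply]
    simp only [act_single_apply]
  rw [e]
  refine Submodule.sum_mem _ fun a _ => ?_
  obtain ⟨c, hc⟩ := hφ
  refine ⟨c + w (toReal a), fun k hk => ?_⟩
  rw [act_single_apply] at hk
  have := hc (k - a) fun h0 => hk (by rw [h0, mul_zero])
  rw [toReal_sub, map_sub] at this
  linarith

lemma polynomial_mem_boundedSeries (w : (Fin n → ℝ) →ₗ[ℝ] ℝ) (q : LaurentPoly A n) :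
    (fun k => q.coeff k) ∈ boundedSeries A w := by
  obtain ⟨c, hc⟩ := (q.coeff.support.image fun k => w (toReal k)).bddBelow
  exact ⟨c, fun k hk => hc (Finset.mem_coe.2 (Finset.mem_image_of_mem _
    (Finsupp.mem_support_iff.2 hk)))⟩

lemma formal_mem_boundedSeries (w : (Fin n → ℝ) →ₗ[ℝ] ℝ)
    (hw : ∀ v ∈ Δ, 0 ≤ w (v - toReal b)) {φ : (Fin n → ℤ) → A} (hφ : φ ∈ OmegaFormal A Δ b) :
    φ ∈ boundedSeries A w := by
  refine ⟨0, fun k hk => ?_⟩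
  obtain ⟨r, hr, v, hv, e⟩ := hφ k hk
  rw [e, map_smul, smul_eq_mul]
  exact mul_nonneg hr (hw v hv)

/-- Multiplication by `1 - l` is injective on series with exponents of bounded weight. -/
lemma act_one_sub_injective (w : (Fin n → ℝ) →ₗ[ℝ] ℝ) (ε : ℝ) (hε : 0 < ε)
    (l : LaurentPoly A n) (hl : ∀ a, l.coeff a ≠ 0 → ε ≤ w (toReal a))
    {φ : (Fin n → ℤ) → A} (hφ : φ ∈ boundedSeries A w) (h0 : act (1 - l) φ = 0) : φ = 0 := by
  obtain ⟨c, hc⟩ := hφ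
  have h1 : act l φ = φ := by
    rw [map_sub, map_one, LinearMap.sub_apply, Module.End.one_apply, sub_eq_zero] at h0
    exact h0.symm
  have h2 : ∀ j : ℕ, act (l ^ j) φ = φ := by
    intro j
    induction j with
    | zero => simp
    | succ j ih => rw [pow_succ', map_mul, Module.End.mul_apply, ih, h1]
  funext k
  obtain ⟨j, hj⟩ := exists_nat_gt ((w (toReal k) - c) / ε)
  rw [div_lt_iff₀ hε] at hj
  rw [← h2 j]
  exact act_pow_eq_zero w ε c l hl φ hc j k (by linarith)

/-- Multiplication by `1 - l` is surjective on `Ω_formal`: the inverse is the geometric series. -/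
lemma act_one_sub_surjective (hΔ : Convex ℝ Δ) (w : (Fin n → ℝ) →ₗ[ℝ] ℝ) (ε : ℝ) (hε : 0 < ε)
    (hw : ∀ v ∈ Δ, 0 ≤ w (v - toReal b)) (l : LaurentPoly A n)
    (hl : ∀ a, l.coeff a ≠ 0 → ε ≤ w (toReal a))
    (hl' : ∀ a, l.coeff a ≠ 0 → toReal a ∈ tangentCone Δ b)
    {φ : (Fin n → ℤ) → A} (hφ : φ ∈ OmegaFormal A Δ b) :
    ∃ ψ ∈ OmegaFormal A Δ b, act (1 - l) ψ = φ := by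
  have hφ0 : ∀ k, φ k ≠ 0 → 0 ≤ w (toReal k) := by
    intro k hk
    obtain ⟨r, hr, v, hv, e⟩ := hφ k hk
    rw [e, map_smul, smul_eq_mul]
    exact mul_nonneg hr (hw v hv)
  have hvan : ∀ (j : ℕ) k, w (toReal k) < j * ε → act (l ^ j) φ k = 0 := fun j k hk =>
    act_pow_eq_zero w ε 0 l hl φ hφ0 j k (by simpa using hk)
  have hmem : ∀ j : ℕ, act (l ^ j) φ ∈ OmegaFormal A Δ b := by
    intro j
    induction j with
    | zero => simpa using hφ
    | succ j ih =>
      rw [pow_succ', map_mul, Module.End.mul_apply]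
      exact act_mem hΔ l hl' ih
  let J : (Fin n → ℤ) → ℕ := fun k => ⌊w (toReal k) / ε⌋₊ + 1
  have hJ : ∀ k, ∀ j, J k ≤ j → act (l ^ j) φ k = 0 := by
    intro k j hj
    refine hvan j k ?_
    have h1 := Nat.lt_floor_add_one (w (toReal k) / ε)
    rw [div_lt_iff₀ hε] at h1
    refine h1.trans_le (mul_le_mul_of_nonneg_right ?_ hε.le)
    exact_mod_cast hj
  let ψ : (Fin n → ℤ) → A := fun k => ∑ j ∈ Finset.range (J k), act (l ^ j) φ k
  have hψ : ∀ k m, J k ≤ m → ψ k = act (∑ j ∈ Finset.range m, l ^ j) φ k := by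
    intro k m hm
    rw [map_sum, LinearMap.sum_apply, Finset.sum_apply]
    refine Finset.sum_subset (Finset.range_mono hm) fun j _ hj => hJ k j ?_
    simpa using hj
  refine ⟨ψ, ?_, ?_⟩
  · intro k hk
    obtain ⟨j, _, hj⟩ := Finset.exists_ne_zero_of_sum_ne_zero hk
    exact hmem j k hj
  · funext k
    let m := (J k) + ∑ a ∈ (1 - l).coeff.support, J (k - a)
    have e1 : act (1 - l) ψ k = act (1 - l) (act (∑ j ∈ Finset.range m, l ^ j) φ) k := by
      rw [act_apply, act_apply]
      refine Finset.sum_congr rfl fun a ha => ?_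
      rw [hψ (k - a) m]
      exact (Finset.single_le_sum (f := fun a => J (k - a)) (fun _ _ => Nat.zero_le _) ha).trans
        (Nat.le_add_left _ _)
    rw [e1, ← Module.End.mul_apply, ← map_mul, mul_neg_geom_sum, map_sub, map_one,
      LinearMap.sub_apply, Pi.sub_apply, hJ k m (Nat.le_add_right _ _), sub_zero,
      Module.End.one_apply]

/-- `φ` is an expansion of the rational function `ω`: if `ω = q / g^m`, then `g^m φ = q`. -/
def IsExpansion (g : LaurentPoly A n) (ω : Localization.Away g) (φ : (Fin n → ℤ) → A) : Prop :=
  ∀ (m : ℕ) (q : LaurentPoly A n), ω = Localization.mk q (⟨g ^ m, m, rfl⟩ : Submonoid.powers g) →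
    act (g ^ m) φ = fun k => q.coeff k

/-- A tuple of data as in `exists_factor` shows that `g` acts injectively. -/
lemma act_injective (w : (Fin n → ℝ) →ₗ[ℝ] ℝ) (ε : ℝ) (hε : 0 < ε)
    (l : LaurentPoly A n) (d : A) (hl : ∀ a, l.coeff a ≠ 0 → ε ≤ w (toReal a))
    (hg : AddMonoidAlgebra.single (-b) d * g = 1 - l)
    {φ : (Fin n → ℤ) → A} (hφ : φ ∈ boundedSeries A w) (m : ℕ) (h0 : act (g ^ m) φ = 0) :
    φ = 0 := by
  induction m with
  | zero => simpa using h0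
  | succ m ih =>
    refine ih (act_one_sub_injective w ε hε l hl (act_boundedSeries w _ hφ) ?_)
    rw [← hg, map_mul, Module.End.mul_apply, ← Module.End.mul_apply (act g), ← map_mul,
      ← pow_succ', h0, map_zero]

lemma coeff_eq_act (q : LaurentPoly A n) :
    (fun k => q.coeff k) = act q (Pi.single 0 1) := by
  funext k
  rw [act_apply]
  by_cases hk : q.coeff k = 0
  · rw [hk]
    refine (Finset.sum_eq_zero fun a ha => ?_).symm
    by_cases hak : a = k
    · rw [hak, hk, zero_mul]
    · rw [Pi.single_eq_of_ne (sub_ne_zero.2 (Ne.symm hak)), mul_zero]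
  · rw [Finset.sum_eq_single k]
    · simp
    · intro a _ hak
      rw [Pi.single_eq_of_ne (sub_ne_zero.2 (Ne.symm hak)), mul_zero]
    · intro hk'
      exact absurd (Finsupp.mem_support_iff.2 hk) hk'

lemma IsUnitVertex.isExpansion_iff (h : IsUnitVertex Δ g b) (ω : Localization.Away g)
    {φ : (Fin n → ℤ) → A} (hφ : φ ∈ OmegaFormal A Δ b) (m : ℕ) (q : LaurentPoly A n)
    (hω : ω = Localization.mk q (⟨g ^ m, m, rfl⟩ : Submonoid.powers g)) :
    IsExpansion g ω φ ↔ act (g ^ m) φ = fun k => q.coeff k := by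
  refine ⟨fun H => H m q hω, fun H m' q' hω' => ?_⟩
  obtain ⟨w, ε, l, c, d, hε, hw, -, hl, -, hg⟩ := h.exists_factor
  rw [hω, Localization.mk_eq_mk_iff, Localization.r_iff_exists] at hω'
  obtain ⟨⟨_, j, rfl⟩, e⟩ := hω'
  simp only at e
  rw [← sub_eq_zero]
  refine act_injective w ε hε l d hl hg (sub_mem (act_boundedSeries w _
    (formal_mem_boundedSeries w hw hφ)) (polynomial_mem_boundedSeries w q')) (j + m) ?_
  rw [map_sub, sub_eq_zero, coeff_eq_act q', ← Module.End.mul_apply, ← Module.End.mul_apply,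
    ← map_mul, ← map_mul]
  have e' : g ^ (j + m) * q' = g ^ (j + m') * q := by
    rw [pow_add, pow_add, mul_assoc, mul_assoc]
    exact e.symm
  rw [e', map_mul act (g ^ (j + m')) q, Module.End.mul_apply, ← coeff_eq_act q, ← H,
    ← Module.End.mul_apply, ← map_mul]
  congr 2
  ring

lemma exists_mk (ω : Localization.Away g) : ∃ (m : ℕ) (q : LaurentPoly A n),
    ω = Localization.mk q (⟨g ^ m, m, rfl⟩ : Submonoid.powers g) := by
  induction ω using Localization.induction_on with
  | _ y =>
    obtain ⟨q, ⟨_, m, rfl⟩⟩ := y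
    exact ⟨m, q, rfl⟩

lemma IsUnitVertex.expansion_unique (h : IsUnitVertex Δ g b) (ω : Localization.Away g)
    {φ ψ : (Fin n → ℤ) → A} (hφ : φ ∈ OmegaFormal A Δ b) (hψ : ψ ∈ OmegaFormal A Δ b)
    (h₁ : IsExpansion g ω φ) (h₂ : IsExpansion g ω ψ) : φ = ψ := by
  obtain ⟨w, ε, l, c, d, hε, hw, -, hl, -, hg⟩ := h.exists_factor
  obtain ⟨m, q, hq⟩ := exists_mk ω
  rw [← sub_eq_zero]
  refine act_injective w ε hε l d hl hg (sub_mem (formal_mem_boundedSeries w hw hφ)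
    (formal_mem_boundedSeries w hw hψ)) m ?_
  rw [map_sub, h₁ m q hq, h₂ m q hq, sub_self]

lemma IsUnitVertex.isExpansion_add (h : IsUnitVertex Δ g b) {ω₁ ω₂ : Localization.Away g}
    {φ ψ : (Fin n → ℤ) → A} (hφ : φ ∈ OmegaFormal A Δ b) (hψ : ψ ∈ OmegaFormal A Δ b)
    (h₁ : IsExpansion g ω₁ φ) (h₂ : IsExpansion g ω₂ ψ) : IsExpansion g (ω₁ + ω₂) (φ + ψ) := by
  obtain ⟨m₁, q₁, e₁⟩ := exists_mk ω₁
  obtain ⟨m₂, q₂, e₂⟩ := exists_mk ω₂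
  refine (h.isExpansion_iff (ω₁ + ω₂) (add_mem hφ hψ) (m₁ + m₂) (g ^ m₁ * q₂ + g ^ m₂ * q₁) ?_).2 ?_
  · rw [e₁, e₂, Localization.add_mk]
    exact congrArg _ (Subtype.ext (pow_add g m₁ m₂).symm)
  · have e₃ : act (g ^ (m₁ + m₂)) φ = act (g ^ m₂ * q₁) (Pi.single 0 1) := by
      rw [add_comm, pow_add, map_mul, Module.End.mul_apply, h₁ m₁ q₁ e₁, coeff_eq_act, map_mul,
        Module.End.mul_apply]
    have e₄ : act (g ^ (m₁ + m₂)) ψ = act (g ^ m₁ * q₂) (Pi.single 0 1) := by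
      rw [pow_add, map_mul, Module.End.mul_apply, h₂ m₂ q₂ e₂, coeff_eq_act, map_mul,
        Module.End.mul_apply]
    rw [map_add, e₃, e₄, coeff_eq_act, map_add act, LinearMap.add_apply, add_comm]

lemma IsUnitVertex.isExpansion_smul (h : IsUnitVertex Δ g b) (r : A) {ω : Localization.Away g}
    {φ : (Fin n → ℤ) → A} (hφ : φ ∈ OmegaFormal A Δ b)
    (h₁ : IsExpansion g ω φ) : IsExpansion g (r • ω) (r • φ) := by
  obtain ⟨m, q, e⟩ := exists_mk ω
  refine (h.isExpansion_iff (r • ω) (Submodule.smul_mem _ r hφ) m (r • q) ?_).2 ?_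
  · rw [e, Localization.smul_mk]
  · rw [map_smul, h₁ m q e]
    rfl

lemma IsUnitVertex.exists_expansion (h : IsUnitVertex Δ g b) (ω : Localization.Away g)
    (hω : ω ∈ Omega Δ g) : ∃ φ ∈ OmegaFormal A Δ b, IsExpansion g ω φ := by
  have hconv : Convex ℝ Δ := by
    obtain ⟨S, hS⟩ := h.polytope
    exact hS ▸ convex_convexHull ℝ _
  induction hω using Submodule.span_induction with
  | zero =>
    refine ⟨0, zero_mem _, (h.isExpansion_iff 0 (zero_mem _) 0 0 ?_).2 ?_⟩
    · rw [Localization.mk_zero]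
    · rw [map_zero]; rfl
  | add ω₁ ω₂ _ _ h₁ h₂ =>
    obtain ⟨φ, hφ, hφ'⟩ := h₁
    obtain ⟨ψ, hψ, hψ'⟩ := h₂
    exact ⟨φ + ψ, add_mem hφ hψ, h.isExpansion_add hφ hψ hφ' hψ'⟩
  | smul r ω _ h₁ =>
    obtain ⟨φ, hφ, hφ'⟩ := h₁
    exact ⟨r • φ, Submodule.smul_mem _ r hφ, h.isExpansion_smul r hφ hφ'⟩
  | mem ω hω =>
    obtain ⟨⟨N, k⟩, ⟨⟨r, hr, v, hv, huv⟩, -⟩, rfl⟩ := hω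
    simp only [Prod.smul_mk, Prod.mk.injEq, smul_eq_mul, mul_one] at huv
    obtain ⟨rfl, hk⟩ := huv
    obtain ⟨w, ε, l, c, d, hε, hw, hcd, hl, hl', hg⟩ := h.exists_factor
    have hl'' : ∀ a, l.coeff a ≠ 0 → toReal a ∈ tangentCone Δ b := fun a ha =>
      ⟨1, zero_le_one, toReal (a + b), hl' a ha, by rw [toReal_add]; simp⟩
    have hmono : ∀ r : A, act (AddMonoidAlgebra.single (k - N • b) r) (Pi.single 0 1) ∈
        OmegaFormal A Δ b := by
      intro r k' hk'
      rw [act_single_apply] at hk'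
      have hk0 : k' - (k - N • b) = 0 := by
        by_contra h0
        exact hk' (by rw [Pi.single_eq_of_ne h0, mul_zero])
      refine ⟨N, Nat.cast_nonneg N, v, hv, ?_⟩
      rw [sub_eq_zero.1 hk0, smul_sub, ← hk]
      funext i
      simp [toReal]
    have hpow : ∀ (j : ℕ), ∀ φ ∈ OmegaFormal A Δ b,
        ∃ ψ ∈ OmegaFormal A Δ b, act ((1 - l) ^ j) ψ = φ := by
      intro j
      induction j with
      | zero => exact fun φ hφ => ⟨φ, hφ, by simp⟩
      | succ j ih =>
        intro φ hφ
        obtain ⟨ψ, hψ, e⟩ := ih φ hφ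
        obtain ⟨χ, hχ, e'⟩ := act_one_sub_surjective hconv w ε hε hw l hl hl'' hψ
        exact ⟨χ, hχ, by rw [pow_succ, map_mul, Module.End.mul_apply, e', e]⟩
    obtain ⟨ψ, hψ, e⟩ := hpow N _ (hmono (d ^ N * ((N - 1).factorial : A)))
    have hgN : g ^ N = AddMonoidAlgebra.single (N • b) (c ^ N) * (1 - l) ^ N := by
      rw [← AddMonoidAlgebra.single_pow, ← mul_pow, ← hg, ← mul_assoc,
        AddMonoidAlgebra.single_mul_single, hcd, add_neg_cancel, ← AddMonoidAlgebra.one_def,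
        one_mul]
    refine ⟨ψ, hψ, (h.isExpansion_iff _ hψ N
      (AddMonoidAlgebra.single k ((N - 1).factorial : A)) ?_).2 ?_⟩
    · rw [omega, Localization.smul_mk, AddMonoidAlgebra.smul_single, smul_eq_mul, mul_one]
    · rw [hgN, map_mul, Module.End.mul_apply, e, coeff_eq_act, ← Module.End.mul_apply, ← map_mul,
        AddMonoidAlgebra.single_mul_single, ← mul_assoc, ← mul_pow, hcd, one_pow, one_mul,
        add_sub_cancel]

/-- The formal expansion at the vertex `b`: the linear map that sends `ω = q / g^m` in `Ω_g` to
the unique series `φ` in `Ω_formal` with `g^m φ = q`. -/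
def expansion (h : IsUnitVertex Δ g b) : Omega Δ g →ₗ[A] OmegaFormal A Δ b where
  toFun ω := ⟨(h.exists_expansion ω ω.2).choose, (h.exists_expansion ω ω.2).choose_spec.1⟩
  map_add' ω₁ ω₂ := by
    have s := fun ω : Omega Δ g => (h.exists_expansion ω ω.2).choose_spec
    exact Subtype.ext (h.expansion_unique _ (s _).1 (add_mem (s ω₁).1 (s ω₂).1) (s _).2
      (h.isExpansion_add (s ω₁).1 (s ω₂).1 (s ω₁).2 (s ω₂).2))
  map_smul' r ω := by
    have s := fun ω : Omega Δ g => (h.exists_expansion ω ω.2).choose_spec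
    exact Subtype.ext (h.expansion_unique _ (s _).1 (Submodule.smul_mem _ r (s ω).1) (s _).2
      (h.isExpansion_smul r (s ω).1 (s ω).2))

lemma expansion_spec (h : IsUnitVertex Δ g b) (ω : Omega Δ g) :
    IsExpansion g (ω : Localization.Away g) (expansion h ω : (Fin n → ℤ) → A) :=
  (h.exists_expansion ω ω.2).choose_spec.2

end Expansion

/-- The formal expansion extended to the `p`-adic completions (`Ω_formal` is `p`-adically complete
when the coefficient ring is). -/
def completedExpansion (p : ℕ) {A : Type*} [CommRing A] {n : ℕ} {Δ : Set (Fin n → ℝ)}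
    {g : LaurentPoly A n} {b : Fin n → ℤ} (h : IsUnitVertex Δ g b)
    (ω : PCompletion p A (Omega Δ g)) : PCompletion p A (OmegaFormal A Δ b) :=
  AdicCompletion.map (Ideal.span {(p : A)}) (expansion h) ω

/-- The Cartier operator on the `p`-adic completion of `Ω_formal`. -/
def completedCartierFormal (p : ℕ) [Fact p.Prime] {A : Type*} [CommRing A] {n : ℕ}
    {Δ : Set (Fin n → ℝ)} {b : Fin n → ℤ} (φ : PCompletion p A (OmegaFormal A Δ b)) :
    PCompletion p A (OmegaFormal A Δ b) :=
  AdicCompletion.map (Ideal.span {(p : A)}) (cartierFormal p A Δ b) φ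

/-- `C` is the Cartier operator from the completion of `Ω_{g₁}` to that of `Ω_{g₂}`: on formal
expansions at the vertex `b` it is the operator `∑ a_k x^k ↦ ∑ a_{pk} x^k`. -/
def IsCartierOperator (p : ℕ) [Fact p.Prime] {A : Type*} [CommRing A] {n : ℕ}
    {Δ : Set (Fin n → ℝ)} {g₁ g₂ : LaurentPoly A n} {b : Fin n → ℤ}
    (h₁ : IsUnitVertex Δ g₁ b) (h₂ : IsUnitVertex Δ g₂ b)
    (C : PCompletion p A (Omega Δ g₁) →ₗ[A] PCompletion p A (Omega Δ g₂)) : Prop :=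
  ∀ ω, completedExpansion p h₂ (C ω) = completedCartierFormal p (completedExpansion p h₁ ω)

end DworkCrystal

end

open DworkCrystal

noncomputable section

namespace DworkCrystal

/-! ### Valuations of rational numbers -/

section Valuation

/-! Write f^σ(x^p) = f^p + p g, which is possible because σ lifts Frobenius. Carrying e^{-F^σ}
through V_p turns it into exp(x₀^p f^σ(x^p)/p), so the operator is V_p after multiplication by E(x₀
f) exp(x₀^p g), where E(t) = exp(t + t^p/p) = ∑ c_i t^i. Hence its only denominators sit in the
rationals (-p)^N c_i / j! with i + p j ≤ p N (`coeff_dworkOperator`). A Dwork-type estimate of c_i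
(`truncExpCoeff_val`) shows that for p > 2 these have valuation at least N/6 (`dworkCoeff_val`). So
they lie in R, tend to 0 with N, and are divisible by p for N > 0; this gives integrality,
divisibility by p and stability of the completed modules. The commutation relation is formal: e^F
conjugates the twisted derivatives into θ_i, and V_p θ_i = p θ_i V_p.

The Laplace transform kills the image of the twisted derivative of index 0 because the partial sums
telescope. Conversely, suppose that ∑ (-1)^N (N-1)! h_N / g^N has zero expansion at the vertex. Its
partial sum up to M is then minus a tail divisible by M!, and dividing the numerators of the partial
sums by M! yields, up to sign, the coefficients of a preimage of h (`exists_twistedDeriv_eq`).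
Together with surjectivity (`laplace_surjective`) this makes the completed expansion injective
(`completedExpansion_injective`), so the Cartier operator is unique and identities may be tested on
expansions.

For the comparison put ψ_m = h_m / f^m, as formal series. In the transform of the image of h, the
sum over powers of p g is a binomial series: it replaces powers of f^σ(x^p) by powers of f^σ(x^p) -
p g = f^p, and these cancel. What remains in front of the Cartier image of ψ_m is the p-adic sum
∑_{M ≥ 0} p^{M+1} M! c_{p(M+1)-m}. The recurrence k c_k = c_{k-1} + c_{k-p} makes it telescope to p
(-1)^m (m-1)! (`sum_gaussTerm_val`), which is p times the Laplace coefficient of ψ_m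
(`completedExpansion_laplace_eq`). -/

/-- The `p`-adic valuation of `q` is at least `z`. -/
def ValGE (p : ℕ) (z : ℤ) (q : ℚ) : Prop := padicNorm p q ≤ (p : ℚ) ^ (-z)

namespace ValGE

variable {p : ℕ} [hp : Fact p.Prime] {z z₁ z₂ : ℤ} {q q₁ q₂ : ℚ}

lemma mono (h : ValGE p z₁ q) (hz : z₂ ≤ z₁) : ValGE p z₂ q :=
  h.trans (zpow_le_zpow_right₀ (by exact_mod_cast hp.out.one_lt.le) (by omega))

lemma zero (z : ℤ) : ValGE p z 0 := by
  unfold ValGE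
  rw [padicNorm.zero]
  positivity

lemma add (h₁ : ValGE p z q₁) (h₂ : ValGE p z q₂) : ValGE p z (q₁ + q₂) :=
  padicNorm.nonarchimedean.trans (max_le h₁ h₂)

lemma neg (h : ValGE p z q) : ValGE p z (-q) := by
  unfold ValGE
  rwa [padicNorm.neg]

lemma sub (h₁ : ValGE p z q₁) (h₂ : ValGE p z q₂) : ValGE p z (q₁ - q₂) := by
  rw [sub_eq_add_neg]
  exact h₁.add h₂.neg

lemma sum {ι : Type*} {s : Finset ι} {F : ι → ℚ} (h : ∀ i ∈ s, ValGE p z (F i)) :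
    ValGE p z (∑ i ∈ s, F i) :=
  padicNorm.sum_le' h (by positivity)

lemma mul (h₁ : ValGE p z₁ q₁) (h₂ : ValGE p z₂ q₂) : ValGE p (z₁ + z₂) (q₁ * q₂) := by
  unfold ValGE at *
  rw [padicNorm.mul, neg_add, zpow_add₀ (by exact_mod_cast hp.out.ne_zero)]
  exact mul_le_mul h₁ h₂ (padicNorm.nonneg _) (by positivity)

lemma intCast (a : ℤ) : ValGE p 0 a := by
  simpa [ValGE] using padicNorm.of_int a

lemma natCast (a : ℕ) : ValGE p 0 a := by
  simpa [ValGE] using padicNorm.of_nat a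

lemma one : ValGE p 0 1 := by simpa using natCast (p := p) 1

lemma pow (h : ValGE p z q) (k : ℕ) : ValGE p (k * z) (q ^ k) := by
  induction k with
  | zero => simpa using one
  | succ k ih =>
    rw [pow_succ]
    exact (ih.mul h).mono (by push_cast; linarith)

lemma mul_int (h : ValGE p z q) (a : ℤ) : ValGE p z (a * q) := by
  simpa using (intCast a).mul h

lemma mul_nat (h : ValGE p z q) (a : ℕ) : ValGE p z (a * q) := by
  simpa using (natCast a).mul h

lemma zpow_prime (k : ℤ) : ValGE p k ((p : ℚ) ^ k) := by
  unfold ValGE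
  have h := map_zpow₀ (IsAbsoluteValue.toAbsoluteValue (padicNorm p)) (p : ℚ) k
  change padicNorm p _ = padicNorm p _ ^ k at h
  rw [h, padicNorm.padicNorm_p_of_prime, inv_zpow, zpow_neg]

lemma pow_prime (k : ℕ) : ValGE p k ((p : ℚ) ^ k) := by
  simpa using zpow_prime (p := p) k

lemma prime : ValGE p 1 (p : ℚ) := by simpa using pow_prime (p := p) 1

lemma of_prime_mul (h : ValGE p (z + 1) (p * q)) : ValGE p z q := by
  have h' := (zpow_prime (p := p) (-1)).mul h
  have hp0 : (p : ℚ) ≠ 0 := by exact_mod_cast hp.out.ne_zero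
  rw [zpow_neg_one, inv_mul_cancel_left₀ hp0] at h'
  exact h'.mono (by omega)

lemma inv_natCast {a : ℕ} (ha : a ≠ 0) : ValGE p (-(padicValNat p a : ℤ)) ((a : ℚ)⁻¹) := by
  unfold ValGE
  have ha' : (a : ℚ)⁻¹ ≠ 0 := by simpa using ha
  rw [padicNorm.eq_zpow_of_nonzero ha', padicValRat.inv, padicValRat.of_nat]

/-- The denominator b is prime to p, hence invertible in a p-adically complete ring; in this form
the bound transfers from ℚ to R. -/
lemma exists_eq {s : ℕ} (h : ValGE p s q) :
    ∃ (a : ℤ) (b : ℕ), ¬ p ∣ b ∧ q * b = p ^ s * a := by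
  by_cases hd : p ∣ q.den
  · exfalso
    have hn : ¬ (p : ℤ) ∣ q.num := by
      intro hn
      have h1 := Nat.dvd_gcd (Int.natCast_dvd.1 hn) hd
      rw [q.reduced] at h1
      exact hp.out.one_lt.ne' (Nat.dvd_one.1 h1)
    have h1 : padicNorm p q * padicNorm p (q.den : ℚ) = padicNorm p (q.num : ℚ) := by
      rw [← padicNorm.mul, Rat.mul_den_eq_num]
    rw [(padicNorm.int_eq_one_iff _).2 hn] at h1
    have h2 := (padicNorm.nat_lt_one_iff q.den).2 hd
    have h3 : padicNorm p q ≤ 1 := by simpa [ValGE] using h.mono (z₂ := 0) (by omega)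
    have h4 := padicNorm.nonneg (p := p) (q.den : ℚ)
    nlinarith [padicNorm.nonneg (p := p) q]
  · have h1 : padicNorm p q * padicNorm p (q.den : ℚ) = padicNorm p (q.num : ℚ) := by
      rw [← padicNorm.mul, Rat.mul_den_eq_num]
    rw [(padicNorm.nat_eq_one_iff _).2 hd, mul_one] at h1
    have h2 : ((p ^ s : ℕ) : ℤ) ∣ q.num := padicNorm.dvd_iff_norm_le.2 (h1 ▸ h)
    obtain ⟨a, ha⟩ := h2
    refine ⟨a, q.den, hd, ?_⟩
    rw [Rat.mul_den_eq_num, ha]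
    push_cast
    ring

/-- Fermat's little theorem, after clearing a denominator prime to p. -/
lemma pow_prime_sub_self (h : ValGE p 0 q) : ValGE p 1 (q ^ p - q) := by
  obtain ⟨a, b, hb, hab⟩ := exists_eq (s := 0) (by simpa using h)
  have hb0 : (b : ℚ) ≠ 0 := fun h0 => hb (by simp [Nat.cast_eq_zero.1 h0])
  have hq : q = a / b := by
    field_simp
    simpa using hab
  have hdvd : (p : ℤ) ∣ a ^ p * b - a * b ^ p := by
    rw [← ZMod.intCast_zmod_eq_zero_iff_dvd]
    push_cast
    rw [ZMod.pow_card, ZMod.pow_card, sub_self]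
  obtain ⟨d, hd⟩ := hdvd
  have e : q ^ p - q = p * (d * ((b ^ (p + 1) : ℕ) : ℚ)⁻¹) := by
    have hd' : (a : ℚ) ^ p * b - a * b ^ p = p * d := by exact_mod_cast hd
    rw [← mul_assoc, ← hd', hq, div_pow]
    push_cast
    field_simp
    ring
  have hv : padicValNat p (b ^ (p + 1)) = 0 :=
    padicValNat.eq_zero_of_not_dvd fun h => hb (hp.out.dvd_of_dvd_pow h)
  have h3 := inv_natCast (p := p) (a := b ^ (p + 1)) (pow_ne_zero _ (by exact_mod_cast hb0))
  rw [hv] at h3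
  rw [e]
  simpa using (prime (p := p)).mul ((intCast d).mul h3)

end ValGE

end Valuation

/-! ### The coefficients of `exp (t + t^p / p)` -/

section ExpCoeff

open PowerSeries

variable (p : ℕ) [hp : Fact p.Prime]

/-- The series `exp (t + t^p / p)`. -/
def truncExp : ℚ⟦X⟧ := exp ℚ * expand p hp.out.ne_zero (rescale (p : ℚ)⁻¹ (exp ℚ))

/-- The coefficients of `exp (t + t^p / p)`. -/
def truncExpCoeff (i : ℕ) : ℚ := coeff i (truncExp p)

/-- A bound for the denominator of the coefficients of `exp (t + t^p / p)`. -/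
def expBound (i : ℕ) : ℕ := padicValNat p (i / p ^ 2).factorial + 2 * (i / p ^ 2)

lemma padicValNat_factorial_mono {a b : ℕ} (h : a ≤ b) :
    padicValNat p a.factorial ≤ padicValNat p b.factorial :=
  (padicValNat_dvd_iff_le (b.factorial_ne_zero)).1
    (pow_padicValNat_dvd.trans (Nat.factorial_dvd_factorial h))

lemma padicValNat_factorial_add_le (a b : ℕ) :
    padicValNat p a.factorial + padicValNat p b.factorial ≤ padicValNat p (a + b).factorial := by
  rw [← padicValNat.mul a.factorial_ne_zero b.factorial_ne_zero]
  exact (padicValNat_dvd_iff_le ((a + b).factorial_ne_zero)).1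
    (pow_padicValNat_dvd.trans (Nat.factorial_mul_factorial_dvd_factorial_add a b))

lemma expBound_add_le (i j : ℕ) : expBound p i + expBound p j ≤ expBound p (i + j) := by
  unfold expBound
  have h1 : i / p ^ 2 + j / p ^ 2 ≤ (i + j) / p ^ 2 := Nat.div_add_div_le_add_div
  have h2 := padicValNat_factorial_add_le p (i / p ^ 2) (j / p ^ 2)
  have h3 := padicValNat_factorial_mono p h1
  omega

lemma expBound_mono {i j : ℕ} (h : i ≤ j) : expBound p i ≤ expBound p j := by
  obtain ⟨k, rfl⟩ := Nat.exists_eq_add_of_le h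
  exact (Nat.le_add_right _ _).trans (expBound_add_le p i k)

/-- With k = ⌊i/p²⌋, the bound at p i is at least ord((pk)!) + 2pk = ord(k!) + k + 2pk, so the claim
reduces to (p-1) ord(k!) < k, which is Legendre's formula. -/
lemma mul_expBound_lt {i : ℕ} (hi : i / p ^ 2 ≠ 0) :
    p * expBound p i + 1 ≤ expBound p (p * i) := by
  unfold expBound
  set k := i / p ^ 2 with hk
  have h1 : p * i / p ^ 2 = i / p := by
    rw [pow_two, Nat.mul_div_mul_left _ _ hp.out.pos]
  have h2 : p * k ≤ i / p := by
    rw [Nat.le_div_iff_mul_le hp.out.pos, mul_right_comm, ← pow_two, mul_comm]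
    exact Nat.div_mul_le_self i (p ^ 2)
  have h3 := padicValNat_factorial_mono p h2
  have h4 := padicValNat_factorial_mul (p := p) k
  have h5 := sub_one_mul_padicValNat_factorial_lt_of_ne_zero p hi
  rw [h1]
  obtain ⟨d, hd⟩ : ∃ d, p = d + 1 := ⟨p - 1, by have := hp.out.pos; omega⟩
  have h6 : p * padicValNat p k.factorial = (p - 1) * padicValNat p k.factorial
      + padicValNat p k.factorial := by
    rw [Nat.sub_one_mul, Nat.sub_add_cancel (Nat.le_mul_of_pos_left _ hp.out.pos)]
  rw [mul_add, h6]
  nlinarith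

/-- The ring of series whose coefficients satisfy the bound. -/
def boundedSubring : Subring ℚ⟦X⟧ where
  carrier := {F | ∀ i, ValGE p (-(expBound p i : ℤ)) (coeff i F)}
  zero_mem' := fun i => by simpa using ValGE.zero _
  one_mem' := fun i => by
    rw [coeff_one]
    split_ifs with h
    · exact ValGE.one.mono (by omega)
    · exact ValGE.zero _
  add_mem' := fun h₁ h₂ i => by simpa using (h₁ i).add (h₂ i)
  neg_mem' := fun h i => by simpa using (h i).neg
  mul_mem' := fun h₁ h₂ i => by
    rw [coeff_mul]
    refine ValGE.sum fun x hx => ?_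
    have h := Finset.HasAntidiagonal.mem_antidiagonal.1 hx
    have := expBound_add_le p x.1 x.2
    rw [h] at this
    exact ((h₁ x.1).mul (h₂ x.2)).mono (by omega)

/-- The series whose coefficients satisfy the bound with one power of `p` to spare. -/
def smallSeries : Set ℚ⟦X⟧ := {F | ∀ i, ValGE p (1 - (expBound p i : ℤ)) (coeff i F)}

variable {p}

lemma smallSeries_add {F G : ℚ⟦X⟧} (hF : F ∈ smallSeries p) (hG : G ∈ smallSeries p) :
    F + G ∈ smallSeries p := fun i => by simpa using (hF i).add (hG i)

lemma smallSeries_prime_mul {F : ℚ⟦X⟧} (hF : F ∈ boundedSubring p) :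
    (p : ℚ⟦X⟧) * F ∈ smallSeries p := fun i => by
  have e : coeff i ((p : ℚ⟦X⟧) * F) = p * coeff i F := by
    rw [← map_natCast (C (R := ℚ)), coeff_C_mul]
  rw [e]
  exact (ValGE.prime.mul (hF i)).mono (by omega)

lemma smallSeries_monomial {d : ℕ} {q : ℚ} (h : ValGE p (1 - (expBound p d : ℤ)) q) :
    monomial d q ∈ smallSeries p := fun i => by
  rw [coeff_monomial]
  split_ifs with hi
  · rwa [hi]
  · exact ValGE.zero _

lemma boundedSubring_monomial {d : ℕ} {q : ℚ} (h : ValGE p (-(expBound p d : ℤ)) q) :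
    monomial d q ∈ boundedSubring p := fun i => by
  rw [coeff_monomial]
  split_ifs with hi
  · rwa [hi]
  · exact ValGE.zero _

/-- Below degree p² the bound is 0 and Fermat's congruence supplies the extra p. Above it, the bound
grows so fast from i to p i that q^p and q are each small separately. -/
lemma bounded_pow_sub_self {i : ℕ} {q : ℚ} (h : ValGE p (-(expBound p i : ℤ)) q) :
    ValGE p (1 - (expBound p (p * i) : ℤ)) (q ^ p - q) := by
  by_cases hi : i / p ^ 2 = 0
  · have h0 : expBound p i = 0 := by simp [expBound, hi]
    rw [h0] at h
    exact (ValGE.pow_prime_sub_self (by simpa using h)).mono (by omega)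
  · have h1 := mul_expBound_lt p hi
    have h1' : (p : ℤ) * expBound p i + 1 ≤ expBound p (p * i) := by exact_mod_cast h1
    have h2 : (expBound p i : ℤ) ≤ p * expBound p i := by
      have := Nat.le_mul_of_pos_left (expBound p i) hp.out.pos
      exact_mod_cast this
    exact ((h.pow p).mono (by linarith)).sub (h.mono (by linarith))

/-- The congruence P(t)^p ≡ P(t^p), with "mod p" replaced by one spare power of p relative to the
bound. The monomials are added one at a time; the cross terms carry an explicit factor p. -/
lemma sum_pow_sub_expand {m : ℕ} {a : ℕ → ℚ} (h : ∀ i < m, ValGE p (-(expBound p i : ℤ)) (a i)) :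
    (∑ i ∈ Finset.range m, monomial i (a i)) ^ p -
      expand p hp.out.ne_zero (∑ i ∈ Finset.range m, monomial i (a i)) ∈ smallSeries p := by
  induction m with
  | zero =>
    simp only [Finset.range_zero, Finset.sum_empty, map_zero, sub_zero,
      zero_pow hp.out.ne_zero]
    exact fun i => by simpa using ValGE.zero _
  | succ m ih =>
    rw [Finset.sum_range_succ]
    set P := ∑ i ∈ Finset.range m, monomial i (a i)
    have hP : P ∈ boundedSubring p := Subring.sum_mem _ fun i hi =>
      boundedSubring_monomial (h i (by have := Finset.mem_range.1 hi; omega))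
    have hQ := boundedSubring_monomial (h m (by omega))
    -- Applying the binomial identity inside the subring makes the cofactor r bounded as well.
    obtain ⟨r, hr⟩ := exists_add_pow_prime_eq hp.out (⟨P, hP⟩ : boundedSubring p)
      ⟨monomial m (a m), hQ⟩
    have hr' := congrArg Subtype.val hr
    simp only [Subring.coe_add, Subring.coe_mul, Subring.coe_pow, Subring.coe_natCast] at hr'
    have e : (P + monomial m (a m)) ^ p - expand p hp.out.ne_zero (P + monomial m (a m)) =
        (P ^ p - expand p hp.out.ne_zero P) + (monomial (p * m) (a m ^ p - a m)
          + (p : ℚ⟦X⟧) * (P * monomial m (a m) * r)) := by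
      rw [hr', map_add, expand_monomial, monomial_pow, map_sub]
      ring
    rw [e]
    refine smallSeries_add (ih fun i hi => h i (by omega)) (smallSeries_add
      (smallSeries_monomial (bounded_pow_sub_self (h m (by omega)))) (smallSeries_prime_mul ?_))
    exact mul_mem (mul_mem hP hQ) r.2

variable (p)

/-- Compare exponents: p t + t^p on the left; on the right t^p + t^{p²}/p from E(t^p), corrected by
p t and -t^{p²}/p. -/
lemma truncExp_pow : truncExp p ^ p = expand p hp.out.ne_zero (truncExp p) *
    (rescale (p : ℚ) (exp ℚ) *
      expand (p * p) (mul_ne_zero hp.out.ne_zero hp.out.ne_zero) (rescale (-(p : ℚ)⁻¹) (exp ℚ))) := by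
  have hp0 : (p : ℚ) ≠ 0 := by exact_mod_cast hp.out.ne_zero
  have e1 : rescale (p : ℚ)⁻¹ (exp ℚ) ^ p = exp ℚ := by
    rw [← map_pow, exp_pow_eq_rescale_exp, rescale_rescale, mul_inv_cancel₀ hp0, rescale_one]
    rfl
  have e2 : expand (p * p) (mul_ne_zero hp.out.ne_zero hp.out.ne_zero)
      (rescale (p : ℚ)⁻¹ (exp ℚ)) * expand (p * p) (mul_ne_zero hp.out.ne_zero hp.out.ne_zero)
      (rescale (-(p : ℚ)⁻¹) (exp ℚ)) = 1 := by
    rw [← map_mul, exp_mul_exp_eq_exp_add, add_neg_cancel, rescale_zero]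
    simp
  rw [truncExp, mul_pow, ← map_pow, e1, exp_pow_eq_rescale_exp, map_mul, ← expand_mul]
  linear_combination (-(expand p hp.out.ne_zero (exp ℚ)) * rescale (p : ℚ) (exp ℚ)) * e2

/-- The coefficient c of degree m enters F^p linearly, as p c, since P has constant term 1 and the
quadratic remainder starts in degree 2m > m. -/
lemma coeff_pow_of_eq_add {m : ℕ} (hm : m ≠ 0) (F P : ℚ⟦X⟧) (hP0 : coeff 0 P = 1) (c : ℚ)
    (Q : ℚ⟦X⟧) (hF : F = P + X ^ m * Q) (hQ : coeff 0 Q = c) :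
    coeff m (F ^ p) = coeff m (P ^ p) + p * c := by
  obtain ⟨r, hr⟩ := Polynomial.powAddExpansion P (X ^ m * Q) p
  have h1 : coeff m ((p : ℚ⟦X⟧) * P ^ (p - 1) * (X ^ m * Q)) = p * c := by
    have e : ((p : ℚ⟦X⟧) * P ^ (p - 1) * (X ^ m * Q)) = X ^ m * (C (p : ℚ) * (P ^ (p - 1) * Q)) := by
      rw [map_natCast]
      ring
    have h0 := coeff_X_pow_mul (C (p : ℚ) * (P ^ (p - 1) * Q)) m 0
    rw [zero_add] at h0
    rw [coeff_zero_eq_constantCoeff_apply] at hP0 hQ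
    rw [e, h0, coeff_zero_eq_constantCoeff_apply, map_mul, map_mul, map_pow, hP0, hQ, one_pow,
      one_mul, constantCoeff_C]
  have h2 : coeff m (r * (X ^ m * Q) ^ 2) = 0 := by
    rw [show r * (X ^ m * Q) ^ 2 = X ^ (m + m) * (r * Q ^ 2) by ring, coeff_X_pow_mul',
      if_neg (by omega)]
  rw [hF, hr, map_add, map_add, h1, h2, add_zero]

variable {p}

lemma smallSeries_mul {F G : ℚ⟦X⟧} (hF : F ∈ boundedSubring p) (hG : G ∈ smallSeries p) :
    F * G ∈ smallSeries p := fun i => by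
  rw [coeff_mul]
  refine ValGE.sum fun x hx => ?_
  have h := Finset.HasAntidiagonal.mem_antidiagonal.1 hx
  have := expBound_add_le p x.1 x.2
  rw [h] at this
  exact ((hF x.1).mul (hG x.2)).mono (by omega)

lemma smallSeries_subset {F : ℚ⟦X⟧} (hF : F ∈ smallSeries p) : F ∈ boundedSubring p :=
  fun i => (hF i).mono (by omega)

variable (p)

lemma rescale_exp_sub_one_mem : rescale (p : ℚ) (exp ℚ) - 1 ∈ smallSeries p := fun i => by
  rw [map_sub, coeff_one, coeff_rescale, coeff_exp]
  split_ifs with h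
  · simpa [h] using ValGE.zero _
  · have h1 := padicValNat_factorial_lt_of_ne_zero p h
    have h2 := (ValGE.pow_prime (p := p) i).mul (ValGE.inv_natCast (p := p) i.factorial_ne_zero)
    simpa using h2.mono (z₂ := 1 - (expBound p i : ℤ)) (by omega)

/-- In degree p² k the coefficient has valuation -k - ord(k!), while the bound allows -2k - ord(k!).
Since k ≥ 1, a power of p is left over; this is why `expBound` contains 2k and not k. -/
lemma expand_exp_sub_one_mem :
    expand (p * p) (mul_ne_zero hp.out.ne_zero hp.out.ne_zero) (rescale (-(p : ℚ)⁻¹) (exp ℚ)) - 1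
      ∈ smallSeries p := fun i => by
  rw [map_sub, coeff_one, coeff_expand]
  by_cases h0 : i = 0
  · subst h0
    simpa using ValGE.zero _
  rw [if_neg h0, sub_zero]
  split_ifs with h
  · obtain ⟨k, rfl⟩ := h
    have hk : k ≠ 0 := by
      rintro rfl
      simp at h0
    have h1 : p * p * k / p ^ 2 = k := by
      rw [pow_two, Nat.mul_div_cancel_left _ (Nat.mul_pos hp.out.pos hp.out.pos)]
    rw [Nat.mul_div_cancel_left _ (Nat.mul_pos hp.out.pos hp.out.pos), coeff_rescale, coeff_exp]
    have h2 := ((ValGE.zpow_prime (p := p) (-1)).neg.pow k).mul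
      (ValGE.inv_natCast (p := p) k.factorial_ne_zero)
    have h3 : expBound p (p * p * k) = padicValNat p k.factorial + 2 * k := by
      rw [expBound, h1]
    rw [zpow_neg_one] at h2
    simpa using h2.mono (z₂ := 1 - (expBound p (p * p * k) : ℤ)) (by rw [h3]; push_cast; omega)
  · exact ValGE.zero _

lemma truncExpCoeff_zero : truncExpCoeff p 0 = 1 := by
  rw [truncExpCoeff, truncExp, coeff_zero_eq_constantCoeff_apply, map_mul, constantCoeff_expand,
    ← coeff_zero_eq_constantCoeff_apply, ← coeff_zero_eq_constantCoeff_apply, coeff_rescale]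
  simp

/-- Induction on the degree, following Dwork. In `truncExp_pow` the unknown coefficient occurs as p
c_m in E^p and not at all in E(t^p) up to degree m. The rest is P^p - P(t^p) and P(t^p) times a
factor close to 1 minus 1, both small; the spare power of p pays for dividing by p. -/
theorem truncExpCoeff_val (m : ℕ) : ValGE p (-(expBound p m : ℤ)) (truncExpCoeff p m) := by
  induction m using Nat.strong_induction_on with
  | _ m ih =>
  rcases Nat.eq_zero_or_pos m with rfl | hm
  · rw [truncExpCoeff_zero]
    exact ValGE.one.mono (by omega)
  set P : ℚ⟦X⟧ := ∑ i ∈ Finset.range m, monomial i (truncExpCoeff p i) with hPdef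
  set E₁ := rescale (p : ℚ) (exp ℚ) with hE₁
  set E₂ := expand (p * p) (mul_ne_zero hp.out.ne_zero hp.out.ne_zero)
    (rescale (-(p : ℚ)⁻¹) (exp ℚ)) with hE₂
  have hPcoeff : ∀ i, coeff i P = if i < m then truncExpCoeff p i else 0 := by
    intro i
    rw [hPdef, map_sum]
    simp only [coeff_monomial]
    rw [Finset.sum_ite_eq]
    simp
  have hW : E₁ * E₂ - 1 ∈ smallSeries p := by
    have e : E₁ * E₂ - 1 = (E₁ - 1) + ((E₂ - 1) + (E₁ - 1) * (E₂ - 1)) := by ring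
    rw [e]
    exact smallSeries_add (rescale_exp_sub_one_mem p) (smallSeries_add (expand_exp_sub_one_mem p)
      (smallSeries_mul (smallSeries_subset (rescale_exp_sub_one_mem p))
        (expand_exp_sub_one_mem p)))
  have hP' : expand p hp.out.ne_zero P ∈ boundedSubring p := by
    rw [hPdef, map_sum]
    refine Subring.sum_mem _ fun i hi => ?_
    rw [expand_monomial]
    have := expBound_mono p (Nat.le_mul_of_pos_left i hp.out.pos)
    exact boundedSubring_monomial ((ih i (Finset.mem_range.1 hi)).mono (by omega))
  have h1 : coeff m (truncExp p ^ p) = coeff m (P ^ p) + p * truncExpCoeff p m := by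
    refine coeff_pow_of_eq_add p hm.ne' _ P ?_ _
      (PowerSeries.mk fun k => truncExpCoeff p (k + m)) ?_ ?_
    · rw [hPcoeff, if_pos hm, truncExpCoeff_zero]
    · ext k
      rw [map_add, hPcoeff, coeff_X_pow_mul']
      by_cases hk : k < m
      · rw [if_pos hk, if_neg (by omega), add_zero, truncExpCoeff]
      · rw [if_neg hk, if_pos (by omega), zero_add, coeff_mk, Nat.sub_add_cancel (by omega),
          truncExpCoeff]
    · rw [coeff_mk, zero_add]
  -- Up to degree m, the series E(t^p) only involves coefficients c_{i/p} with i/p < m, so E may be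
  -- replaced by its truncation.
  have h2 : ∀ i ≤ m, coeff i (expand p hp.out.ne_zero (truncExp p)) =
      coeff i (expand p hp.out.ne_zero P) := by
    intro i hi
    rw [coeff_expand, coeff_expand]
    split_ifs with hd
    · have : i / p < m := by
        rcases Nat.eq_zero_or_pos i with rfl | hi0
        · simpa using hm
        · exact (Nat.div_lt_self hi0 hp.out.one_lt).trans_le hi
      rw [hPcoeff, if_pos this, truncExpCoeff]
    · rfl
  have h3 : coeff m (truncExp p ^ p) = coeff m (expand p hp.out.ne_zero P)
      + coeff m (expand p hp.out.ne_zero P * (E₁ * E₂ - 1)) := by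
    rw [← map_add, mul_sub, mul_one, add_sub_cancel, truncExp_pow, coeff_mul, coeff_mul]
    refine Finset.sum_congr rfl fun x hx => ?_
    rw [h2 x.1 (by have := Finset.HasAntidiagonal.mem_antidiagonal.1 hx; omega)]
  have h4 : p * truncExpCoeff p m = coeff m (expand p hp.out.ne_zero P * (E₁ * E₂ - 1))
      - coeff m (P ^ p - expand p hp.out.ne_zero P) := by
    rw [map_sub]
    linarith
  have h5 := (smallSeries_mul hP' hW m).sub (sum_pow_sub_expand ih m)
  rw [← h4] at h5
  exact ValGE.of_prime_mul (h5.mono (by omega))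

lemma derivative_expand_exp :
    derivative ℚ (expand p hp.out.ne_zero (rescale (p : ℚ)⁻¹ (exp ℚ))) =
      X ^ (p - 1) * expand p hp.out.ne_zero (rescale (p : ℚ)⁻¹ (exp ℚ)) := by
  have hp0 : (p : ℚ) ≠ 0 := by exact_mod_cast hp.out.ne_zero
  have hpos := hp.out.pos
  ext i
  rw [coeff_derivative, coeff_X_pow_mul', coeff_expand, coeff_expand]
  by_cases hd : p ∣ i + 1
  · obtain ⟨k, hk⟩ := hd
    obtain ⟨l, rfl⟩ : ∃ l, k = l + 1 := ⟨k - 1, by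
      rcases k with _ | k
      · simp at hk
      · rfl⟩
    have hi : i - (p - 1) = p * l := by
      rw [mul_add, mul_one] at hk
      omega
    have hle : p - 1 ≤ i := by
      rw [mul_add, mul_one] at hk
      have := Nat.zero_le (p * l)
      omega
    rw [if_pos hle, hi, hk, if_pos (dvd_mul_right _ _), if_pos (dvd_mul_right _ _),
      Nat.mul_div_cancel_left _ hpos, Nat.mul_div_cancel_left _ hpos, coeff_rescale,
      coeff_rescale, coeff_exp, coeff_exp]
    have hi' : (i : ℚ) + 1 = p * (l + 1) := by exact_mod_cast hk
    have hl : ((l : ℚ) + 1) ≠ 0 := by positivity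
    have hf : (l.factorial : ℚ) ≠ 0 := by exact_mod_cast l.factorial_ne_zero
    rw [hi', Nat.factorial_succ]
    simp only [Algebra.algebraMap_self, RingHom.id_apply]
    push_cast
    rw [pow_succ]
    field_simp
  · rw [if_neg hd, zero_mul]
    split_ifs with h1 h2
    · exfalso
      refine hd ?_
      have : i + 1 = i - (p - 1) + p := by omega
      rw [this]
      exact dvd_add h2 dvd_rfl
    · rfl
    · rfl

/-- Coefficients in the differential equation E' = (1 + t^{p-1}) E. -/
lemma succ_mul_truncExpCoeff (i : ℕ) : ((i + 1 : ℕ) : ℚ) * truncExpCoeff p (i + 1) =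
    truncExpCoeff p i + if p ≤ i + 1 then truncExpCoeff p (i + 1 - p) else 0 := by
  have h : derivative ℚ (truncExp p) = truncExp p + X ^ (p - 1) * truncExp p := by
    rw [truncExp, Derivation.leibniz, derivative_expand_exp, derivative_exp, smul_eq_mul,
      smul_eq_mul]
    ring
  have h1 := congrArg (coeff i) h
  have hpos := hp.out.pos
  rw [coeff_derivative, map_add, coeff_X_pow_mul'] at h1
  unfold truncExpCoeff
  rw [mul_comm]
  push_cast
  rw [h1]
  congr 1
  by_cases h2 : p ≤ i + 1
  · rw [if_pos h2, if_pos (by omega)]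
    congr 2
    omega
  · rw [if_neg h2, if_neg (by omega)]

end ExpCoeff

/-! ### Valuations of the operator's coefficients, and a p-adic factorial sum -/

section Gauss

variable (p : ℕ) [hp : Fact p.Prime]

/-- The power of `p` that divides the terms of degree `N` in the image of `e^{-F^σ} ∘ V_p ∘ e^F`. -/
def depth (N : ℕ) : ℕ := (N + 5) / 6

lemma depth_mono {M N : ℕ} (h : M ≤ N) : depth M ≤ depth N :=
  Nat.div_le_div_right (by omega)

lemma le_depth (s : ℕ) : s ≤ depth (6 * s) := by
  unfold depth
  omega

lemma one_le_depth {N : ℕ} (h : N ≠ 0) : 1 ≤ depth N := by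
  unfold depth
  omega

lemma depth_add_le (M N : ℕ) : depth (M + N) ≤ depth M + N := by
  unfold depth
  omega

/-- The number `(-p)^N c_i / j!`, where `c_i` is the coefficient of `t^i` in `exp (t + t^p / p)`. -/
def dworkCoeff (N i j : ℕ) : ℚ := (-(p : ℚ)) ^ N * truncExpCoeff p i * (j.factorial : ℚ)⁻¹

/-- Put k = ⌊i/p²⌋, so that p k + j ≤ N. As p ≥ 3, ord(k!) ≤ k/2, ord(j!) ≤ j/2 and k ≤ pk/3. The
loss ord(k!) + 2k + ord(j!) is thus at most 5pk/6 + j/2 ≤ 5N/6, which leaves N/6, rounded up in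
`depth`. -/
lemma dworkCoeff_val (hp2 : 2 < p) {N i j : ℕ} (h : i + p * j ≤ p * N) :
    ValGE p (depth N) (dworkCoeff p N i j) := by
  have h1 := ((ValGE.prime.neg.pow N).mul (truncExpCoeff_val p i)).mul
    (ValGE.inv_natCast (p := p) j.factorial_ne_zero)
  refine h1.mono ?_
  have h2 : ∀ k : ℕ, 2 * padicValNat p k.factorial ≤ k := by
    intro k
    rcases Nat.eq_zero_or_pos k with rfl | hk
    · simp
    · have h3 := sub_one_mul_padicValNat_factorial_lt_of_ne_zero p hk.ne'
      have h4 : 2 * padicValNat p k.factorial ≤ (p - 1) * padicValNat p k.factorial :=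
        Nat.mul_le_mul_right _ (by omega)
      omega
  have h3 := h2 (i / p ^ 2)
  have h4 := h2 j
  have h5 : p * (p * (i / p ^ 2)) ≤ i := by
    rw [← mul_assoc, ← pow_two]
    exact Nat.mul_div_le i (p ^ 2)
  have h6 : p * (i / p ^ 2) + j ≤ N := by
    refine Nat.le_of_mul_le_mul_left ?_ hp.out.pos
    rw [mul_add]
    omega
  have h7 : 3 * (i / p ^ 2) ≤ p * (i / p ^ 2) := Nat.mul_le_mul_right _ hp2
  unfold expBound depth
  generalize padicValNat p (i / p ^ 2).factorial = v at *
  generalize padicValNat p j.factorial = w at *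
  generalize p * (i / p ^ 2) = x at *
  generalize i / p ^ 2 = k at *
  push_cast
  omega

/-- The coefficients of `exp (t + t^p / p)`, extended by `0` to negative indices. -/
def truncExpCoeffInt (k : ℤ) : ℚ := if 0 ≤ k then truncExpCoeff p k.toNat else 0

/-- With zeros at negative indices the recurrence holds for every integer k, including k = 0, so the
telescoping below needs no boundary cases. -/
lemma mul_truncExpCoeffInt (k : ℤ) : (k : ℚ) * truncExpCoeffInt p k =
    truncExpCoeffInt p (k - 1) + truncExpCoeffInt p (k - p) := by
  have hpos := hp.out.pos
  rcases lt_trichotomy k 0 with hk | rfl | hk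
  · unfold truncExpCoeffInt
    rw [if_neg (by omega), if_neg (by omega), if_neg (by omega)]
    simp
  · unfold truncExpCoeffInt
    rw [if_neg (by omega : ¬ (0 : ℤ) ≤ 0 - 1), if_neg (by omega : ¬ (0 : ℤ) ≤ 0 - p)]
    simp
  · obtain ⟨i, rfl⟩ : ∃ i : ℕ, k = ((i + 1 : ℕ) : ℤ) := ⟨(k - 1).toNat, by omega⟩
    have h := succ_mul_truncExpCoeff p i
    unfold truncExpCoeffInt
    rw [if_pos (by omega), if_pos (by omega), Int.toNat_natCast, Int.cast_natCast, h]
    congr 1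
    · congr 1
      omega
    · by_cases h2 : p ≤ i + 1
      · rw [if_pos h2, if_pos (by omega)]
        congr 1
        omega
      · rw [if_neg h2, if_neg (by omega)]

/-- The terms of the sum `∑_{M ≥ 0} p^{M+1} M! c_{p(M+1)-m}`. -/
def gaussTerm (m M : ℕ) : ℚ :=
  (p : ℚ) ^ (M + 1) * M.factorial * truncExpCoeffInt p ((p * (M + 1) : ℕ) - (m : ℤ))

lemma prime_pow_mul_truncExpCoeffInt_val (hp2 : 2 < p) (m M : ℕ) :
    ValGE p (depth M) ((p : ℚ) ^ M * truncExpCoeffInt p ((p * M : ℕ) - (m : ℤ))) := by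
  unfold truncExpCoeffInt
  split_ifs with h
  · have h1 := dworkCoeff_val p hp2 (N := M) (i := ((p * M : ℕ) - (m : ℤ)).toNat) (j := 0) (by omega)
    have h2 := h1.mul_int ((-1) ^ M)
    refine (congrArg _ ?_ : ValGE p _ _ = ValGE p _ _).mp h2
    have e : ((-1 : ℚ)) ^ M * (-1) ^ M = 1 := by rw [← mul_pow]; simp
    rw [dworkCoeff, neg_pow (p : ℚ)]
    simp only [Nat.factorial_zero, Nat.cast_one, inv_one, mul_one, Int.cast_pow, Int.cast_neg,
      Int.cast_one]
    rw [mul_assoc, ← mul_assoc, e, one_mul]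
  · rw [mul_zero]
    exact ValGE.zero _

lemma gaussTerm_val (hp2 : 2 < p) (m M : ℕ) : ValGE p (depth (M + 1)) (gaussTerm p m M) := by
  have h := (prime_pow_mul_truncExpCoeffInt_val p hp2 m (M + 1)).mul_nat M.factorial
  refine (congrArg _ ?_ : ValGE p _ _ = ValGE p _ _).mp h
  unfold gaussTerm
  ring

/-- Multiply the recurrence at k = p(M+1) - m by p^{M+1} M!. The part p(M+1) of k raises p^{M+1} M!
to p^{M+2} (M+1)!, so the first two terms are consecutive values of one sequence. -/
lemma gaussTerm_succ (m M : ℕ) : gaussTerm p (m + 1) M =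
    (p : ℚ) ^ (M + 2) * (M + 1).factorial * truncExpCoeffInt p ((p * (M + 1) : ℕ) - (m : ℤ))
      - (p : ℚ) ^ (M + 1) * M.factorial * truncExpCoeffInt p ((p * M : ℕ) - (m : ℤ))
      - m * gaussTerm p m M := by
  have h := mul_truncExpCoeffInt p ((p * (M + 1) : ℕ) - (m : ℤ))
  have e1 : ((p * (M + 1) : ℕ) - (m : ℤ)) - p = (p * M : ℕ) - (m : ℤ) := by
    push_cast
    ring
  have e2 : ((p * (M + 1) : ℕ) - (m : ℤ)) - 1 = (p * (M + 1) : ℕ) - ((m + 1 : ℕ) : ℤ) := by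
    push_cast
    ring
  rw [e1, e2] at h
  unfold gaussTerm
  rw [← sub_eq_iff_eq_add] at h
  rw [← h, Nat.factorial_succ]
  push_cast
  ring

lemma sum_gaussTerm_succ (m T : ℕ) : ∑ M ∈ Finset.range T, gaussTerm p (m + 1) M =
    (p : ℚ) ^ (T + 1) * T.factorial * truncExpCoeffInt p ((p * T : ℕ) - (m : ℤ))
      - p * truncExpCoeffInt p (-(m : ℤ)) - m * ∑ M ∈ Finset.range T, gaussTerm p m M := by
  induction T with
  | zero => simp
  | succ T ih =>
    rw [Finset.sum_range_succ, ih, Finset.sum_range_succ, gaussTerm_succ]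
    ring

/-- The sum `∑_{M ≥ 1} p^M (M-1)! c_{pM-m}` converges `p`-adically to `p (-1)^m (m-1)!`. -/
theorem sum_gaussTerm_val (hp2 : 2 < p) (m T : ℕ) :
    ValGE p (depth T) (∑ M ∈ Finset.range T, gaussTerm p (m + 1) M
      - p * ((-1) ^ (m + 1) * m.factorial)) := by
  -- The boundary term at T of the telescoping sum tends to 0. The other boundary term is -p c_{-m},
  -- which is -p for m = 0 and vanishes for m > 0; the limits therefore satisfy S_1 = -p and S_{m+1}
  -- = -m S_m.
  have hU : ∀ m : ℕ, ValGE p (depth T) ((p : ℚ) ^ (T + 1) * T.factorial *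
      truncExpCoeffInt p ((p * T : ℕ) - (m : ℤ))) := by
    intro m
    have h := (prime_pow_mul_truncExpCoeffInt_val p hp2 m T).mul_nat (p * T.factorial)
    refine (congrArg _ ?_ : ValGE p _ _ = ValGE p _ _).mp h
    push_cast
    ring
  induction m with
  | zero =>
    rw [sum_gaussTerm_succ]
    have e : truncExpCoeffInt p (-((0 : ℕ) : ℤ)) = 1 := by
      simp [truncExpCoeffInt, truncExpCoeff_zero]
    rw [e]
    refine (congrArg _ ?_ : ValGE p _ _ = ValGE p _ _).mp (hU 0)
    simp
  | succ m ih =>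
    rw [sum_gaussTerm_succ]
    have e : truncExpCoeffInt p (-((m + 1 : ℕ) : ℤ)) = 0 := by
      unfold truncExpCoeffInt
      rw [if_neg (by omega)]
    rw [e]
    refine (congrArg _ ?_ : ValGE p _ _ = ValGE p _ _).mp
      ((hU (m + 1)).sub (ih.mul_nat (m + 1)))
    rw [Nat.factorial_succ]
    push_cast
    ring

end Gauss

/-! ### The Cartier operator on Laurent polynomials and on series -/

section CartierBasic

variable {A : Type*} [CommRing A] {n : ℕ} (p : ℕ) [hp : Fact p.Prime]

lemma cartierPoly_coeff (g : LaurentPoly A n) (k : Fin n → ℤ) :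
    (cartierPoly p g).coeff k = g.coeff (p • k) := by
  simp [cartierPoly]

lemma cartierPoly_add (g h : LaurentPoly A n) :
    cartierPoly p (g + h) = cartierPoly p g + cartierPoly p h := by
  ext k
  simp [cartierPoly_coeff]

lemma cartierPoly_zero : cartierPoly p (0 : LaurentPoly A n) = 0 := by
  ext k
  simp [cartierPoly_coeff]

lemma cartierPoly_sum {ι : Type*} (s : Finset ι) (g : ι → LaurentPoly A n) :
    cartierPoly p (∑ i ∈ s, g i) = ∑ i ∈ s, cartierPoly p (g i) := by
  ext k
  simp [cartierPoly_coeff]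

lemma cartierPoly_smul {S : Type*} [SMulZeroClass S A] (r : S) (g : LaurentPoly A n) :
    cartierPoly p (r • g) = r • cartierPoly p g := by
  ext k
  simp [cartierPoly_coeff]

lemma cartierPoly_mapCoeff {B : Type*} [CommRing B] (τ : A →+* B) (g : LaurentPoly A n) :
    cartierPoly p (mapCoeff τ g) = mapCoeff τ (cartierPoly p g) := by
  ext k
  simp [cartierPoly_coeff, mapCoeff]

/-- The Laurent polynomial `g(x^p)`. -/
def expandPoly : LaurentPoly A n →+* LaurentPoly A n :=
  AddMonoidAlgebra.mapDomainRingHom A (nsmulAddMonoidHom p : (Fin n → ℤ) →+ (Fin n → ℤ))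

lemma expandPoly_single (k : Fin n → ℤ) (r : A) :
    expandPoly p (AddMonoidAlgebra.single k r) = AddMonoidAlgebra.single (p • k) r := by
  simp [expandPoly]

lemma expandPoly_mapCoeff {B : Type*} [CommRing B] (τ : A →+* B) (g : LaurentPoly A n) :
    expandPoly p (mapCoeff τ g) = mapCoeff τ (expandPoly p g) := by
  induction g using AddMonoidAlgebra.induction_linear with
  | zero => simp
  | add x y hx hy => simp only [map_add, hx, hy]
  | single k r => simp [expandPoly_single, mapCoeff]

/-- The operator `∑ a_k x^k ↦ ∑ a_{pk} x^k` on all formal series. -/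
def cartierFun : ((Fin n → ℤ) → A) →ₗ[A] ((Fin n → ℤ) → A) :=
  LinearMap.funLeft A A fun k => p • k

lemma cartierFun_apply (φ : (Fin n → ℤ) → A) (k : Fin n → ℤ) :
    cartierFun p φ k = φ (p • k) := rfl

lemma cartierFun_act_expandPoly (g : LaurentPoly A n) (φ : (Fin n → ℤ) → A) :
    cartierFun p (act (expandPoly p g) φ) = act g (cartierFun p φ) := by
  induction g using AddMonoidAlgebra.induction_linear with
  | zero => simp
  | add x y hx hy => simp only [map_add, LinearMap.add_apply, hx, hy]
  | single k r =>
    funext l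
    rw [cartierFun_apply, expandPoly_single, act_single_apply, act_single_apply, cartierFun_apply,
      smul_sub]

lemma coeff_mul_eq_act (g h : LaurentPoly A n) :
    (fun k => (g * h).coeff k) = act g fun k => h.coeff k := by
  rw [coeff_eq_act, map_mul, Module.End.mul_apply, ← coeff_eq_act]

lemma cartierFun_coeff (g : LaurentPoly A n) :
    cartierFun p (fun k => g.coeff k) = fun k => (cartierPoly p g).coeff k := by
  funext k
  rw [cartierFun_apply, cartierPoly_coeff]

/-- The projection formula: factors in x^p pass through the Cartier operator. It is what lets
e^{-F^σ} be moved across V_p. -/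
lemma cartierPoly_expandPoly_mul (g h : LaurentPoly A n) :
    cartierPoly p (expandPoly p g * h) = g * cartierPoly p h := by
  ext k
  have h1 := congrFun (coeff_mul_eq_act g (cartierPoly p h)) k
  have h2 := congrFun (cartierFun_coeff p (expandPoly p g * h)) k
  rw [h1, ← h2, coeff_mul_eq_act, cartierFun_act_expandPoly, cartierFun_coeff]

/-- Both f ↦ f^σ(x^p) and f ↦ f^p are additive modulo p, so monomials suffice; there it is the
hypothesis on σ. -/
lemma exists_frobenius_lift (σ : A →+* A) (hσ : ∀ r, (p : A) ∣ σ r - r ^ p) (f : LaurentPoly A n) :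
    ∃ g : LaurentPoly A n, expandPoly p (mapCoeff σ f) = f ^ p + (p : A) • g := by
  induction f using AddMonoidAlgebra.induction_linear with
  | zero => exact ⟨0, by simp [hp.out.ne_zero]⟩
  | add x y hx hy =>
    obtain ⟨g₁, h₁⟩ := hx
    obtain ⟨g₂, h₂⟩ := hy
    obtain ⟨r, hr⟩ := exists_add_pow_prime_eq hp.out x y
    refine ⟨g₁ + g₂ - x * y * r, ?_⟩
    rw [map_add, map_add, h₁, h₂, hr, Nat.cast_smul_eq_nsmul, Nat.cast_smul_eq_nsmul,
      Nat.cast_smul_eq_nsmul, nsmul_eq_mul, nsmul_eq_mul, nsmul_eq_mul]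
    ring
  | single k r =>
    obtain ⟨d, hd⟩ := hσ r
    refine ⟨AddMonoidAlgebra.single (p • k) d, ?_⟩
    rw [mapCoeff, AddMonoidAlgebra.mapRingHom_single, expandPoly_single,
      AddMonoidAlgebra.single_pow, AddMonoidAlgebra.smul_single, ← AddMonoidAlgebra.single_add,
      smul_eq_mul, ← hd, add_sub_cancel]

end CartierBasic

/-! ### The commutation with the twisted derivatives -/

section Commutation

variable {A : Type*} [CommRing A] {n : ℕ}

/-- The action of `θ_i` on the part of degree `N`. -/
def layerTheta (i : Fin (n + 1)) (N : ℕ) (g : LaurentPoly A n) : LaurentPoly A n :=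
  g.coeff.sum fun k c =>
    AddMonoidAlgebra.single k ((((Fin.cons (N : ℤ) k : Fin (n + 1) → ℤ) i : ℤ) : A) * c)

lemma coeff_theta (i : Fin (n + 1)) (N : ℕ) (h : Series A n) :
    PowerSeries.coeff N (theta i h) = layerTheta i N (PowerSeries.coeff N h) := by
  rw [theta, PowerSeries.coeff_mk, layerTheta]

lemma layerTheta_coeff (i : Fin (n + 1)) (N : ℕ) (g : LaurentPoly A n) (k : Fin n → ℤ) :
    (layerTheta i N g).coeff k =
      (((Fin.cons (N : ℤ) k : Fin (n + 1) → ℤ) i : ℤ) : A) * g.coeff k := by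
  classical
  rw [layerTheta, Finsupp.sum, AddMonoidAlgebra.coeff_sum, Finsupp.finsetSum_apply]
  simp only [AddMonoidAlgebra.coeff_single, Finsupp.single_apply]
  rw [Finset.sum_ite_eq']
  split_ifs with hk
  · rfl
  · rw [Finsupp.notMem_support_iff.1 hk, mul_zero]

lemma layerTheta_add (i : Fin (n + 1)) (N : ℕ) (g h : LaurentPoly A n) :
    layerTheta i N (g + h) = layerTheta i N g + layerTheta i N h := by
  ext k
  simp [layerTheta_coeff, mul_add]

lemma layerTheta_zero (i : Fin (n + 1)) (N : ℕ) : layerTheta i N (0 : LaurentPoly A n) = 0 := by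
  ext k
  simp [layerTheta_coeff]

lemma layerTheta_sum {ι : Type*} (i : Fin (n + 1)) (N : ℕ) (s : Finset ι)
    (g : ι → LaurentPoly A n) :
    layerTheta i N (∑ j ∈ s, g j) = ∑ j ∈ s, layerTheta i N (g j) := by
  ext k
  simp [layerTheta_coeff, Finset.mul_sum]

lemma layerTheta_neg (i : Fin (n + 1)) (N : ℕ) (g : LaurentPoly A n) :
    layerTheta i N (-g) = -layerTheta i N g := by
  ext k
  simp [layerTheta_coeff]

lemma layerTheta_single (i : Fin (n + 1)) (N : ℕ) (k : Fin n → ℤ) (c : A) :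
    layerTheta i N (AddMonoidAlgebra.single k c) = AddMonoidAlgebra.single k
      ((((Fin.cons (N : ℤ) k : Fin (n + 1) → ℤ) i : ℤ) : A) * c) := by
  rw [layerTheta, AddMonoidAlgebra.coeff_single, Finsupp.sum_single_index (by simp)]

/-- The Leibniz rule degree by degree: the exponents (N, k) and (M, l) add, and each θ_i is linear
in the exponent. -/
lemma layerTheta_mul (i : Fin (n + 1)) (N M : ℕ) (g h : LaurentPoly A n) :
    layerTheta i (N + M) (g * h) = layerTheta i N g * h + g * layerTheta i M h := by
  induction g using AddMonoidAlgebra.induction_linear with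
  | zero => simp [layerTheta_zero]
  | add x y hx hy => rw [add_mul, layerTheta_add, hx, hy, layerTheta_add]; ring
  | single k r =>
    induction h using AddMonoidAlgebra.induction_linear with
    | zero => simp [layerTheta_zero]
    | add x y hx hy => rw [mul_add, layerTheta_add, hx, hy, layerTheta_add]; ring
    | single l s =>
      simp only [AddMonoidAlgebra.single_mul_single, layerTheta_single]
      rw [← AddMonoidAlgebra.single_add]
      congr 1
      have e : (Fin.cons ((N + M : ℕ) : ℤ) (k + l) : Fin (n + 1) → ℤ) i =
          (Fin.cons (N : ℤ) k : Fin (n + 1) → ℤ) i + (Fin.cons (M : ℤ) l : Fin (n + 1) → ℤ) i := by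
        refine Fin.cases ?_ (fun j => ?_) i <;> simp
      rw [e]
      push_cast
      ring

lemma layerTheta_one (i : Fin (n + 1)) : layerTheta i 0 (1 : LaurentPoly A n) = 0 := by
  rw [AddMonoidAlgebra.one_def, layerTheta_single]
  have e : (Fin.cons ((0 : ℕ) : ℤ) (0 : Fin n → ℤ) : Fin (n + 1) → ℤ) i = 0 := by
    refine Fin.cases ?_ (fun j => ?_) i <;> simp
  rw [e]
  simp

lemma layerTheta_pow (i : Fin (n + 1)) (g : LaurentPoly A n) (N : ℕ) :
    layerTheta i (N + 1) (g ^ (N + 1)) = ((N + 1 : ℕ) : LaurentPoly A n) *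
      (layerTheta i 1 g * g ^ N) := by
  induction N with
  | zero => simp
  | succ N ih =>
    rw [pow_succ g (N + 1), layerTheta_mul, ih]
    push_cast
    ring

lemma theta_mul (i : Fin (n + 1)) (h₁ h₂ : Series A n) :
    theta i (h₁ * h₂) = theta i h₁ * h₂ + h₁ * theta i h₂ := by
  ext1 N
  rw [coeff_theta, map_add, PowerSeries.coeff_mul, PowerSeries.coeff_mul, PowerSeries.coeff_mul,
    layerTheta_sum, ← Finset.sum_add_distrib]
  refine Finset.sum_congr rfl fun x hx => ?_
  rw [← Finset.HasAntidiagonal.mem_antidiagonal.1 hx, layerTheta_mul, coeff_theta, coeff_theta]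

lemma theta_phase (i : Fin (n + 1)) (g : LaurentPoly A n) :
    theta i (phase g) = PowerSeries.X * PowerSeries.C (layerTheta i 1 g) := by
  ext1 N
  rw [coeff_theta, phase]
  rcases N with _ | N
  · simp [layerTheta_zero]
  · rw [PowerSeries.coeff_succ_X_mul, PowerSeries.coeff_succ_X_mul, PowerSeries.coeff_C,
      PowerSeries.coeff_C]
    split_ifs with h
    · rw [h]
    · rw [layerTheta_zero]

lemma theta_phase_neg (i : Fin (n + 1)) (g : LaurentPoly A n) :
    theta i (phase (-g)) = -theta i (phase g) := by
  rw [theta_phase, theta_phase, layerTheta_neg, map_neg, mul_neg]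

variable {K : Type*} [CommRing K] [Algebra ℚ K]

lemma layerTheta_qsmul (i : Fin (n + 1)) (N : ℕ) (q : ℚ) (g : LaurentPoly K n) :
    layerTheta i N (q • g) = q • layerTheta i N g := by
  ext k
  simp [layerTheta_coeff]

lemma theta_expPhase (i : Fin (n + 1)) (g : LaurentPoly K n) :
    theta i (expPhase g) = theta i (phase g) * expPhase g := by
  ext1 N
  rw [coeff_theta, theta_phase, expPhase, PowerSeries.coeff_mk, mul_assoc]
  rcases N with _ | N
  · simp [layerTheta_one]
  · rw [PowerSeries.coeff_succ_X_mul, PowerSeries.coeff_C_mul, PowerSeries.coeff_mk,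
      layerTheta_qsmul, layerTheta_pow, mul_smul_comm, Nat.factorial_succ, ← nsmul_eq_mul,
      ← Nat.cast_smul_eq_nsmul ℚ, smul_smul]
    congr 1
    have : ((N + 1 : ℕ) : ℚ) ≠ 0 := by positivity
    push_cast
    field_simp

lemma expPhase_eq (g : LaurentPoly K n) :
    expPhase g = PowerSeries.rescale g (PowerSeries.exp (LaurentPoly K n)) := by
  ext1 N
  rw [expPhase, PowerSeries.coeff_mk, PowerSeries.coeff_rescale, PowerSeries.coeff_exp, one_div,
    mul_comm, Algebra.smul_def]

variable (p : ℕ) [hp : Fact p.Prime]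

lemma coeff_Vp (h : Series A n) (N : ℕ) : PowerSeries.coeff N (Vp p h) =
    ((-(p : A)) ^ N) • cartierPoly p (PowerSeries.coeff (p * N) h) := by
  rw [Vp, PowerSeries.coeff_mk]

lemma Vp_theta (i : Fin (n + 1)) (h : Series A n) : Vp p (theta i h) = p • theta i (Vp p h) := by
  ext N k
  rw [coeff_Vp, coeff_theta, map_nsmul, coeff_theta, AddMonoidAlgebra.coeff_smul_apply,
    cartierPoly_coeff, layerTheta_coeff, AddMonoidAlgebra.coeff_smul_apply, layerTheta_coeff,
    coeff_Vp, AddMonoidAlgebra.coeff_smul_apply, cartierPoly_coeff]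
  have e : (Fin.cons ((p * N : ℕ) : ℤ) (p • k) : Fin (n + 1) → ℤ) i =
      p * (Fin.cons (N : ℤ) k : Fin (n + 1) → ℤ) i := by
    refine Fin.cases ?_ (fun j => ?_) i <;> simp
  rw [e, smul_eq_mul, smul_eq_mul, nsmul_eq_mul]
  push_cast
  ring

/-- Multiplication by e^F turns the twisted derivative into θ_i, and θ_i passes V_p with a factor p.
On the other side e^{-F^σ} turns θ_i back into a twisted derivative. -/
theorem dworkOperator_twistedDeriv (g₁ g₂ : LaurentPoly K n) (i : Fin (n + 1)) (h : Series K n) :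
    dworkOperator p g₁ g₂ (twistedDeriv i g₁ h) =
      p • twistedDeriv i g₂ (dworkOperator p g₁ g₂ h) := by
  have h1 : expPhase g₁ * twistedDeriv i g₁ h = theta i (expPhase g₁ * h) := by
    rw [theta_mul, theta_expPhase, twistedDeriv]
    ring
  rw [dworkOperator, h1, Vp_theta, twistedDeriv, dworkOperator, theta_mul, theta_expPhase,
    theta_phase_neg, nsmul_eq_mul, nsmul_eq_mul]
  ring

/-! ### The coefficients of `e^{-F^σ} ∘ V_p ∘ e^F` -/

/-- If p divides both a and a + b then it divides b, so only index pairs divisible by p contribute.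
-/
lemma coeff_expand_mul_series {B : Type*} [CommRing B] (G H : PowerSeries B) (N : ℕ) :
    PowerSeries.coeff (p * N) (PowerSeries.expand p hp.out.ne_zero G * H) =
      ∑ x ∈ Finset.HasAntidiagonal.antidiagonal N, PowerSeries.coeff x.1 G * PowerSeries.coeff (p * x.2) H := by
  rw [PowerSeries.coeff_mul]
  symm
  refine Finset.sum_of_injOn (fun x => (p * x.1, p * x.2)) ?_ ?_ ?_ ?_
  · rintro ⟨a, b⟩ - ⟨c, d⟩ - h
    simp only [Prod.mk.injEq] at h
    exact Prod.ext (Nat.eq_of_mul_eq_mul_left hp.out.pos h.1)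
      (Nat.eq_of_mul_eq_mul_left hp.out.pos h.2)
  · rintro ⟨a, b⟩ h
    simp only [Finset.mem_coe, Finset.HasAntidiagonal.mem_antidiagonal] at h ⊢
    rw [← h, mul_add]
  · rintro ⟨a, b⟩ h h'
    rw [PowerSeries.coeff_expand]
    split_ifs with hd
    · exfalso
      obtain ⟨c, rfl⟩ := hd
      rw [Finset.HasAntidiagonal.mem_antidiagonal] at h
      have hb : p ∣ b := (Nat.dvd_add_right (dvd_mul_right p c)).1 (h ▸ dvd_mul_right p N)
      obtain ⟨d, rfl⟩ := hb
      refine h' ⟨(c, d), ?_, rfl⟩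
      rw [Finset.mem_coe, Finset.HasAntidiagonal.mem_antidiagonal]
      exact Nat.eq_of_mul_eq_mul_left hp.out.pos (by rw [← h, mul_add])
    · rw [zero_mul]
  · rintro ⟨a, b⟩ _
    rw [PowerSeries.coeff_expand_mul]

lemma rescale_truncExp (f : LaurentPoly K n) :
    PowerSeries.rescale f (PowerSeries.map (algebraMap ℚ (LaurentPoly K n)) (truncExp p)) =
      expPhase f * PowerSeries.expand p hp.out.ne_zero
        (PowerSeries.rescale ((p : ℚ)⁻¹ • f ^ p) (PowerSeries.exp (LaurentPoly K n))) := by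
  rw [truncExp, map_mul, map_mul, PowerSeries.map_exp, expPhase_eq]
  congr 1
  ext1 N
  rw [PowerSeries.coeff_rescale, PowerSeries.coeff_map, PowerSeries.coeff_expand,
    PowerSeries.coeff_expand]
  split_ifs with h
  · obtain ⟨k, rfl⟩ := h
    rw [Nat.mul_div_cancel_left _ hp.out.pos, PowerSeries.coeff_rescale, PowerSeries.coeff_rescale,
      PowerSeries.coeff_exp, PowerSeries.coeff_exp, map_mul, Algebra.smul_def, mul_pow, ← map_pow,
      pow_mul]
    simp only [Algebra.algebraMap_self, RingHom.id_apply]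
    ring
  · rw [map_zero, mul_zero]

/-- The expansion of V_p ∘ E(x₀ f) exp(x₀^p g). Here `x.1` is the exponent of g, `y.1` that of f,
and `y.2` the degree of the part of h involved. -/
theorem coeff_dworkOperator (f g fσ : LaurentPoly K n)
    (hg : expandPoly p fσ = f ^ p + (p : K) • g) (h : Series K n) (N : ℕ) :
    PowerSeries.coeff N (dworkOperator p f fσ h) =
      ∑ x ∈ Finset.HasAntidiagonal.antidiagonal N, ∑ y ∈ Finset.HasAntidiagonal.antidiagonal (p * x.2),
        dworkCoeff p N y.1 x.1 •
          cartierPoly p (g ^ x.1 * f ^ y.1 * PowerSeries.coeff y.2 h) := by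
  have hp0 : (p : ℚ) ≠ 0 := by exact_mod_cast hp.out.ne_zero
  set H := expPhase f * h with hH
  -- Passing e^{-F^σ} through V_p: each factor -x₀ f^σ is the image of x₀^p f^σ(x^p)/p under the
  -- weight (-p)^{u₀}.
  have e1 : PowerSeries.coeff N (dworkOperator p f fσ h) = ((-(p : ℚ)) ^ N) •
      cartierPoly p (PowerSeries.coeff (p * N) (PowerSeries.expand p hp.out.ne_zero
        (PowerSeries.rescale ((p : ℚ)⁻¹ • expandPoly p fσ)
          (PowerSeries.exp (LaurentPoly K n))) * H)) := by
    rw [dworkOperator, ← hH, PowerSeries.coeff_mul, coeff_expand_mul_series, cartierPoly_sum,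
      Finset.smul_sum]
    refine Finset.sum_congr rfl fun x hx => ?_
    rw [← Finset.HasAntidiagonal.mem_antidiagonal.1 hx, coeff_Vp, expPhase, PowerSeries.coeff_mk,
      PowerSeries.coeff_rescale, PowerSeries.coeff_exp, smul_pow, ← map_pow]
    rw [show ((p : ℚ)⁻¹ ^ x.1 • expandPoly p (fσ ^ x.1)) * algebraMap ℚ (LaurentPoly K n)
        (1 / x.1.factorial) * PowerSeries.coeff (p * x.2) H =
        ((p : ℚ)⁻¹ ^ x.1 * (1 / x.1.factorial)) •
          (expandPoly p (fσ ^ x.1) * PowerSeries.coeff (p * x.2) H) by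
      rw [Algebra.smul_def, Algebra.smul_def, map_mul (algebraMap ℚ (LaurentPoly K n))]; ring]
    rw [cartierPoly_smul, cartierPoly_expandPoly_mul, smul_smul]
    have e : (-(p : K)) ^ x.2 • cartierPoly p (PowerSeries.coeff (p * x.2) H) =
        ((-(p : ℚ)) ^ x.2) • cartierPoly p (PowerSeries.coeff (p * x.2) H) := by
      ext k
      simp [Algebra.smul_def]
    rw [e, smul_mul_smul_comm, neg_pow fσ]
    rw [show ((-1 : LaurentPoly K n)) ^ x.1 = algebraMap ℚ _ ((-1) ^ x.1) by
      rw [map_pow, map_neg, map_one],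
      ← Algebra.smul_def, smul_mul_assoc, smul_smul]
    congr 1
    rw [neg_pow (p : ℚ), neg_pow (p : ℚ), pow_add, pow_add, inv_pow]
    field_simp
  -- The summand f^p/p joins e^F to form E(x₀ f); the summand g keeps an ordinary exponential.
  have e2 : (p : ℚ)⁻¹ • expandPoly p fσ = g + (p : ℚ)⁻¹ • f ^ p := by
    rw [hg, smul_add, add_comm]
    congr 1
    rw [Nat.cast_smul_eq_nsmul, ← Nat.cast_smul_eq_nsmul ℚ, smul_smul, inv_mul_cancel₀ hp0,
      one_smul]
  rw [e1, e2, ← PowerSeries.exp_mul_exp_eq_exp_add,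
    map_mul (PowerSeries.expand p hp.out.ne_zero), mul_assoc, hH, ← mul_assoc _ _ h,
    mul_comm _ (expPhase f), ← rescale_truncExp, coeff_expand_mul_series, cartierPoly_sum,
    Finset.smul_sum]
  refine Finset.sum_congr rfl fun x _ => ?_
  rw [PowerSeries.coeff_mul, Finset.mul_sum, cartierPoly_sum, Finset.smul_sum]
  refine Finset.sum_congr rfl fun y _ => ?_
  rw [PowerSeries.coeff_rescale, PowerSeries.coeff_rescale, PowerSeries.coeff_exp,
    PowerSeries.coeff_map]
  rw [show g ^ x.1 * algebraMap ℚ (LaurentPoly K n) (1 / x.1.factorial) *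
      (f ^ y.1 * algebraMap ℚ (LaurentPoly K n) (PowerSeries.coeff y.1 (truncExp p)) *
        PowerSeries.coeff y.2 h) = ((x.1.factorial : ℚ)⁻¹ * truncExpCoeff p y.1) •
        (g ^ x.1 * f ^ y.1 * PowerSeries.coeff y.2 h) by
    rw [Algebra.smul_def, map_mul, truncExpCoeff, one_div]; ring]
  rw [cartierPoly_smul, smul_smul]
  congr 1
  rw [dworkCoeff]
  ring

end Commutation

/-! ### Torsion-free and complete coefficient rings -/

section Coefficients

lemma isAddTorsionFree_of_injective {R K : Type*} [CommRing R] [CommRing K] [Algebra ℚ K]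
    [Algebra R K] (hRK : Function.Injective (algebraMap R K)) : IsAddTorsionFree R := by
  refine ⟨fun m hm x y hxy => hRK ?_⟩
  have h := congrArg (algebraMap R K) hxy
  simp only [map_nsmul] at h
  rw [← Nat.cast_smul_eq_nsmul ℚ, ← Nat.cast_smul_eq_nsmul ℚ] at h
  have hm' : (m : ℚ) ≠ 0 := by exact_mod_cast hm
  simpa [smul_smul, inv_mul_cancel₀ hm'] using congrArg (fun z => (m : ℚ)⁻¹ • z) h

variable {R : Type*} [CommRing R]

lemma natCast_mul_cancel [IsAddTorsionFree R] {m : ℕ} (hm : m ≠ 0) {x y : R}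
    (h : (m : R) * x = m * y) : x = y := by
  rw [← nsmul_eq_mul, ← nsmul_eq_mul] at h
  exact nsmul_right_injective hm h

lemma pow_mul_cancel [IsAddTorsionFree R] {p s : ℕ} (hp : p ≠ 0) {x y : R}
    (h : (p : R) ^ s * x = p ^ s * y) : x = y := by
  refine natCast_mul_cancel (m := p ^ s) (pow_ne_zero s hp) ?_
  push_cast
  exact h

variable (p : ℕ) [hp : Fact p.Prime]

/-- From u p + v b = 1, the product b v is 1 - u p, a unit because p lies in the Jacobson radical of
a p-adically complete ring. -/
lemma isUnit_natCast [IsAdicComplete (Ideal.span {(p : R)}) R] {b : ℕ} (hb : ¬ p ∣ b) :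
    IsUnit (b : R) := by
  have hcop : IsCoprime (p : ℤ) (b : ℤ) := by
    rw [Nat.isCoprime_iff_coprime]
    exact (Nat.Prime.coprime_iff_not_dvd hp.out).2 hb
  obtain ⟨u, v, huv⟩ := hcop
  have h1 : (p : R) ∈ (⊥ : Ideal R).jacobson :=
    IsAdicComplete.le_jacobson_bot (Ideal.span {(p : R)}) (Ideal.mem_span_singleton_self _)
  have h2 := Ideal.mem_jacobson_bot.1 h1 (-(u : R))
  have h3 : (p : R) * -(u : R) + 1 = b * v := by
    have := congrArg (Int.cast : ℤ → R) huv
    push_cast at this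
    linear_combination -this
  rw [h3] at h2
  exact isUnit_of_mul_isUnit_left h2

lemma exists_natCast_dvd_pow [IsAdicComplete (Ideal.span {(p : R)}) R] {m : ℕ} (hm : m ≠ 0) :
    ∃ s, (m : R) ∣ (p : R) ^ s := by
  obtain ⟨s, b, hb, rfl⟩ := Nat.exists_eq_pow_mul_and_not_dvd hm p hp.out.ne_one
  obtain ⟨u, hu⟩ := isUnit_natCast (R := R) p hb
  refine ⟨s, ↑u⁻¹, ?_⟩
  push_cast
  rw [← hu, mul_assoc, Units.mul_inv, mul_one]

lemma exists_algebraMap_eq_of_valGE {K : Type*} [CommRing K] [Algebra ℚ K] [Algebra R K]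
    [IsAdicComplete (Ideal.span {(p : R)}) R] {s : ℕ} {q : ℚ} (h : ValGE p s q) :
    ∃ r : R, algebraMap R K (p ^ s * r) = algebraMap ℚ K q := by
  obtain ⟨a, b, hb, hab⟩ := h.exists_eq
  obtain ⟨u, hu⟩ := isUnit_natCast (R := R) p hb
  refine ⟨a * ↑u⁻¹, ?_⟩
  have h1 := congrArg (algebraMap ℚ K) hab
  have h2 : algebraMap R K b * algebraMap R K ↑u⁻¹ = 1 := by
    rw [← hu, ← map_mul, Units.mul_inv, map_one]
  simp only [map_mul, map_pow, map_natCast, map_intCast] at h1 h2 ⊢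
  linear_combination (-(algebraMap R K ↑u⁻¹)) * h1 + algebraMap ℚ K q * h2

end Coefficients

/-! ### The graded pieces of the cone algebra -/

section Layer

variable {A : Type*} [CommRing A] {n : ℕ} {Δ : Set (Fin n → ℝ)}

lemma mem_latticeCone_iff {N : ℕ} {k : Fin n → ℤ} :
    (N, k) ∈ latticeCone Δ ↔ ∃ v ∈ Δ, toReal k = (N : ℝ) • v := by
  constructor
  · rintro ⟨r, -, v, hv, e⟩
    simp only [Prod.smul_mk, Prod.mk.injEq, smul_eq_mul, mul_one] at e
    exact ⟨v, hv, e.1 ▸ e.2⟩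
  · rintro ⟨v, hv, e⟩
    exact ⟨N, Nat.cast_nonneg N, v, hv, by simp [e]⟩

lemma latticeCone_add (hΔ : Convex ℝ Δ) {N M : ℕ} {k l : Fin n → ℤ} (hk : (N, k) ∈ latticeCone Δ)
    (hl : (M, l) ∈ latticeCone Δ) : (N + M, k + l) ∈ latticeCone Δ := by
  rw [mem_latticeCone_iff] at *
  obtain ⟨v, hv, hk⟩ := hk
  obtain ⟨w, hw, hl⟩ := hl
  rcases Nat.eq_zero_or_pos (N + M) with h0 | h0
  · obtain ⟨rfl, rfl⟩ : N = 0 ∧ M = 0 := by omega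
    exact ⟨v, hv, by rw [toReal_add, hk, hl]; simp⟩
  · have h0' : (0 : ℝ) < N + M := by exact_mod_cast h0
    refine ⟨((N : ℝ) / (N + M)) • v + ((M : ℝ) / (N + M)) • w,
      hΔ hv hw (by positivity) (by positivity) (by field_simp), ?_⟩
    rw [toReal_add, hk, hl]
    funext i
    simp
    field_simp

/-- The Laurent polynomials `g` for which `g x₀^N` is supported in the cone over `Δ`. -/
def layer (A : Type*) [CommRing A] {n : ℕ} (Δ : Set (Fin n → ℝ)) (N : ℕ) :
    Submodule A (LaurentPoly A n) where
  carrier := {g | ∀ k, g.coeff k ≠ 0 → (N, k) ∈ latticeCone Δ}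
  zero_mem' := fun k hk => absurd (by simp) hk
  add_mem' := by
    intro g h hg hh k hk
    by_cases h0 : g.coeff k = 0
    · exact hh k fun h0' => hk (by simp [h0, h0'])
    · exact hg k h0
  smul_mem' := fun c g hg k hk => hg k fun h0 => hk (by simp [h0])

lemma mem_coneSeries_iff {h : Series A n} :
    h ∈ coneSeries A Δ ↔ ∀ N, PowerSeries.coeff N h ∈ layer A Δ N :=
  ⟨fun H N k hk => H (N, k) hk, fun H u hu => H u.1 u.2 hu⟩

lemma layer_mul (hΔ : Convex ℝ Δ) {N M : ℕ} {g h : LaurentPoly A n} (hg : g ∈ layer A Δ N)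
    (hh : h ∈ layer A Δ M) : g * h ∈ layer A Δ (N + M) := by
  intro k hk
  rw [show (g * h).coeff k = act g (fun k => h.coeff k) k from
    congrFun (coeff_mul_eq_act g h) k, act_apply] at hk
  obtain ⟨a, ha, h0⟩ := Finset.exists_ne_zero_of_sum_ne_zero hk
  have h1 := latticeCone_add hΔ (hg a (Finsupp.mem_support_iff.1 ha))
    (hh (k - a) fun h => h0 (by rw [h, mul_zero]))
  rwa [add_sub_cancel] at h1

lemma layer_pow_mul (hΔ : Convex ℝ Δ) {N M : ℕ} {g h : LaurentPoly A n} (hg : g ∈ layer A Δ N)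
    (hh : h ∈ layer A Δ M) (i : ℕ) : g ^ i * h ∈ layer A Δ (N * i + M) := by
  induction i with
  | zero => simpa using hh
  | succ i ih =>
    rw [pow_succ', mul_assoc, mul_add, mul_one, add_comm (N * i) N, add_assoc]
    exact layer_mul hΔ hg ih

lemma layer_pow (hΔ : Convex ℝ Δ) {N : ℕ} {g : LaurentPoly A n} (hg : g ∈ layer A Δ N) {i : ℕ}
    (hi : i ≠ 0) : g ^ i ∈ layer A Δ (N * i) := by
  obtain ⟨j, rfl⟩ := Nat.exists_eq_succ_of_ne_zero hi
  exact layer_pow_mul hΔ hg hg j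

lemma layer_of_nsmul [IsAddTorsionFree A] {N m : ℕ} (hm : m ≠ 0) {g : LaurentPoly A n}
    (h : (m : A) • g ∈ layer A Δ N) : g ∈ layer A Δ N := by
  intro k hk
  refine h k fun h0 => hk (natCast_mul_cancel hm ?_)
  rw [mul_zero, ← h0]
  rfl

lemma mem_layer_one_of_support {g : LaurentPoly A n} (h : ∀ a, g.coeff a ≠ 0 → toReal a ∈ Δ) :
    g ∈ layer A Δ 1 := fun k hk => mem_latticeCone_iff.2 ⟨toReal k, h k hk, by simp⟩

lemma mem_layer_newtonPolytope (f : LaurentPoly A n) : f ∈ layer A (newtonPolytope f) 1 :=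
  mem_layer_one_of_support fun a ha =>
    subset_convexHull ℝ _ ⟨a, Finsupp.mem_support_iff.2 ha, rfl⟩

lemma layer_mapCoeff {B : Type*} [CommRing B] (τ : A →+* B) {N : ℕ} {g : LaurentPoly A n}
    (hg : g ∈ layer A Δ N) : mapCoeff τ g ∈ layer B Δ N := fun k hk =>
  hg k fun h0 => hk (by simp [mapCoeff, h0])

variable (p : ℕ) [hp : Fact p.Prime]

lemma layer_cartierPoly {N : ℕ} {g : LaurentPoly A n} (hg : g ∈ layer A Δ (p * N)) :
    cartierPoly p g ∈ layer A Δ N := by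
  intro k hk
  rw [cartierPoly_coeff] at hk
  obtain ⟨v, hv, e⟩ := mem_latticeCone_iff.1 (hg _ hk)
  refine mem_latticeCone_iff.2 ⟨v, hv, ?_⟩
  have hp0 : (p : ℝ) ≠ 0 := by exact_mod_cast hp.out.ne_zero
  funext i
  have := congrFun e i
  simp only [toReal, Pi.smul_apply, smul_eq_mul, Int.nsmul_eq_mul] at this ⊢
  push_cast at this
  rw [mul_assoc] at this
  exact mul_left_cancel₀ hp0 this

lemma layer_expandPoly {N : ℕ} {g : LaurentPoly A n} (hg : g ∈ layer A Δ N) :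
    expandPoly p g ∈ layer A Δ (p * N) := by
  classical
  intro k hk
  have e : expandPoly p g = ∑ a ∈ g.coeff.support,
      AddMonoidAlgebra.single (p • a) (g.coeff a) := by
    conv_lhs => rw [← AddMonoidAlgebra.sum_coeff_single g, Finsupp.sum, map_sum]
    exact Finset.sum_congr rfl fun a _ => expandPoly_single p a _
  rw [e, AddMonoidAlgebra.coeff_sum, Finsupp.finsetSum_apply] at hk
  obtain ⟨a, ha, h0⟩ := Finset.exists_ne_zero_of_sum_ne_zero hk
  rw [AddMonoidAlgebra.coeff_single, Finsupp.single_apply] at h0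
  split_ifs at h0 with hak
  · obtain ⟨v, hv, e⟩ := mem_latticeCone_iff.1 (hg a (Finsupp.mem_support_iff.1 ha))
    refine mem_latticeCone_iff.2 ⟨v, hv, ?_⟩
    rw [← hak]
    funext i
    have := congrFun e i
    simp only [toReal, Pi.smul_apply, smul_eq_mul, Int.nsmul_eq_mul] at this ⊢
    push_cast
    rw [this, mul_assoc]
  · exact absurd rfl h0

/-- p g is the difference of two polynomials supported in pΔ, and multiplication by p does not
shrink the support when there is no torsion. -/
lemma layer_frobenius_lift [IsAddTorsionFree A] (hΔ : Convex ℝ Δ) {f fσ g : LaurentPoly A n}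
    (hf : f ∈ layer A Δ 1) (hfσ : fσ ∈ layer A Δ 1)
    (hg : expandPoly p fσ = f ^ p + (p : A) • g) : g ∈ layer A Δ p := by
  refine layer_of_nsmul hp.out.ne_zero ?_
  rw [show (p : A) • g = expandPoly p fσ - f ^ p by rw [hg, add_sub_cancel_left]]
  have h1 := layer_expandPoly p hfσ
  have h2 := layer_pow hΔ hf hp.out.ne_zero
  rw [mul_one] at h1
  rw [one_mul] at h2
  exact sub_mem h1 h2

end Layer

/-! ### Integrality of `e^{-F^σ} ∘ V_p ∘ e^F` -/

section Integrality

variable {R : Type*} [CommRing R] {n : ℕ} {Δ : Set (Fin n → ℝ)} (p : ℕ) [hp : Fact p.Prime]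

/-- The operator with the coefficients `c` in place of the rational numbers `dworkCoeff`. -/
def integralDwork (c : ℕ → ℕ → ℕ → R) (f g : LaurentPoly R n) : Series R n →ₗ[R] Series R n where
  toFun h := PowerSeries.mk fun N => ∑ x ∈ Finset.HasAntidiagonal.antidiagonal N,
    ∑ y ∈ Finset.HasAntidiagonal.antidiagonal (p * x.2),
      c N y.1 x.1 • cartierPoly p (g ^ x.1 * f ^ y.1 * PowerSeries.coeff y.2 h)
  map_add' h₁ h₂ := by
    ext1 N
    rw [map_add, PowerSeries.coeff_mk, PowerSeries.coeff_mk, PowerSeries.coeff_mk,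
      ← Finset.sum_add_distrib]
    refine Finset.sum_congr rfl fun x _ => ?_
    rw [← Finset.sum_add_distrib]
    refine Finset.sum_congr rfl fun y _ => ?_
    rw [map_add, mul_add, cartierPoly_add, smul_add]
  map_smul' r h := by
    ext1 N
    rw [RingHom.id_apply, PowerSeries.coeff_mk, PowerSeries.coeff_smul, PowerSeries.coeff_mk,
      Finset.smul_sum]
    refine Finset.sum_congr rfl fun x _ => ?_
    rw [Finset.smul_sum]
    refine Finset.sum_congr rfl fun y _ => ?_
    rw [PowerSeries.coeff_smul, mul_smul_comm, cartierPoly_smul, smul_comm]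

lemma coeff_integralDwork (c : ℕ → ℕ → ℕ → R) (f g : LaurentPoly R n) (h : Series R n) (N : ℕ) :
    PowerSeries.coeff N (integralDwork p c f g h) =
      ∑ x ∈ Finset.HasAntidiagonal.antidiagonal N,
        ∑ y ∈ Finset.HasAntidiagonal.antidiagonal (p * x.2),
          c N y.1 x.1 • cartierPoly p (g ^ x.1 * f ^ y.1 * PowerSeries.coeff y.2 h) := by
  have e : integralDwork p c f g h = PowerSeries.mk fun N =>
      ∑ x ∈ Finset.HasAntidiagonal.antidiagonal N,
        ∑ y ∈ Finset.HasAntidiagonal.antidiagonal (p * x.2),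
          c N y.1 x.1 • cartierPoly p (g ^ x.1 * f ^ y.1 * PowerSeries.coeff y.2 h) := rfl
  rw [e, PowerSeries.coeff_mk]

lemma integralDwork_mem_coneSeries (hΔ : Convex ℝ Δ) (c : ℕ → ℕ → ℕ → R) {f g : LaurentPoly R n}
    (hf : f ∈ layer R Δ 1) (hg : g ∈ layer R Δ p) {h : Series R n} (hh : h ∈ coneSeries R Δ) :
    integralDwork p c f g h ∈ coneSeries R Δ := by
  rw [mem_coneSeries_iff] at *
  intro N
  rw [coeff_integralDwork]
  refine Submodule.sum_mem _ fun x hx => Submodule.sum_mem _ fun y hy =>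
    Submodule.smul_mem _ _ (layer_cartierPoly p ?_)
  have h1 := layer_pow_mul hΔ hg (layer_pow_mul hΔ hf (hh y.2) y.1) x.1
  rw [mul_assoc]
  rw [Finset.HasAntidiagonal.mem_antidiagonal] at hx hy
  rwa [one_mul, hy, ← mul_add, hx] at h1

lemma integralDwork_mem_nullSeries {c : ℕ → ℕ → ℕ → R}
    (hc : ∀ s : ℕ, ∃ N₀, ∀ N, N₀ ≤ N → ∀ i j, (p : R) ^ s ∣ c N i j) (f g : LaurentPoly R n)
    (h : Series R n) : integralDwork p c f g h ∈ nullSeries p R n := by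
  intro s
  obtain ⟨N₀, hN₀⟩ := hc s
  refine ⟨N₀, fun u hu => ?_⟩
  rw [coeffAt, coeff_integralDwork, AddMonoidAlgebra.coeff_sum, Finsupp.finsetSum_apply]
  refine Finset.dvd_sum fun x _ => ?_
  rw [AddMonoidAlgebra.coeff_sum, Finsupp.finsetSum_apply]
  refine Finset.dvd_sum fun y _ => ?_
  rw [AddMonoidAlgebra.coeff_smul_apply, smul_eq_mul]
  exact (hN₀ _ hu _ _).mul_right _

lemma coeffAt_integralDwork_zero (c : ℕ → ℕ → ℕ → R) (f g : LaurentPoly R n) {h : Series R n}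
    (hh : coeffAt h 0 = 0) : coeffAt (integralDwork p c f g h) 0 = 0 := by
  have hh' : (PowerSeries.coeff 0 h).coeff 0 = 0 := hh
  rw [coeffAt, Prod.fst_zero, Prod.snd_zero, coeff_integralDwork]
  simp only [Finset.Nat.antidiagonal_zero, Finset.sum_singleton, mul_zero, pow_zero, one_mul,
    AddMonoidAlgebra.coeff_smul_apply, cartierPoly_coeff, smul_zero, hh']

variable {K : Type*} [CommRing K] [Algebra ℚ K] [Algebra R K]

lemma coeff_mapSeries {B : Type*} [CommRing B] (τ : R →+* B) (h : Series R n) (N : ℕ) :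
    PowerSeries.coeff N (mapSeries τ h) = mapCoeff τ (PowerSeries.coeff N h) := by
  rw [mapSeries, PowerSeries.coeff_map]

lemma mapCoeff_smul {B : Type*} [CommRing B] (τ : R →+* B) (r : R) (g : LaurentPoly R n) :
    mapCoeff τ (r • g) = τ r • mapCoeff τ g := by
  ext k
  simp [mapCoeff]

lemma mapSeries_integralDwork {c : ℕ → ℕ → ℕ → R}
    (hc : ∀ N i j, i + p * j ≤ p * N →
      algebraMap R K (c N i j) = algebraMap ℚ K (dworkCoeff p N i j))
    {f fσ g : LaurentPoly R n} (hg : expandPoly p fσ = f ^ p + (p : R) • g) (h : Series R n) :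
    mapSeries (algebraMap R K) (integralDwork p c f g h) =
      dworkOperator p (mapCoeff (algebraMap R K) f) (mapCoeff (algebraMap R K) fσ)
        (mapSeries (algebraMap R K) h) := by
  have hg' : expandPoly p (mapCoeff (algebraMap R K) fσ) = mapCoeff (algebraMap R K) f ^ p
      + (p : K) • mapCoeff (algebraMap R K) g := by
    rw [expandPoly_mapCoeff, hg, map_add, map_pow, mapCoeff_smul, map_natCast]
  ext1 N
  rw [coeff_dworkOperator p _ _ _ hg', coeff_mapSeries, coeff_integralDwork, map_sum]
  refine Finset.sum_congr rfl fun x hx => ?_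
  rw [map_sum]
  refine Finset.sum_congr rfl fun y hy => ?_
  rw [Finset.HasAntidiagonal.mem_antidiagonal] at hx hy
  rw [mapCoeff_smul, hc N _ _ (by rw [← hx, mul_add, ← hy]; omega), ← cartierPoly_mapCoeff,
    map_mul, map_mul, map_pow, map_pow, coeff_mapSeries, algebraMap_smul]

/-- A choice in R of the quotients of the rational coefficients by p^{`depth N`}; values outside i +
p j ≤ p N never occur in the operator and are irrelevant. -/
lemma exists_integral_dworkCoeff [IsAdicComplete (Ideal.span {(p : R)}) R] (hp2 : 2 < p) :
    ∃ c : ℕ → ℕ → ℕ → R, ∀ N i j, i + p * j ≤ p * N →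
      algebraMap R K (p ^ depth N * c N i j) = algebraMap ℚ K (dworkCoeff p N i j) := by
  classical
  have h : ∀ N i j, ∃ r : R, i + p * j ≤ p * N →
      algebraMap R K (p ^ depth N * r) = algebraMap ℚ K (dworkCoeff p N i j) := by
    intro N i j
    by_cases hc : i + p * j ≤ p * N
    · obtain ⟨r, hr⟩ := exists_algebraMap_eq_of_valGE (R := R) (K := K) p
        (dworkCoeff_val p hp2 hc)
      exact ⟨r, fun _ => hr⟩
    · exact ⟨0, fun h => absurd h hc⟩
  choose c hc using h
  exact ⟨c, hc⟩

end Integrality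

/-! ### The module of completed series -/

section Completed

variable {R : Type*} [CommRing R] {n : ℕ} {Δ : Set (Fin n → ℝ)}

lemma coeff_zero_eq_zero {h : Series R n} (hh : h ∈ coneSeriesPlus R Δ) :
    PowerSeries.coeff 0 h = 0 := by
  ext k
  by_contra hk
  obtain ⟨v, -, e⟩ := mem_latticeCone_iff.1 (hh.1 (0, k) hk)
  have hk0 : k = 0 := toReal_injective n (by rw [e]; funext i; simp [toReal])
  exact hk (hk0 ▸ hh.2)

lemma mem_coneSeriesPlus_iff {h : Series R n} :
    h ∈ coneSeriesPlus R Δ ↔ (∀ N, PowerSeries.coeff N h ∈ layer R Δ N) ∧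
      PowerSeries.coeff 0 h = 0 := by
  refine ⟨fun H => ⟨mem_coneSeries_iff.1 H.1, coeff_zero_eq_zero H⟩,
    fun H => ⟨mem_coneSeries_iff.2 H.1, ?_⟩⟩
  change (PowerSeries.coeff 0 h).coeff 0 = 0
  rw [H.2]
  rfl

/-- Guarantees that a coefficientwise limit is again a Laurent polynomial in each degree of x₀. -/
lemma finite_layer (hΔ : Bornology.IsBounded Δ) (N : ℕ) :
    {k : Fin n → ℤ | (N, k) ∈ latticeCone Δ}.Finite := by
  obtain ⟨C, hC⟩ := hΔ.exists_norm_le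
  refine (Set.finite_Icc (fun _ => -⌈(N : ℝ) * C⌉) (fun _ => ⌈(N : ℝ) * C⌉)).subset fun k hk => ?_
  obtain ⟨v, hv, e⟩ := mem_latticeCone_iff.1 hk
  have h : ∀ i, |(k i : ℝ)| ≤ N * C := by
    intro i
    have h1 : (k i : ℝ) = N * v i := congrFun e i
    rw [h1, abs_mul, Nat.abs_cast]
    exact mul_le_mul_of_nonneg_left ((norm_le_pi_norm v i).trans (hC v hv)) (Nat.cast_nonneg N)
  rw [Set.mem_Icc, Pi.le_def, Pi.le_def]
  refine ⟨fun i => ?_, fun i => ?_⟩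
  · have h1 := (abs_le.1 (h i)).1
    have h2 := Int.le_ceil ((N : ℝ) * C)
    have : ((-⌈(N : ℝ) * C⌉ : ℤ) : ℝ) ≤ k i := by push_cast; linarith
    exact_mod_cast this
  · have h1 := (abs_le.1 (h i)).2
    have h2 := Int.le_ceil ((N : ℝ) * C)
    have : (k i : ℝ) ≤ (⌈(N : ℝ) * C⌉ : ℤ) := by linarith
    exact_mod_cast this

lemma exists_smul_eq_of_dvd [IsAddTorsionFree R] {c : ℕ} (hc : c ≠ 0) {q : LaurentPoly R n}
    (hq : ∀ k, (c : R) ∣ q.coeff k) : ∃ q' : LaurentPoly R n, q = (c : R) • q' := by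
  choose d hd using hq
  have hfin : (Function.support d).Finite := by
    refine q.coeff.support.finite_toSet.subset fun k hk => ?_
    rw [Finset.mem_coe, Finsupp.mem_support_iff, hd]
    intro h0
    exact hk (natCast_mul_cancel hc (by rw [h0, mul_zero]))
  refine ⟨AddMonoidAlgebra.ofCoeff (Finsupp.ofSupportFinite d hfin), ?_⟩
  ext k
  rw [AddMonoidAlgebra.coeff_smul_apply, smul_eq_mul, hd]
  rfl

variable (p : ℕ) [hp : Fact p.Prime]

lemma exists_pow_smul_eq [IsAddTorsionFree R] (S : ℕ) (h : completedSeriesPlus p R Δ)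
    (hh : ∀ u, (p : R) ^ S ∣ coeffAt (h : Series R n) u) :
    ∃ w : completedSeriesPlus p R Δ, h = (p : R) ^ S • w := by
  have hpS : p ^ S ≠ 0 := pow_ne_zero S hp.out.ne_zero
  have hd : ∀ N, ∃ q : LaurentPoly R n,
      PowerSeries.coeff N (h : Series R n) = ((p ^ S : ℕ) : R) • q := fun N =>
    exists_smul_eq_of_dvd hpS fun k => by rw [Nat.cast_pow]; exact hh (N, k)
  choose q hq using hd
  have h1 := mem_coneSeriesPlus_iff.1 h.2.1
  refine ⟨⟨PowerSeries.mk q, mem_coneSeriesPlus_iff.2 ⟨fun N => ?_, ?_⟩, fun s => ?_⟩, ?_⟩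
  · rw [PowerSeries.coeff_mk]
    refine layer_of_nsmul hpS ?_
    rw [← hq]
    exact h1.1 N
  · rw [PowerSeries.coeff_mk]
    have h2 := hq 0
    rw [h1.2] at h2
    ext k
    refine natCast_mul_cancel hpS ?_
    have h3 := congrArg (fun g : LaurentPoly R n => g.coeff k) h2
    simp only [AddMonoidAlgebra.coeff_smul_apply, smul_eq_mul] at h3
    rw [← h3]
    simp
  -- Dividing by p^S costs S powers of p, so convergence of the quotient to precision s needs
  -- precision S + s for h.
  · obtain ⟨N₀, hN₀⟩ := h.2.2 (S + s)
    refine ⟨N₀, fun u hu => ?_⟩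
    obtain ⟨d, hd⟩ := hN₀ u hu
    refine ⟨d, ?_⟩
    have e : coeffAt (h : Series R n) u = (p : R) ^ S * (q u.1).coeff u.2 := by
      rw [coeffAt, hq, AddMonoidAlgebra.coeff_smul_apply, smul_eq_mul]
      push_cast
      rfl
    rw [coeffAt, PowerSeries.coeff_mk]
    refine pow_mul_cancel (s := S) hp.out.ne_zero ?_
    rw [← e, hd]
    ring
  · refine Subtype.ext ?_
    ext1 N
    rw [hq, Submodule.coe_smul, PowerSeries.coeff_smul, PowerSeries.coeff_mk]
    push_cast
    rfl

lemma coeffAt_sum {ι : Type*} (s : Finset ι) (h : ι → Series R n) (u : ℕ × (Fin n → ℤ)) :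
    coeffAt (∑ i ∈ s, h i) u = ∑ i ∈ s, coeffAt (h i) u := by
  rw [coeffAt, map_sum, AddMonoidAlgebra.coeff_sum, Finsupp.finsetSum_apply]
  rfl

lemma exists_adic_limit [IsAdicComplete (Ideal.span {(p : R)}) R] (a : ℕ → R) :
    ∃ L : R, ∀ S, (p : R) ^ S ∣ L - ∑ s ∈ Finset.range S, (p : R) ^ s * a s := by
  obtain ⟨L, hL⟩ := IsPrecomplete.prec (I := Ideal.span {(p : R)}) (M := R) inferInstance
    (f := fun S => ∑ s ∈ Finset.range S, (p : R) ^ s * a s) (by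
      intro m k hmk
      rw [SModEq.comm, SModEq.sub_mem, smul_eq_mul, Ideal.mul_top, Ideal.span_singleton_pow,
        Ideal.mem_span_singleton, ← Finset.sum_Ico_eq_sub _ hmk]
      refine Finset.dvd_sum fun s hs => ?_
      exact Dvd.dvd.mul_right (pow_dvd_pow _ (Finset.mem_Ico.1 hs).1) _)
  refine ⟨L, fun S => ?_⟩
  have := (hL S).symm
  rwa [SModEq.sub_mem, smul_eq_mul, Ideal.mul_top, Ideal.span_singleton_pow,
    Ideal.mem_span_singleton] at this

/-- Completeness in the form used for surjectivity: the series ∑ p^s β_s has a sum whose S-th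
remainder is p^S times an element of the module itself. -/
lemma exists_adic_sum [IsAddTorsionFree R] [IsAdicComplete (Ideal.span {(p : R)}) R]
    (hΔ : Bornology.IsBounded Δ) (β : ℕ → completedSeriesPlus p R Δ) :
    ∃ h : completedSeriesPlus p R Δ, ∀ S, ∃ w : completedSeriesPlus p R Δ,
      h = ∑ s ∈ Finset.range S, (p : R) ^ s • β s + (p : R) ^ S • w := by
  -- The limit is taken to be 0 off the cone and at the origin, so that the support conditions hold
  -- by construction.
  have hlim : ∀ u : ℕ × (Fin n → ℤ), ∃ L : R, (L ≠ 0 → u ∈ latticeCone Δ \ {0}) ∧ ∀ S,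
      (p : R) ^ S ∣ L - ∑ s ∈ Finset.range S, (p : R) ^ s * coeffAt (β s : Series R n) u := by
    intro u
    by_cases hu : u ∈ latticeCone Δ \ {0}
    · obtain ⟨L, hL⟩ := exists_adic_limit p fun s => coeffAt (β s : Series R n) u
      exact ⟨L, fun _ => hu, hL⟩
    · refine ⟨0, fun h => absurd rfl h, fun S => ?_⟩
      rw [Finset.sum_eq_zero, sub_zero]
      · exact dvd_zero _
      · intro s _
        have h0 : coeffAt (β s : Series R n) u = 0 := by
          by_contra h0
          refine hu ⟨(β s).2.1.1 u h0, ?_⟩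
          rintro rfl
          exact h0 (β s).2.1.2
        rw [h0, mul_zero]
  choose L hL0 hL using hlim
  have hfin : ∀ N, (Function.support fun k => L (N, k)).Finite := fun N =>
    (finite_layer hΔ N).subset fun k hk => (hL0 (N, k) hk).1
  let h : Series R n := PowerSeries.mk fun N =>
    AddMonoidAlgebra.ofCoeff (Finsupp.ofSupportFinite (fun k => L (N, k)) (hfin N))
  have hcoeff : ∀ u, coeffAt h u = L u := by
    intro u
    rw [coeffAt, PowerSeries.coeff_mk]
    rfl
  have hmem : h ∈ completedSeriesPlus p R Δ := by
    refine ⟨⟨fun u hu => ?_, ?_⟩, fun s => ?_⟩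
    · rw [hcoeff] at hu
      exact (hL0 u hu).1
    · rw [hcoeff]
      by_contra h0
      exact (hL0 0 h0).2 rfl
    · obtain ⟨N₀, hN₀⟩ := (∑ i ∈ Finset.range s, (p : R) ^ i • β i).2.2 s
      refine ⟨N₀, fun u hu => ?_⟩
      have h1 := hN₀ u hu
      rw [Submodule.coe_sum, coeffAt_sum] at h1
      simp only [Submodule.coe_smul, coeffAt_smul] at h1
      rw [hcoeff]
      exact (dvd_sub_left h1).1 (hL u s)
  refine ⟨⟨h, hmem⟩, fun S => ?_⟩
  obtain ⟨w, hw⟩ := exists_pow_smul_eq p S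
    ((⟨h, hmem⟩ : completedSeriesPlus p R Δ) - ∑ s ∈ Finset.range S, (p : R) ^ s • β s) (by
      intro u
      have h1 := hL u S
      rw [← hcoeff] at h1
      have e : coeffAt (((⟨h, hmem⟩ : completedSeriesPlus p R Δ) -
          ∑ s ∈ Finset.range S, (p : R) ^ s • β s : completedSeriesPlus p R Δ) : Series R n) u =
          coeffAt h u - ∑ s ∈ Finset.range S, (p : R) ^ s * coeffAt (β s : Series R n) u := by
        rw [Submodule.coe_sub, Submodule.coe_sum, sub_eq_add_neg, coeffAt_add,
          ← neg_one_smul R (∑ s ∈ Finset.range S, _), coeffAt_smul, coeffAt_sum]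
        simp only [Submodule.coe_smul, coeffAt_smul]
        ring
      rwa [e])
  exact ⟨w, by rw [← hw, add_sub_cancel]⟩

end Completed

/-! ### The twisted derivative with index `0` -/

section EulerDeriv

variable {R : Type*} [CommRing R] {n : ℕ} {Δ : Set (Fin n → ℝ)}

lemma layerTheta_zero_index (N : ℕ) (g : LaurentPoly R n) : layerTheta 0 N g = (N : R) • g := by
  ext k
  rw [layerTheta_coeff, AddMonoidAlgebra.coeff_smul_apply]
  simp

lemma coeff_zero_twistedDeriv_zero (g : LaurentPoly R n) (y : Series R n) :
    PowerSeries.coeff 0 (twistedDeriv 0 g y) = 0 := by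
  rw [twistedDeriv, map_add, coeff_theta, theta_phase, mul_assoc, PowerSeries.coeff_zero_X_mul,
    layerTheta_zero_index]
  simp

lemma coeff_succ_twistedDeriv_zero (g : LaurentPoly R n) (y : Series R n) (N : ℕ) :
    PowerSeries.coeff (N + 1) (twistedDeriv 0 g y) =
      ((N + 1 : ℕ) : R) • PowerSeries.coeff (N + 1) y + g * PowerSeries.coeff N y := by
  rw [twistedDeriv, map_add, coeff_theta, theta_phase, mul_assoc, PowerSeries.coeff_succ_X_mul,
    PowerSeries.coeff_C_mul, layerTheta_zero_index, layerTheta_zero_index]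
  simp

lemma twistedDeriv_zero_mem (p : ℕ) (hΔ : Convex ℝ Δ) {g : LaurentPoly R n}
    (hg : g ∈ layer R Δ 1) {y : Series R n} (hy : y ∈ completedSeriesPlus p R Δ) :
    twistedDeriv 0 g y ∈ completedSeriesPlus p R Δ := by
  have hy1 := mem_coneSeriesPlus_iff.1 hy.1
  refine ⟨mem_coneSeriesPlus_iff.2 ⟨fun N => ?_, coeff_zero_twistedDeriv_zero g y⟩, fun s => ?_⟩
  · rcases N with _ | N
    · rw [coeff_zero_twistedDeriv_zero]
      exact zero_mem _
    · rw [coeff_succ_twistedDeriv_zero]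
      refine add_mem (Submodule.smul_mem _ _ (hy1.1 _)) ?_
      rw [add_comm]
      exact layer_mul hΔ hg (hy1.1 N)
  · obtain ⟨N₀, hN₀⟩ := hy.2 s
    refine ⟨N₀ + 1, ?_⟩
    rintro ⟨N, k⟩ hN
    rcases N with _ | N
    · simp at hN
    · rw [coeffAt, coeff_succ_twistedDeriv_zero, AddMonoidAlgebra.coeff_add, Finsupp.add_apply,
        AddMonoidAlgebra.coeff_smul_apply, smul_eq_mul]
      refine dvd_add (Dvd.dvd.mul_left (hN₀ (N + 1, k) (by simp only at hN ⊢; omega)) _) ?_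
      rw [show (g * PowerSeries.coeff N y).coeff k =
        act g (fun k => (PowerSeries.coeff N y).coeff k) k from
        congrFun (coeff_mul_eq_act g _) k, act_apply]
      exact Finset.dvd_sum fun a _ => Dvd.dvd.mul_left (hN₀ (N, k - a) (by simp only at hN ⊢; omega)) _

end EulerDeriv

/-! ### The Laplace transform -/

section Laplace

variable {R : Type*} [CommRing R] {n : ℕ} {Δ : Set (Fin n → ℝ)} (p : ℕ)

lemma mem_pow_smul_top_iff {M : Type*} [AddCommGroup M] [Module R M] {s : ℕ} {x : M} :
    x ∈ (Ideal.span {(p : R)} ^ s • ⊤ : Submodule R M) ↔ ∃ y, x = (p : R) ^ s • y := by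
  rw [Ideal.span_singleton_pow, Submodule.ideal_span_singleton_smul,
    Submodule.mem_smul_pointwise_iff_exists]
  constructor
  · rintro ⟨y, -, rfl⟩
    exact ⟨y, rfl⟩
  · rintro ⟨y, rfl⟩
    exact ⟨y, trivial, rfl⟩

lemma laplace_val (g : LaurentPoly R n) (h : completedSeriesPlus p R Δ) {s T : ℕ}
    (hT : ∀ u : ℕ × (Fin n → ℤ), T ≤ u.1 → (p : R) ^ s ∣ coeffAt (h : Series R n) u) :
    (laplace p Δ g h).val s = (Ideal.span {(p : R)} ^ s • ⊤ : Submodule R (Omega Δ g)).mkQ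
      (∑ N ∈ Finset.range T, laplaceTerm Δ g N h) := by
  rw [map_sum]
  change ∑ᶠ N, _ = _
  refine finsum_eq_sum_of_support_subset _ fun N hN => ?_
  rw [Finset.coe_range, Set.mem_Iio]
  by_contra hlt
  refine hN ((Submodule.Quotient.mk_eq_zero _).2 (laplaceTerm_mem p Δ g N s h fun k => ?_))
  exact hT (N, k) (not_lt.1 hlt)

lemma omega_eq (g : LaurentPoly R n) (u : ℕ × (Fin n → ℤ)) : omega g u =
    ((u.1 - 1).factorial : R) • Localization.mk (AddMonoidAlgebra.single u.2 (1 : R))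
      (⟨g ^ u.1, u.1, rfl⟩ : Submonoid.powers g) := rfl

lemma coe_omegaIn (g : LaurentPoly R n) {u : ℕ × (Fin n → ℤ)} (hu : u ∈ latticeCone Δ \ {0}) :
    (omegaIn Δ g u : Localization.Away g) = omega g u := by
  rw [omegaIn, dif_pos hu]

lemma coe_laplaceTerm (g : LaurentPoly R n) {h : Series R n} (hh : h ∈ coneSeriesPlus R Δ)
    (N : ℕ) : ((laplaceTerm Δ g N h : Omega Δ g) : Localization.Away g) =
      ((-1) ^ N * ((N - 1).factorial : R)) • Localization.mk (PowerSeries.coeff N h)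
        (⟨g ^ N, N, rfl⟩ : Submonoid.powers g) := by
  have e : PowerSeries.coeff N h = ∑ k ∈ (PowerSeries.coeff N h).coeff.support,
      coeffAt h (N, k) • AddMonoidAlgebra.single k (1 : R) := by
    conv_lhs => rw [← AddMonoidAlgebra.sum_coeff_single (PowerSeries.coeff N h), Finsupp.sum]
    refine Finset.sum_congr rfl fun k _ => ?_
    rw [AddMonoidAlgebra.smul_single, smul_eq_mul, mul_one]
    rfl
  rw [laplaceTerm_apply]
  conv_rhs => rw [e]
  rw [Localization.mk_sum, Submodule.coe_sum, Finset.smul_sum]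
  refine Finset.sum_congr rfl fun k hk => ?_
  have hk' : coeffAt h (N, k) ≠ 0 := Finsupp.mem_support_iff.1 hk
  have hmem : ((N, k) : ℕ × (Fin n → ℤ)) ∈ latticeCone Δ \ {0} := by
    refine ⟨hh.1 _ hk', fun h0 => hk' ?_⟩
    rw [Set.mem_singleton_iff] at h0
    rw [h0]
    exact hh.2
  rw [Submodule.coe_smul, Submodule.coe_smul, coe_omegaIn g hmem, omega_eq, ← Localization.smul_mk,
    smul_smul, smul_smul, smul_smul]
  congr 1
  ring

/-- Since g y_N / g^{N+1} = y_N / g^N, both parts of the twisted derivative become transforms of y,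
and N · (N-1)! = N! makes them consecutive terms of N ↦ N L_N(y). At N = 0 the term y_0 vanishes. -/
lemma laplaceTerm_twistedDeriv (hΔ : Convex ℝ Δ) {g : LaurentPoly R n} (hg : g ∈ layer R Δ 1)
    (y : completedSeriesPlus p R Δ) (N : ℕ) :
    laplaceTerm Δ g (N + 1) (twistedDeriv 0 g y) =
      ((N + 1 : ℕ) : R) • laplaceTerm Δ g (N + 1) y - (N : R) • laplaceTerm Δ g N y := by
  refine Subtype.ext ?_
  rw [coe_laplaceTerm g (twistedDeriv_zero_mem p hΔ hg y.2).1, Submodule.coe_sub,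
    Submodule.coe_smul, Submodule.coe_smul, coe_laplaceTerm g y.2.1, coe_laplaceTerm g y.2.1,
    coeff_succ_twistedDeriv_zero, ← Localization.add_mk_self, smul_add, ← Localization.smul_mk,
    sub_eq_add_neg]
  congr 1
  · rw [smul_smul, smul_smul, mul_comm]
  · have e1 : Localization.mk (g * PowerSeries.coeff N (y : Series R n))
        (⟨g ^ (N + 1), N + 1, rfl⟩ : Submonoid.powers g) =
        Localization.mk (PowerSeries.coeff N (y : Series R n))
          (⟨g ^ N, N, rfl⟩ : Submonoid.powers g) := by
      rw [Localization.mk_eq_mk_iff, Localization.r_iff_exists]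
      refine ⟨1, ?_⟩
      simp only [OneMemClass.coe_one, one_mul]
      ring
    rw [e1, smul_smul, ← neg_smul]
    rcases N with _ | N
    · rw [coeff_zero_eq_zero y.2.1, Localization.mk_zero, smul_zero, smul_zero]
    · congr 1
      rw [Nat.add_sub_cancel, Nat.add_sub_cancel, Nat.factorial_succ]
      push_cast
      ring

lemma laplaceTerm_zero (g : LaurentPoly R n) {h : Series R n} (hh : h ∈ coneSeriesPlus R Δ) :
    laplaceTerm Δ g 0 h = 0 := by
  refine Subtype.ext ?_
  rw [coe_laplaceTerm g hh, coeff_zero_eq_zero hh, Localization.mk_zero, smul_zero]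
  rfl

theorem laplace_twistedDeriv (hΔ : Convex ℝ Δ) {g : LaurentPoly R n} (hg : g ∈ layer R Δ 1)
    (h y : completedSeriesPlus p R Δ) (hy : (h : Series R n) = twistedDeriv 0 g y) :
    laplace p Δ g h = 0 := by
  refine AdicCompletion.ext fun s => ?_
  obtain ⟨N₁, hN₁⟩ := h.2.2 s
  obtain ⟨N₂, hN₂⟩ := y.2.2 s
  rw [laplace_val p g h (s := s) (T := (N₁ + N₂) + 1) fun u hu => hN₁ u (by omega),
    AdicCompletion.val_zero_apply, Submodule.mkQ_apply, Submodule.Quotient.mk_eq_zero, hy]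
  -- The telescoped partial sum T · L_T(y) tends to 0 because the coefficients of y do.
  have e : ∀ T : ℕ, ∑ N ∈ Finset.range (T + 1), laplaceTerm Δ g N (twistedDeriv 0 g y) =
      (T : R) • laplaceTerm Δ g T y := by
    intro T
    induction T with
    | zero =>
      rw [zero_add, Finset.sum_range_one, laplaceTerm_zero g (hy ▸ h.2.1), Nat.cast_zero, zero_smul]
    | succ T ih =>
      rw [Finset.sum_range_succ, ih, laplaceTerm_twistedDeriv p hΔ hg, add_sub_cancel]
  rw [e]
  exact Submodule.smul_mem _ _ (laplaceTerm_mem p Δ g _ s y fun k => hN₂ _ (by simp))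

lemma monomial_mem_completedSeriesPlus {u : ℕ × (Fin n → ℤ)} (hu : u ∈ latticeCone Δ \ {0})
    (r : R) : (PowerSeries.monomial u.1 (AddMonoidAlgebra.single u.2 r) : Series R n) ∈
      completedSeriesPlus p R Δ := by
  have h : ∀ v : ℕ × (Fin n → ℤ), coeffAt (PowerSeries.monomial u.1
      (AddMonoidAlgebra.single u.2 r) : Series R n) v ≠ 0 → v = u := by
    classical
    intro v hv
    rw [coeffAt, PowerSeries.coeff_monomial] at hv
    split_ifs at hv with h1
    · rw [AddMonoidAlgebra.coeff_single, Finsupp.single_apply] at hv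
      split_ifs at hv with h2
      · exact Prod.ext h1 h2.symm
      · exact absurd rfl hv
    · simp at hv
  refine ⟨⟨fun v hv => h v hv ▸ hu.1, ?_⟩, fun s => ⟨u.1 + 1, fun v hv => ?_⟩⟩
  · by_contra h0
    exact hu.2 (h 0 h0).symm
  · by_cases h0 : coeffAt (PowerSeries.monomial u.1 (AddMonoidAlgebra.single u.2 r) :
      Series R n) v = 0
    · rw [h0]
      exact dvd_zero _
    · rw [h v h0] at hv
      omega

lemma coeffAt_monomial_of_ne {m N : ℕ} (h : N ≠ m) (q : LaurentPoly R n) (k : Fin n → ℤ) :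
    coeffAt (PowerSeries.monomial m q : Series R n) (N, k) = 0 := by
  rw [coeffAt, PowerSeries.coeff_monomial, if_neg h]
  rfl

lemma laplace_of_coeffAt_eq_zero (g : LaurentPoly R n) (h : completedSeriesPlus p R Δ) {m : ℕ}
    (hm : ∀ u : ℕ × (Fin n → ℤ), u.1 ≠ m → coeffAt (h : Series R n) u = 0) :
    laplace p Δ g h = AdicCompletion.of _ _ (laplaceTerm Δ g m h) := by
  refine AdicCompletion.ext fun s => ?_
  rw [laplace_val p g h (s := s) (T := m + 1) fun u hu => by
    rw [hm u (by omega)]; exact dvd_zero _, AdicCompletion.of_apply, Finset.sum_range_succ,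
    Finset.sum_eq_zero, zero_add]
  intro N hN
  rw [laplaceTerm_apply]
  refine Finset.sum_eq_zero fun k _ => ?_
  rw [hm (N, k) (by have := Finset.mem_range.1 hN; simp only; omega), zero_smul]

lemma of_mem_range_laplace (g : LaurentPoly R n) (ω : Omega Δ g) :
    AdicCompletion.of _ _ ω ∈ LinearMap.range (laplace p Δ g) := by
  obtain ⟨ω, hω⟩ := ω
  induction hω using Submodule.span_induction with
  | zero =>
    rw [show (⟨0, _⟩ : Omega Δ g) = 0 from rfl, map_zero]
    exact zero_mem _
  | add x y hx hy h₁ h₂ =>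
    rw [show (⟨x + y, _⟩ : Omega Δ g) = ⟨x, hx⟩ + ⟨y, hy⟩ from rfl, map_add]
    exact add_mem h₁ h₂
  | smul r x hx h₁ =>
    rw [show (⟨r • x, _⟩ : Omega Δ g) = r • ⟨x, hx⟩ from rfl, map_smul]
    exact Submodule.smul_mem _ r h₁
  | mem x hx =>
    obtain ⟨⟨m, k⟩, hu, rfl⟩ := hx
    refine ⟨⟨_, monomial_mem_completedSeriesPlus p hu ((-1) ^ m)⟩, ?_⟩
    rw [laplace_of_coeffAt_eq_zero p g _ (m := m) fun u hu' => coeffAt_monomial_of_ne hu' _ u.2]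
    congr 1
    refine Subtype.ext ?_
    rw [coe_laplaceTerm g (monomial_mem_completedSeriesPlus p hu ((-1) ^ m)).1,
      PowerSeries.coeff_monomial_same]
    change _ = omega g (m, k)
    rw [omega_eq]
    simp only
    rw [show AddMonoidAlgebra.single k ((-1 : R) ^ m) =
        ((-1 : R) ^ m) • AddMonoidAlgebra.single k (1 : R) by
      rw [AddMonoidAlgebra.smul_single, smul_eq_mul, mul_one], ← Localization.smul_mk, smul_smul]
    congr 1
    have : ((-1 : R)) ^ m * (-1) ^ m = 1 := by rw [← mul_pow]; simp
    linear_combination ((m - 1).factorial : R) * this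

variable [hp : Fact p.Prime]

/-- An element of the completion is a_0 + ∑ p^s b_s with a_0 and b_s in Ω_g. Each of these lifts,
and the lifts are summed p-adically; modulo p^S the remainder disappears by linearity alone. -/
theorem laplace_surjective [IsAddTorsionFree R] [IsAdicComplete (Ideal.span {(p : R)}) R]
    (hΔ : Bornology.IsBounded Δ) (g : LaurentPoly R n) :
    Function.Surjective (laplace p Δ g) := by
  intro z
  obtain ⟨a, rfl⟩ := AdicCompletion.mk_surjective _ _ z
  have hb : ∀ s, ∃ b : Omega Δ g, a (s + 1) = a s + (p : R) ^ s • b := by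
    intro s
    have h := (a.2 (Nat.le_succ s)).symm
    rw [SModEq.sub_mem] at h
    obtain ⟨b, hb⟩ := (mem_pow_smul_top_iff p).1 h
    exact ⟨b, by rw [← hb]; exact (add_sub_cancel _ _).symm⟩
  choose b hb using hb
  have ha : ∀ S, a S = a 0 + ∑ s ∈ Finset.range S, (p : R) ^ s • b s := by
    intro S
    induction S with
    | zero => simp
    | succ S ih => rw [hb, ih, Finset.sum_range_succ, add_assoc]
  obtain ⟨α, hα⟩ := of_mem_range_laplace p g (a 0)
  choose β hβ using fun s => of_mem_range_laplace p g (b s)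
  obtain ⟨h, hh⟩ := exists_adic_sum p hΔ β
  refine ⟨α + h, AdicCompletion.ext fun S => ?_⟩
  obtain ⟨w, hw⟩ := hh S
  have e : laplace p Δ g (α + h) = AdicCompletion.of _ _ (a S) + (p : R) ^ S • laplace p Δ g w := by
    rw [hw, ha S, map_add, map_add, map_add, hα, map_smul, map_sum, map_sum, add_assoc]
    refine congrArg (fun x => AdicCompletion.of _ _ (a 0) + (x + (p : R) ^ S • laplace p Δ g w)) ?_
    refine Finset.sum_congr rfl fun s _ => ?_
    rw [map_smul, map_smul, hβ]
  have e0 : ∀ x : Omega Δ g ⧸ (Ideal.span {(p : R)} ^ S • ⊤ : Submodule R (Omega Δ g)),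
      (p : R) ^ S • x = 0 := by
    intro x
    obtain ⟨x, rfl⟩ := Submodule.Quotient.mk_surjective _ x
    rw [← Submodule.Quotient.mk_smul, Submodule.Quotient.mk_eq_zero]
    exact (mem_pow_smul_top_iff p).2 ⟨x, rfl⟩
  rw [e, AdicCompletion.val_add_apply, AdicCompletion.val_smul_apply, e0, add_zero,
    AdicCompletion.of_apply, AdicCompletion.mk_apply_coe]

end Laplace

/-! ### Divisibility of formal expansions -/

section FormalDivisibility

variable {R : Type*} [CommRing R] {n : ℕ} {Δ : Set (Fin n → ℝ)} {g : LaurentPoly R n}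
  {b : Fin n → ℤ}

lemma act_mapCoeff {B : Type*} [CommRing B] (τ : R →+* B) (q : LaurentPoly R n)
    (φ : (Fin n → ℤ) → R) :
    act (mapCoeff τ q) (fun k => τ (φ k)) = fun k => τ (act q φ k) := by
  induction q using AddMonoidAlgebra.induction_linear with
  | zero => funext k; simp
  | add x y hx hy => funext k; simp [hx, hy]
  | single l r =>
    funext k
    rw [mapCoeff, AddMonoidAlgebra.mapRingHom_single, act_single_apply, act_single_apply, map_mul]

lemma dvd_act {c : R} (q : LaurentPoly R n) {φ : (Fin n → ℤ) → R} (h : ∀ k, c ∣ φ k)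
    (k : Fin n → ℤ) : c ∣ act q φ k := by
  rw [act_apply]
  exact Finset.dvd_sum fun a _ => Dvd.dvd.mul_left (h _) _

/-- Injectivity of multiplication by g^m over R/c. The data of `IsUnitVertex` survive reduction
modulo c because Δ is only required to contain the support of g. -/
lemma IsUnitVertex.dvd_of_dvd_act (hV : IsUnitVertex Δ g b) {c : R} {φ : (Fin n → ℤ) → R}
    (hφ : φ ∈ OmegaFormal R Δ b) (m : ℕ) (h : ∀ k, c ∣ act (g ^ m) φ k) (k : Fin n → ℤ) :
    c ∣ φ k := by
  let τ := Ideal.Quotient.mk (Ideal.span {c})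
  have hτ : ∀ x, τ x = 0 ↔ c ∣ x := fun x => by
    rw [Ideal.Quotient.eq_zero_iff_mem, Ideal.mem_span_singleton]
  obtain ⟨w, ε, l, c', d, hε, hw, -, hl, -, hg⟩ := (hV.map τ).exists_factor
  have hφ' : (fun k => τ (φ k)) ∈ OmegaFormal (R ⧸ Ideal.span {c}) Δ b := fun k hk =>
    hφ k fun h0 => hk (by simp only [h0, map_zero])
  have h0 := act_injective w ε hε l d hl hg (formal_mem_boundedSeries w hw hφ') m (by
    rw [← map_pow, act_mapCoeff]
    funext k
    exact (hτ _).2 (h k))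
  exact (hτ _).1 (congrFun h0 k)

lemma IsUnitVertex.eq_of_act_eq (hV : IsUnitVertex Δ g b) {φ ψ : (Fin n → ℤ) → R}
    (hφ : φ ∈ OmegaFormal R Δ b) (hψ : ψ ∈ OmegaFormal R Δ b) (m : ℕ)
    (h : act (g ^ m) φ = act (g ^ m) ψ) : φ = ψ := by
  funext k
  rw [← sub_eq_zero, ← zero_dvd_iff]
  refine hV.dvd_of_dvd_act (sub_mem hφ hψ) m (fun k => ?_) k
  rw [map_sub, h, sub_self]
  exact dvd_zero _

lemma IsUnitVertex.convex (hV : IsUnitVertex Δ g b) : Convex ℝ Δ := by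
  obtain ⟨S, hS⟩ := hV.polytope
  exact hS ▸ convex_convexHull ℝ _

lemma IsUnitVertex.mem_layer_one (hV : IsUnitVertex Δ g b) : g ∈ layer R Δ 1 :=
  mem_layer_one_of_support hV.support_subset

/-- Factor g = c x^b (1 - l): the shift by -m b moves the support of q into the tangent cone, and (1
- l)^{-m} is an iterated geometric series. -/
lemma IsUnitVertex.exists_formal_quotient (hV : IsUnitVertex Δ g b) {m : ℕ} {q : LaurentPoly R n}
    (hq : q ∈ layer R Δ m) :
    ∃ ψ ∈ OmegaFormal R Δ b, act (g ^ m) ψ = fun k => q.coeff k := by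
  obtain ⟨w, ε, l, c, d, hε, hw, hcd, hl, hl', hg⟩ := hV.exists_factor
  have hl'' : ∀ a, l.coeff a ≠ 0 → toReal a ∈ tangentCone Δ b := fun a ha =>
    ⟨1, zero_le_one, toReal (a + b), hl' a ha, by rw [toReal_add]; simp⟩
  have hshift : act (AddMonoidAlgebra.single (-(m • b)) (d ^ m)) (fun k => q.coeff k) ∈
      OmegaFormal R Δ b := by
    intro k hk
    rw [act_single_apply] at hk
    obtain ⟨v, hv, e⟩ := mem_latticeCone_iff.1 (hq _ (right_ne_zero_of_mul hk))
    refine ⟨m, Nat.cast_nonneg m, v, hv, ?_⟩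
    rw [smul_sub, ← e]
    funext i
    simp [toReal]
  have hpow : ∀ (j : ℕ), ∀ φ ∈ OmegaFormal R Δ b,
      ∃ ψ ∈ OmegaFormal R Δ b, act ((1 - l) ^ j) ψ = φ := by
    intro j
    induction j with
    | zero => exact fun φ hφ => ⟨φ, hφ, by simp⟩
    | succ j ih =>
      intro φ hφ
      obtain ⟨ψ, hψ, e⟩ := ih φ hφ
      obtain ⟨χ, hχ, e'⟩ := act_one_sub_surjective hV.convex w ε hε hw l hl hl'' hψ
      exact ⟨χ, hχ, by rw [pow_succ, map_mul, Module.End.mul_apply, e', e]⟩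
  obtain ⟨ψ, hψ, e⟩ := hpow m _ hshift
  have hgm : g ^ m = AddMonoidAlgebra.single (m • b) (c ^ m) * (1 - l) ^ m := by
    rw [← AddMonoidAlgebra.single_pow, ← mul_pow, ← hg, ← mul_assoc,
      AddMonoidAlgebra.single_mul_single, hcd, add_neg_cancel, ← AddMonoidAlgebra.one_def,
      one_mul]
  refine ⟨ψ, hψ, ?_⟩
  rw [hgm, map_mul, Module.End.mul_apply, e, ← Module.End.mul_apply, ← map_mul,
    AddMonoidAlgebra.single_mul_single, ← mul_pow, hcd, one_pow, add_neg_cancel,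
    ← AddMonoidAlgebra.one_def, map_one, Module.End.one_apply]

lemma expansion_laplaceTerm (hV : IsUnitVertex Δ g b) {h : Series R n}
    (hh : h ∈ coneSeriesPlus R Δ) (N : ℕ) (ψ : OmegaFormal R Δ b)
    (hψ : act (g ^ N) ψ = fun k => (PowerSeries.coeff N h).coeff k) :
    expansion hV (laplaceTerm Δ g N h) = ((-1) ^ N * ((N - 1).factorial : R)) • ψ := by
  refine Subtype.ext (hV.eq_of_act_eq (SetLike.coe_mem _) (SetLike.coe_mem _) N ?_)
  have h1 := expansion_spec hV (laplaceTerm Δ g N h)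
  rw [coe_laplaceTerm g hh, Localization.smul_mk] at h1
  rw [h1 N _ rfl, Submodule.coe_smul, map_smul, hψ]
  rfl

variable (p : ℕ)

lemma completedExpansion_laplace_val (hV : IsUnitVertex Δ g b) (h : completedSeriesPlus p R Δ)
    (ψ : ℕ → OmegaFormal R Δ b)
    (hψ : ∀ N, act (g ^ N) (ψ N) = fun k => (PowerSeries.coeff N (h : Series R n)).coeff k)
    {s T : ℕ}
    (hT : ∀ u : ℕ × (Fin n → ℤ), T ≤ u.1 → (p : R) ^ s ∣ coeffAt (h : Series R n) u) :
    (completedExpansion p hV (laplace p Δ g h)).val s =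
      (Ideal.span {(p : R)} ^ s • ⊤ : Submodule R (OmegaFormal R Δ b)).mkQ
        (∑ N ∈ Finset.range T, ((-1) ^ N * ((N - 1).factorial : R)) • ψ N) := by
  rw [completedExpansion, AdicCompletion.map_val_apply, laplace_val p g h hT]
  have e : ∑ N ∈ Finset.range T, ((-1) ^ N * ((N - 1).factorial : R)) • ψ N =
      expansion hV (∑ N ∈ Finset.range T, laplaceTerm Δ g N h) := by
    rw [map_sum]
    exact Finset.sum_congr rfl fun N _ => (expansion_laplaceTerm hV h.2.1 N (ψ N) (hψ N)).symm
  rw [e]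
  rfl

variable [hp : Fact p.Prime]

/-- Dividing every coefficient by p^s preserves the support, so membership can be tested
coefficientwise. -/
lemma mem_pow_smul_top_omegaFormal_iff [IsAddTorsionFree R] {s : ℕ} {φ : OmegaFormal R Δ b} :
    φ ∈ (Ideal.span {(p : R)} ^ s • ⊤ : Submodule R (OmegaFormal R Δ b)) ↔
      ∀ k, (p : R) ^ s ∣ (φ : (Fin n → ℤ) → R) k := by
  rw [mem_pow_smul_top_iff]
  constructor
  · rintro ⟨ψ, rfl⟩ k
    exact Dvd.intro _ rfl
  · intro h
    choose ψ hψ using h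
    refine ⟨⟨ψ, fun k hk => φ.2 k fun h0 => hk ?_⟩, Subtype.ext (funext hψ)⟩
    refine pow_mul_cancel (s := s) hp.out.ne_zero ?_
    rw [← hψ, h0, mul_zero]

lemma smul_cancel [IsAddTorsionFree R] {m : ℕ} (hm : m ≠ 0) {x y : LaurentPoly R n}
    (h : (m : R) • x = (m : R) • y) : x = y := by
  ext k
  refine natCast_mul_cancel hm ?_
  exact congrArg (fun q : LaurentPoly R n => q.coeff k) h

/-- The partial sums of the Laplace transform, multiplied by `g^M`. -/
def laplaceNumerator (g : LaurentPoly R n) (h : Series R n) (M : ℕ) : LaurentPoly R n :=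
  ∑ m ∈ Finset.range (M + 1), ((-1) ^ m * ((m - 1).factorial : R)) •
    (g ^ (M - m) * PowerSeries.coeff m h)

lemma laplaceNumerator_succ (g : LaurentPoly R n) (h : Series R n) (M : ℕ) :
    laplaceNumerator g h (M + 1) = g * laplaceNumerator g h M +
      ((-1) ^ (M + 1) * (M.factorial : R)) • PowerSeries.coeff (M + 1) h := by
  rw [laplaceNumerator, Finset.sum_range_succ, laplaceNumerator, Finset.mul_sum]
  congr 1
  · refine Finset.sum_congr rfl fun m hm => ?_
    rw [Nat.succ_sub (by have := Finset.mem_range.1 hm; omega), pow_succ', mul_smul_comm, mul_assoc]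
  · simp

lemma laplaceNumerator_mem (hΔ : Convex ℝ Δ) (hg : g ∈ layer R Δ 1) {h : Series R n}
    (hh : h ∈ coneSeriesPlus R Δ) (M : ℕ) : laplaceNumerator g h M ∈ layer R Δ M := by
  refine Submodule.sum_mem _ fun m hm => Submodule.smul_mem _ _ ?_
  have h1 := layer_pow_mul hΔ hg ((mem_coneSeriesPlus_iff.1 hh).1 m) (M - m)
  rwa [one_mul, Nat.sub_add_cancel (by have := Finset.mem_range.1 hm; omega)] at h1

/-- The full sum of the terms (-1)^N (N-1)! ψ_N is 0, so the partial sum up to M is minus the tail.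
There (N-1)! is divisible by M!, and ψ_N inherits p^t from h_N. -/
lemma dvd_laplaceNumerator [IsAddTorsionFree R] [IsAdicComplete (Ideal.span {(p : R)}) R]
    (hV : IsUnitVertex Δ g b) (h : completedSeriesPlus p R Δ)
    (hE : completedExpansion p hV (laplace p Δ g h) = 0) (M t : ℕ)
    (ht : ∀ u : ℕ × (Fin n → ℤ), M < u.1 → (p : R) ^ t ∣ coeffAt (h : Series R n) u)
    (k : Fin n → ℤ) :
    (M.factorial : R) * (p : R) ^ t ∣ (laplaceNumerator g (h : Series R n) M).coeff k := by
  have hψ : ∀ N, ∃ ψ : OmegaFormal R Δ b,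
      act (g ^ N) ψ = fun k => (PowerSeries.coeff N (h : Series R n)).coeff k := fun N => by
    obtain ⟨ψ, h1, h2⟩ := hV.exists_formal_quotient ((mem_coneSeriesPlus_iff.1 h.2.1).1 N)
    exact ⟨⟨ψ, h1⟩, h2⟩
  choose ψ hψ using hψ
  -- The prime-to-p part of M! is a unit, so M! divides some p^{s₀}, and working modulo p^{s₀+t}
  -- detects divisibility by M! p^t.
  obtain ⟨s₀, hs₀⟩ := exists_natCast_dvd_pow (R := R) p M.factorial_ne_zero
  obtain ⟨N₀, hN₀⟩ := h.2.2 (s₀ + t)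
  have h1 := completedExpansion_laplace_val p hV h ψ hψ (s := s₀ + t) (T := (M + 1) + N₀)
    fun u hu => hN₀ u (by omega)
  rw [hE, AdicCompletion.val_zero_apply, eq_comm, Submodule.mkQ_apply,
    Submodule.Quotient.mk_eq_zero, mem_pow_smul_top_omegaFormal_iff] at h1
  have hdvd : (M.factorial : R) * (p : R) ^ t ∣ (p : R) ^ (s₀ + t) := by
    rw [pow_add]
    exact mul_dvd_mul_right hs₀ _
  have h2 := dvd_act (g ^ M) (fun k => hdvd.trans (h1 k)) k
  rw [Finset.sum_range_add, Submodule.coe_add, map_add, Pi.add_apply] at h2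
  have h3 : act (g ^ M) ((∑ N ∈ Finset.range (M + 1),
      ((-1) ^ N * ((N - 1).factorial : R)) • ψ N : OmegaFormal R Δ b) : (Fin n → ℤ) → R) k =
      (laplaceNumerator g (h : Series R n) M).coeff k := by
    rw [laplaceNumerator, Submodule.coe_sum, map_sum, Finset.sum_apply,
      AddMonoidAlgebra.coeff_sum, Finsupp.finsetSum_apply]
    refine Finset.sum_congr rfl fun N hN => ?_
    rw [Submodule.coe_smul, map_smul, Pi.smul_apply, AddMonoidAlgebra.coeff_smul_apply]
    congr 1
    rw [show (g ^ (M - N) * PowerSeries.coeff N (h : Series R n)).coeff k =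
      act (g ^ (M - N)) (fun k => (PowerSeries.coeff N (h : Series R n)).coeff k) k from
      congrFun (coeff_mul_eq_act _ _) k, ← hψ, ← Module.End.mul_apply, ← map_mul, ← pow_add,
      Nat.sub_add_cancel (by have := Finset.mem_range.1 hN; omega)]
  rw [h3] at h2
  refine (dvd_add_left ?_).1 h2
  refine dvd_act _ (fun k => ?_) k
  rw [Submodule.coe_sum, Finset.sum_apply]
  refine Finset.dvd_sum fun N _ => ?_
  rw [Submodule.coe_smul, Pi.smul_apply, smul_eq_mul]
  refine mul_dvd_mul (Dvd.dvd.mul_left ?_ _)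
    (hV.dvd_of_dvd_act (ψ (M + 1 + N)).2 (M + 1 + N) (fun k => ?_) k)
  · exact Nat.cast_dvd_cast (α := R) (Nat.factorial_dvd_factorial (by omega))
  · rw [hψ]
    exact ht (M + 1 + N, k) (by simp only; omega)

/-- A series whose Laplace transform has zero expansion is in the image of the twisted
derivative. -/
theorem exists_twistedDeriv_eq [IsAddTorsionFree R] [IsAdicComplete (Ideal.span {(p : R)}) R]
    (hV : IsUnitVertex Δ g b) (h : completedSeriesPlus p R Δ)
    (hE : completedExpansion p hV (laplace p Δ g h) = 0) :
    ∃ y : completedSeriesPlus p R Δ, (h : Series R n) = twistedDeriv 0 g y := by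
  have hh := mem_coneSeriesPlus_iff.1 h.2.1
  have hd : ∀ M, ∃ q : LaurentPoly R n,
      laplaceNumerator g (h : Series R n) M = (M.factorial : R) • q := fun M =>
    exists_smul_eq_of_dvd M.factorial_ne_zero fun k => by
      simpa using dvd_laplaceNumerator p hV h hE M 0 (fun u _ => by simp) k
  choose q hq using hd
  have hqmem : ∀ M, q M ∈ layer R Δ M := fun M => by
    refine layer_of_nsmul M.factorial_ne_zero ?_
    rw [← hq]
    exact laplaceNumerator_mem hV.convex hV.mem_layer_one h.2.1 M
  have hq0 : q 0 = 0 := by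
    have h0 := hq 0
    rw [laplaceNumerator, Finset.sum_range_one, hh.2] at h0
    simpa using h0.symm
  have hsign : ∀ M : ℕ, ((-1 : R)) ^ M * (-1) ^ M = 1 := fun M => by rw [← mul_pow]; simp
  -- Up to sign, y_M is the M-th numerator over M!. The recursion of the numerators then reads
  -- h_{N+1} = (N+1) y_{N+1} + g y_N, and the factor p^t in `dvd_laplaceNumerator` makes y_M tend to
  -- 0.
  let y : Series R n := PowerSeries.mk fun M => ((-1 : R) ^ M) • q M
  have hy : ∀ M, PowerSeries.coeff M y = ((-1 : R) ^ M) • q M := fun M => PowerSeries.coeff_mk _ _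
  refine ⟨⟨y, mem_coneSeriesPlus_iff.2 ⟨fun M => ?_, ?_⟩, fun t => ?_⟩, ?_⟩
  · rw [hy]
    exact Submodule.smul_mem _ _ (hqmem M)
  · rw [hy, hq0, smul_zero]
  · obtain ⟨N₀, hN₀⟩ := h.2.2 t
    refine ⟨N₀, ?_⟩
    rintro ⟨M, k⟩ hM
    have h1 := dvd_laplaceNumerator p hV h hE M t (fun u hu => hN₀ u (hM.trans hu.le)) k
    rw [hq, AddMonoidAlgebra.coeff_smul_apply, smul_eq_mul] at h1
    obtain ⟨d, hd⟩ := h1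
    rw [mul_assoc] at hd
    rw [coeffAt, hy, AddMonoidAlgebra.coeff_smul_apply, smul_eq_mul]
    exact Dvd.dvd.mul_left ⟨d, natCast_mul_cancel M.factorial_ne_zero hd⟩ _
  · change (h : Series R n) = twistedDeriv 0 g y
    ext1 N
    rcases N with _ | N
    · rw [coeff_zero_twistedDeriv_zero, hh.2]
    · rw [coeff_succ_twistedDeriv_zero, hy, hy]
      have h1 := laplaceNumerator_succ g (h : Series R n) N
      rw [hq, hq, Nat.factorial_succ, mul_smul_comm] at h1
      refine smul_cancel N.factorial_ne_zero ?_
      have h2 := congrArg (fun z => ((-1 : R) ^ (N + 1)) • z) h1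
      simp only [smul_add, smul_smul] at h2
      rw [← mul_assoc ((-1 : R) ^ (N + 1)) ((-1) ^ (N + 1)), hsign, one_mul] at h2
      rw [eq_sub_of_add_eq' h2.symm, mul_smul_comm, smul_add, smul_smul, smul_smul, smul_smul, sub_eq_add_neg,
        ← neg_smul]
      congr 2
      · push_cast
        ring
      · ring

/-- The difference lifts to a series h by surjectivity. Zero expansion puts h in the image of the
twisted derivative, and the Laplace transform kills that image. -/
theorem completedExpansion_injective [IsAddTorsionFree R]
    [IsAdicComplete (Ideal.span {(p : R)}) R] (hV : IsUnitVertex Δ g b)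
    {ω₁ ω₂ : PCompletion p R (Omega Δ g)}
    (h : completedExpansion p hV ω₁ = completedExpansion p hV ω₂) : ω₁ = ω₂ := by
  have hbdd : Bornology.IsBounded Δ := by
    obtain ⟨S, hS⟩ := hV.polytope
    rw [hS, isBounded_convexHull]
    exact ((Finset.finite_toSet S).image _).isBounded
  obtain ⟨h₁, e⟩ := laplace_surjective p hbdd g (ω₁ - ω₂)
  obtain ⟨y, hy⟩ := exists_twistedDeriv_eq p hV h₁ (by
    rw [e, completedExpansion, map_sub, sub_eq_zero]
    exact h)
  rw [← sub_eq_zero, ← e]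
  exact laplace_twistedDeriv p hV.convex hV.mem_layer_one h₁ y hy

theorem laplace_eq_zero_iff [IsAddTorsionFree R] [IsAdicComplete (Ideal.span {(p : R)}) R]
    (hV : IsUnitVertex Δ g b) (h : completedSeriesPlus p R Δ) :
    laplace p Δ g h = 0 ↔
      ∃ y : completedSeriesPlus p R Δ, (h : Series R n) = twistedDeriv 0 g y := by
  constructor
  · intro h0
    refine exists_twistedDeriv_eq p hV h ?_
    rw [h0, completedExpansion, map_zero]
  · rintro ⟨y, hy⟩
    exact laplace_twistedDeriv p hV.convex hV.mem_layer_one h y hy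

end FormalDivisibility

/-! ### Comparison with the Cartier operator on formal expansions -/

/-! ### Truncated binomial series for negative exponents -/

section TruncatedBinomial

variable {A : Type*} [CommRing A]

/-- The homogeneous truncation at `x^J` of the binomial series of `z^(M+1+J) / (z - x)^(M+1)`. -/
def truncBinomial (x z : A) (M J : ℕ) : A :=
  ∑ j ∈ Finset.range J, ((M + j).choose M : A) * (x ^ j * z ^ (J - j))

lemma truncBinomial_succ (x z : A) (M J : ℕ) :
    truncBinomial x z M (J + 1) = z * truncBinomial x z M J + ((M + J).choose M : A) * (x ^ J * z) := by
  rw [truncBinomial, Finset.sum_range_succ, truncBinomial, Finset.mul_sum]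
  congr 1
  · refine Finset.sum_congr rfl fun j hj => ?_
    rw [Nat.succ_sub (Finset.mem_range.1 hj).le, pow_succ]
    ring
  · simp

/-- Multiplication by z - x lowers the exponent M + 1 by one; Pascal's rule accounts for the terms
and for the truncation error. -/
lemma sub_mul_truncBinomial_succ (x z : A) (M J : ℕ) :
    (z - x) * truncBinomial x z (M + 1) J =
      z * truncBinomial x z M J - ((M + J).choose (M + 1) : A) * (x ^ J * z) := by
  induction J with
  | zero => simp [truncBinomial]
  | succ J ih =>
    have h : ((M + 1 + J).choose (M + 1) : A) = (M + J).choose M + (M + J).choose (M + 1) := by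
      rw [show M + 1 + J = M + J + 1 by omega, Nat.choose_succ_succ, Nat.cast_add]
    rw [truncBinomial_succ, truncBinomial_succ, mul_add, mul_left_comm, ih,
      show M + (J + 1) = M + 1 + J by omega, h]
    ring

/-- Induction on M, starting from the geometric sum. Every truncation error is a multiple of x^J,
which is highly divisible by p when x = p g. -/
lemma pow_dvd_sub_pow_mul_truncBinomial (x z : A) (M J : ℕ) :
    x ^ J ∣ (z - x) ^ (M + 1) * truncBinomial x z M J - z ^ (M + 1 + J) := by
  induction M with
  | zero =>
    have h : (z - x) * truncBinomial x z 0 J = z * (z ^ J - x ^ J) := by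
      induction J with
      | zero => simp [truncBinomial]
      | succ J ih =>
        rw [truncBinomial_succ, mul_add, mul_left_comm, ih]
        simp
        ring
    refine ⟨-z, ?_⟩
    rw [zero_add, pow_one, h]
    ring
  | succ M ih =>
    obtain ⟨d, hd⟩ := ih
    refine ⟨z * d - (z - x) ^ (M + 1) * ((M + J).choose (M + 1) : A) * z, ?_⟩
    rw [pow_succ (z - x), mul_assoc, sub_mul_truncBinomial_succ]
    linear_combination z * hd

end TruncatedBinomial

/-! ### Comparison of the Dwork and Cartier operators on expansions -/

section Comparison

lemma mul_dvd_mul_iff_left_of_natCast {R : Type*} [CommRing R] [IsAddTorsionFree R] {m : ℕ}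
    (hm : m ≠ 0) {x y : R} : (m : R) * x ∣ m * y ↔ x ∣ y := by
  refine ⟨fun ⟨d, hd⟩ => ⟨d, natCast_mul_cancel hm (by rw [hd, mul_assoc])⟩,
    fun h => mul_dvd_mul_left _ h⟩

variable {R : Type*} [CommRing R] {n : ℕ} (p : ℕ) [hp : Fact p.Prime]

/-- Since h_m = f^m ψ_m and i + m = p M, the product f^i h_m equals f^{pM} ψ_m; the exponent of f no
longer depends on i or m. -/
lemma cartierFun_act_pow_smul {c : ℕ → ℕ → ℕ → R} {f fσ g : LaurentPoly R n} {h : Series R n}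
    {ψ : ℕ → (Fin n → ℤ) → R}
    (hψ : ∀ m, act (f ^ m) (ψ m) = fun k => (PowerSeries.coeff m h).coeff k) (N a : ℕ) :
    act (fσ ^ a) (fun k => (PowerSeries.coeff N (integralDwork p c f g h)).coeff k) =
      ∑ x ∈ Finset.HasAntidiagonal.antidiagonal N,
        ∑ y ∈ Finset.HasAntidiagonal.antidiagonal (p * x.2), c N y.1 x.1 •
          cartierFun p (act (expandPoly p fσ ^ a * (g ^ x.1 * f ^ (p * x.2))) (ψ y.2)) := by
  have e : (fun k => (PowerSeries.coeff N (integralDwork p c f g h)).coeff k) =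
      ∑ x ∈ Finset.HasAntidiagonal.antidiagonal N,
        ∑ y ∈ Finset.HasAntidiagonal.antidiagonal (p * x.2), c N y.1 x.1 •
          cartierFun p (act (g ^ x.1 * f ^ (p * x.2)) (ψ y.2)) := by
    funext k
    rw [coeff_integralDwork, AddMonoidAlgebra.coeff_sum, Finsupp.finsetSum_apply, Finset.sum_apply]
    refine Finset.sum_congr rfl fun x _ => ?_
    rw [AddMonoidAlgebra.coeff_sum, Finsupp.finsetSum_apply, Finset.sum_apply]
    refine Finset.sum_congr rfl fun y hy => ?_
    rw [Finset.HasAntidiagonal.mem_antidiagonal] at hy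
    rw [AddMonoidAlgebra.coeff_smul_apply, Pi.smul_apply, ← hy, pow_add, ← mul_assoc, map_mul act,
      Module.End.mul_apply, hψ, ← coeff_mul_eq_act, cartierFun_coeff]
  rw [e, map_sum]
  refine Finset.sum_congr rfl fun x _ => ?_
  rw [map_sum]
  refine Finset.sum_congr rfl fun y _ => ?_
  rw [map_smul, ← cartierFun_act_expandPoly, map_pow, map_mul act (_ ^ a), Module.End.mul_apply]

lemma sum_range_antidiagonal {M : Type*} [AddCommMonoid M] (u : ℕ → ℕ → M) (T : ℕ) :
    ∑ N ∈ Finset.range T, ∑ x ∈ Finset.HasAntidiagonal.antidiagonal N, u x.1 x.2 =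
      ∑ m ∈ Finset.range T, ∑ j ∈ Finset.range (T - m), u j m := by
  rw [← Finset.sum_range_diag_flip T fun m j => u j m]
  refine Finset.sum_congr rfl fun N _ => ?_
  rw [← Finset.Nat.sum_antidiagonal_eq_sum_range_succ (fun m j => u j m) N]
  exact Finset.Nat.sum_antidiagonal_swap (f := fun x => u x.2 x.1)

variable {K : Type*} [CommRing K] [Algebra ℚ K] [Algebra R K]

/-- The sign of the Laplace transform cancels that of (-p)^N, and (j+M)!/j! is a binomial
coefficient times M!. This separates the dependence on j, a binomial series in p g, from the factor
depending on m and M. -/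
lemma neg_one_pow_mul_factorial_mul_dworkCoeff (m M i j : ℕ) (hi : i + m = p * (M + 1)) :
    (-1 : ℚ) ^ (j + (M + 1)) * (j + M).factorial * dworkCoeff p (j + (M + 1)) i j =
      gaussTerm p m M * (M + j).choose M * p ^ j := by
  have h1 : truncExpCoeffInt p ((p * (M + 1) : ℕ) - (m : ℤ)) = truncExpCoeff p i := by
    unfold truncExpCoeffInt
    rw [if_pos (by omega)]
    congr 1
    omega
  have h2 : ((j + M).factorial : ℚ) = (M + j).choose M * M.factorial * j.factorial := by
    have := Nat.add_choose_mul_factorial_mul_factorial M j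
    rw [add_comm j M, Nat.choose_symm_add]
    exact_mod_cast this.symm
  have h3 : (-1 : ℚ) ^ (j + (M + 1)) * (-1) ^ (j + (M + 1)) = 1 := by rw [← mul_pow]; simp
  have h4 : (j.factorial : ℚ) * (j.factorial : ℚ)⁻¹ = 1 :=
    mul_inv_cancel₀ (by exact_mod_cast j.factorial_ne_zero)
  rw [gaussTerm, dworkCoeff, h1, h2, neg_pow (p : ℚ), pow_add (p : ℚ)]
  linear_combination ((M + j).choose M * M.factorial * p ^ j * p ^ (M + 1) * truncExpCoeff p i : ℚ) *
    (((j.factorial : ℚ) * (j.factorial : ℚ)⁻¹) * h3 + h4)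

lemma gaussTerm_eq_zero (m M : ℕ) (h : p * (M + 1) < m) : gaussTerm p m M = 0 := by
  unfold gaussTerm truncExpCoeffInt
  rw [if_neg (by omega), mul_zero]

/-- The numerators of the partial sums of the expansion of the image of `h` under the Dwork
operator. -/
lemma sum_act_integralDwork (hRK : Function.Injective (algebraMap R K)) {c : ℕ → ℕ → ℕ → R}
    (hc : ∀ N i j, i + p * j ≤ p * N →
      algebraMap R K (c N i j) = algebraMap ℚ K (dworkCoeff p N i j)) {G : ℕ → ℕ → R}
    (hG : ∀ m M, algebraMap R K (G m M) = algebraMap ℚ K (gaussTerm p m M))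
    {f fσ g : LaurentPoly R n} {h : Series R n} {ψ : ℕ → (Fin n → ℤ) → R} (hψ0 : ψ 0 = 0)
    (hψ : ∀ m, act (f ^ m) (ψ m) = fun k => (PowerSeries.coeff m h).coeff k) (T : ℕ) :
    ∑ N ∈ Finset.range (T + 1), ((-1) ^ N * ((N - 1).factorial : R)) • act (fσ ^ (T + 1 - N))
        (fun k => (PowerSeries.coeff N (integralDwork p c f g h)).coeff k) =
      ∑ M ∈ Finset.range T, ∑ m ∈ Finset.range (p * (T + 1)), G m M • cartierFun p
        (act (f ^ (p * (M + 1)) * truncBinomial ((p : R) • g) (expandPoly p fσ) M (T - M))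
          (ψ m)) := by
  let u : ℕ → ℕ → (Fin n → ℤ) → R := fun j M =>
    ∑ y ∈ Finset.HasAntidiagonal.antidiagonal (p * M),
      ((-1) ^ (j + M) * ((j + M - 1).factorial : R) * c (j + M) y.1 j) • cartierFun p
        (act (expandPoly p fσ ^ (T + 1 - (j + M)) * (g ^ j * f ^ (p * M))) (ψ y.2))
  have h1 : ∀ N, ((-1) ^ N * ((N - 1).factorial : R)) • act (fσ ^ (T + 1 - N))
      (fun k => (PowerSeries.coeff N (integralDwork p c f g h)).coeff k) =
      ∑ x ∈ Finset.HasAntidiagonal.antidiagonal N, u x.1 x.2 := by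
    intro N
    rw [cartierFun_act_pow_smul p hψ, Finset.smul_sum]
    refine Finset.sum_congr rfl fun x hx => ?_
    rw [Finset.HasAntidiagonal.mem_antidiagonal] at hx
    rw [Finset.smul_sum]
    refine Finset.sum_congr rfl fun y _ => ?_
    rw [hx, smul_smul]
  rw [Finset.sum_congr rfl fun N _ => h1 N, sum_range_antidiagonal, Finset.sum_range_succ']
  -- The terms with M = 0 only involve ψ_0 = 0; dropping them shifts M by one.
  have h0 : ∀ j, u j 0 = 0 := fun j => by
    simp only [u, mul_zero, Finset.Nat.antidiagonal_zero, Finset.sum_singleton, hψ0, map_zero,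
      smul_zero]
  rw [Finset.sum_eq_zero (s := Finset.range (T + 1 - 0)) fun j _ => h0 j, add_zero]
  refine Finset.sum_congr rfl fun M hM => ?_
  have hM' := Finset.mem_range.1 hM
  -- The range of m is made independent of M so that the two sums can be exchanged; the added terms
  -- vanish, as c has negative index there.
  have h2 : ∀ j, u j (M + 1) = ∑ m ∈ Finset.range (p * (T + 1)),
      (G m M * (M + j).choose M * (p : R) ^ j) • cartierFun p
        (act (expandPoly p fσ ^ (T - M - j) * (g ^ j * f ^ (p * (M + 1)))) (ψ m)) := by
    intro j
    have hle : p * (M + 1) + 1 ≤ p * (T + 1) := by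
      have := Nat.mul_le_mul_left p (show M + 1 + 1 ≤ T + 1 by omega)
      have := hp.out.pos
      rw [mul_add p (M + 1)] at *
      omega
    rw [← Finset.sum_subset (Finset.range_subset_range.2 hle)]
    · simp only [u]
      rw [← Finset.Nat.sum_antidiagonal_swap, Finset.Nat.sum_antidiagonal_eq_sum_range_succ_mk]
      refine Finset.sum_congr rfl fun m hm => ?_
      have hm' := Finset.mem_range.1 hm
      rw [Prod.swap_prod_mk, show T + 1 - (j + (M + 1)) = T - M - j by omega]
      congr 1
      refine hRK ?_
      rw [show j + (M + 1) - 1 = j + M by omega, map_mul, map_mul, map_mul, map_mul, hG,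
        hc _ _ _ (by rw [mul_add p j]; omega)]
      have h3 := congrArg (algebraMap ℚ K) (neg_one_pow_mul_factorial_mul_dworkCoeff p m M
        (p * (M + 1) - m) j (by omega))
      simpa using h3
    · intro m _ hm
      have hG0 : G m M = 0 := hRK (by
        rw [hG, gaussTerm_eq_zero p m M (by rw [Finset.mem_range] at hm; omega), map_zero, map_zero])
      rw [hG0, zero_mul, zero_mul, zero_smul]
  rw [show T + 1 - (M + 1) = T - M by omega, Finset.sum_congr rfl fun j _ => h2 j,
    Finset.sum_comm]
  refine Finset.sum_congr rfl fun m _ => ?_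
  rw [truncBinomial, Finset.mul_sum, map_sum, LinearMap.sum_apply, map_sum, Finset.smul_sum]
  refine Finset.sum_congr rfl fun j _ => ?_
  have e : f ^ (p * (M + 1)) * (((M + j).choose M : LaurentPoly R n) *
      (((p : R) • g) ^ j * expandPoly p fσ ^ (T - M - j))) = (((M + j).choose M : R) * (p : R) ^ j) •
        (expandPoly p fσ ^ (T - M - j) * (g ^ j * f ^ (p * (M + 1)))) := by
    simp only [Algebra.smul_def, mul_pow, map_mul, map_pow, map_natCast]
    ring
  rw [e, map_smul act, LinearMap.smul_apply, map_smul, smul_smul, mul_assoc (G m M)]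

/-- Divisibility form of the comparison: after multiplication by a power of `f^σ` the two
expansions agree modulo a large power of `p`. -/
lemma pow_depth_dvd_sum_act_integralDwork [IsAddTorsionFree R]
    [IsAdicComplete (Ideal.span {(p : R)}) R] (hp2 : 2 < p)
    (hRK : Function.Injective (algebraMap R K)) {c : ℕ → ℕ → ℕ → R}
    (hc : ∀ N i j, i + p * j ≤ p * N →
      algebraMap R K (c N i j) = algebraMap ℚ K (dworkCoeff p N i j))
    {f fσ g : LaurentPoly R n} (hg : expandPoly p fσ = f ^ p + (p : R) • g)
    {h : Series R n} {ψ : ℕ → (Fin n → ℤ) → R} (hψ0 : ψ 0 = 0)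
    (hψ : ∀ m, act (f ^ m) (ψ m) = fun k => (PowerSeries.coeff m h).coeff k) (T : ℕ)
    (k : Fin n → ℤ) :
    (p : R) ^ depth T ∣ (∑ N ∈ Finset.range (T + 1), ((-1) ^ N * ((N - 1).factorial : R)) •
        act (fσ ^ (T + 1 - N))
          (fun k => (PowerSeries.coeff N (integralDwork p c f g h)).coeff k) -
      (p : R) • act (fσ ^ (T + 1)) (∑ m ∈ Finset.range (p * (T + 1)),
        ((-1) ^ m * ((m - 1).factorial : R)) • cartierFun p (ψ m))) k := by
  have hG : ∀ m M, ∃ r : R, algebraMap R K ((p : R) ^ depth (M + 1) * r) =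
      algebraMap ℚ K (gaussTerm p m M) := fun m M =>
    exists_algebraMap_eq_of_valGE p (gaussTerm_val p hp2 m M)
  choose G hG using hG
  have hS : ∀ m, ∃ r : R, ∑ M ∈ Finset.range T, (p : R) ^ depth (M + 1) * G (m + 1) M =
      p * ((-1) ^ (m + 1) * m.factorial) + p ^ depth T * r := fun m => by
    obtain ⟨r, hr⟩ := exists_algebraMap_eq_of_valGE (R := R) (K := K) p
      (sum_gaussTerm_val p hp2 m T)
    refine ⟨r, hRK ?_⟩
    rw [map_add, hr, map_sum, Finset.sum_congr rfl fun M _ => hG (m + 1) M]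
    simp
  rw [sum_act_integralDwork p hRK hc hG hψ0 hψ]
  have h1 : ∀ m, act (fσ ^ (T + 1)) (cartierFun p (ψ m)) =
      cartierFun p (act (expandPoly p fσ ^ (T + 1)) (ψ m)) := fun m => by
    rw [← cartierFun_act_expandPoly, map_pow]
  have h2 : ∀ M ∈ Finset.range T, ∀ m, ∃ Z : (Fin n → ℤ) → R,
      ((p : R) ^ depth (M + 1) * G m M) • cartierFun p
        (act (f ^ (p * (M + 1)) * truncBinomial ((p : R) • g) (expandPoly p fσ) M (T - M))
          (ψ m)) = ((p : R) ^ depth (M + 1) * G m M) •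
            act (fσ ^ (T + 1)) (cartierFun p (ψ m)) + (p : R) ^ depth T • Z := by
    intro M hM m
    have hM' := Finset.mem_range.1 hM
    obtain ⟨d, hd⟩ := pow_dvd_sub_pow_mul_truncBinomial ((p : R) • g) (expandPoly p fσ) M (T - M)
    rw [show expandPoly p fσ - (p : R) • g = f ^ p by rw [hg, add_sub_cancel_right], ← pow_mul,
      sub_eq_iff_eq_add, show M + 1 + (T - M) = T + 1 by omega, smul_pow, smul_mul_assoc] at hd
    have hle : depth T ≤ depth (M + 1) + (T - M) :=
      (depth_mono (by omega)).trans (depth_add_le (M + 1) (T - M))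
    obtain ⟨e, he⟩ := Nat.exists_eq_add_of_le hle
    refine ⟨((p : R) ^ e * G m M) • cartierFun p (act (g ^ (T - M) * d) (ψ m)), ?_⟩
    rw [hd, map_add act, LinearMap.add_apply, map_add, map_smul act, LinearMap.smul_apply,
      map_smul, smul_add, smul_smul, smul_smul, h1, add_comm]
    congr 2
    rw [mul_right_comm, ← pow_add, he, pow_add, mul_assoc]
  have h3 : ∀ m k, (p : R) ^ depth T ∣
      (∑ M ∈ Finset.range T, ((p : R) ^ depth (M + 1) * G m M) • cartierFun p
        (act (f ^ (p * (M + 1)) * truncBinomial ((p : R) • g) (expandPoly p fσ) M (T - M))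
          (ψ m)) - ∑ M ∈ Finset.range T, ((p : R) ^ depth (M + 1) * G m M) •
            act (fσ ^ (T + 1)) (cartierFun p (ψ m))) k := by
    intro m k
    rw [← Finset.sum_sub_distrib, Finset.sum_apply]
    refine Finset.dvd_sum fun M hM => ?_
    obtain ⟨Z, hZ⟩ := h2 M hM m
    rw [hZ, add_sub_cancel_left]
    exact Dvd.intro _ rfl
  have h4 : ∀ m k, (p : R) ^ depth T ∣ (∑ M ∈ Finset.range T,
      ((p : R) ^ depth (M + 1) * G m M) • act (fσ ^ (T + 1)) (cartierFun p (ψ m)) -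
      (p : R) • act (fσ ^ (T + 1)) (((-1) ^ m * ((m - 1).factorial : R)) •
        cartierFun p (ψ m))) k := by
    intro m k
    -- The factorial sum is only evaluated for m ≥ 1; the index 0 is harmless because ψ_0 = 0.
    rcases m with _ | m
    · simp [hψ0]
    · obtain ⟨r, hr⟩ := hS m
      rw [← Finset.sum_smul, hr, map_smul, smul_smul, Nat.add_sub_cancel, ← sub_smul,
        add_sub_cancel_left, mul_smul]
      exact Dvd.intro _ rfl
  rw [Finset.sum_comm, map_sum, Finset.smul_sum, ← Finset.sum_sub_distrib, Finset.sum_apply]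
  refine Finset.dvd_sum fun m _ => ?_
  have h5 := dvd_add (h3 m k) (h4 m k)
  rwa [← Pi.add_apply, sub_add_sub_cancel] at h5

/-- On formal expansions at a vertex, the operator `p⁻¹ e^{-F^σ} ∘ V_p ∘ e^F` is the Cartier
operator. -/
theorem completedExpansion_laplace_eq [IsAddTorsionFree R]
    [IsAdicComplete (Ideal.span {(p : R)}) R] (hp2 : 2 < p)
    (hRK : Function.Injective (algebraMap R K)) {c : ℕ → ℕ → ℕ → R}
    (hc : ∀ N i j, i + p * j ≤ p * N →
      algebraMap R K (c N i j) = algebraMap ℚ K (dworkCoeff p N i j))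
    {Δ : Set (Fin n → ℝ)} {b : Fin n → ℤ} {f fσ g : LaurentPoly R n}
    (hg : expandPoly p fσ = f ^ p + (p : R) • g) (hV : IsUnitVertex Δ f b)
    (hVσ : IsUnitVertex Δ fσ b) (h y : completedSeriesPlus p R Δ)
    (hy : (p : R) • (y : Series R n) = integralDwork p c f g h) :
    completedExpansion p hVσ (laplace p Δ fσ y) =
      completedCartierFormal p (completedExpansion p hV (laplace p Δ f h)) := by
  have hψ : ∀ N, ∃ ψ : OmegaFormal R Δ b,
      act (f ^ N) ψ = fun k => (PowerSeries.coeff N (h : Series R n)).coeff k := fun N => by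
    obtain ⟨ψ, h1, h2⟩ := hV.exists_formal_quotient ((mem_coneSeriesPlus_iff.1 h.2.1).1 N)
    exact ⟨⟨ψ, h1⟩, h2⟩
  have hχ : ∀ N, ∃ χ : OmegaFormal R Δ b,
      act (fσ ^ N) χ = fun k => (PowerSeries.coeff N (y : Series R n)).coeff k := fun N => by
    obtain ⟨χ, h1, h2⟩ := hVσ.exists_formal_quotient ((mem_coneSeriesPlus_iff.1 y.2.1).1 N)
    exact ⟨⟨χ, h1⟩, h2⟩
  choose ψ hψ using hψ
  choose χ hχ using hχ
  have hψ0 : ((ψ 0 : OmegaFormal R Δ b) : (Fin n → ℤ) → R) = 0 := by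
    have h0 := hψ 0
    rw [(mem_coneSeriesPlus_iff.1 h.2.1).2, pow_zero, map_one, Module.End.one_apply] at h0
    exact h0
  refine AdicCompletion.ext fun s => ?_
  obtain ⟨N₁, hN₁⟩ := h.2.2 s
  obtain ⟨N₂, hN₂⟩ := y.2.2 s
  -- T exceeds both truncation degrees, and 6(s+1) ≤ T gives depth at least s + 1: one more than s,
  -- since the comparison is made after multiplication by p.
  obtain ⟨T, hT₁, hT₂, hT₃⟩ : ∃ T, N₁ ≤ T ∧ N₂ ≤ T ∧ 6 * (s + 1) ≤ T :=
    ⟨N₁ + N₂ + 6 * (s + 1), by omega, by omega, by omega⟩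
  have hpT : T + 1 ≤ p * (T + 1) := Nat.le_mul_of_pos_left _ hp.out.pos
  rw [completedExpansion_laplace_val p hVσ y χ hχ (T := T + 1) fun u hu => hN₂ u (by omega),
    completedCartierFormal, AdicCompletion.map_val_apply,
    completedExpansion_laplace_val p hV h ψ hψ (T := p * (T + 1)) fun u hu => hN₁ u (by omega)]
  change Submodule.Quotient.mk _ = Submodule.Quotient.mk (cartierFormal p R Δ b _)
  rw [Submodule.Quotient.eq, mem_pow_smul_top_omegaFormal_iff]
  intro k
  refine (mul_dvd_mul_iff_left_of_natCast (m := p) hp.out.ne_zero).1 ?_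
  rw [← pow_succ']
  -- Divisibility may be checked after multiplication by (f^σ)^{T+1}, which clears all denominators
  -- of the partial sums.
  refine hVσ.dvd_of_dvd_act (Submodule.smul_mem _ (p : R) (SetLike.coe_mem
    (∑ N ∈ Finset.range (T + 1), ((-1) ^ N * ((N - 1).factorial : R)) • χ N -
      cartierFormal p R Δ b (∑ m ∈ Finset.range (p * (T + 1)),
        ((-1) ^ m * ((m - 1).factorial : R)) • ψ m)))) (T + 1) (fun l => ?_) k
  have h1 := (pow_dvd_pow (p : R) ((le_depth (s + 1)).trans (depth_mono hT₃))).trans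
    (pow_depth_dvd_sum_act_integralDwork p hp2 hRK hc hg hψ0 hψ T l)
  refine (congrArg _ (congrFun ?_ l)).mp h1
  have h2 : ((cartierFormal p R Δ b (∑ m ∈ Finset.range (p * (T + 1)),
        ((-1) ^ m * ((m - 1).factorial : R)) • ψ m) : OmegaFormal R Δ b) : (Fin n → ℤ) → R) =
      ∑ m ∈ Finset.range (p * (T + 1)),
        ((-1) ^ m * ((m - 1).factorial : R)) • cartierFun p (ψ m) := by
    rw [map_sum, Submodule.coe_sum]
    rfl
  rw [Submodule.coe_sub, h2, Submodule.coe_sum, smul_sub, map_sub, map_smul, map_smul]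
  congr 1
  rw [map_sum, Finset.smul_sum]
  refine Finset.sum_congr rfl fun N hN => ?_
  have hN' := Finset.mem_range.1 hN
  have h3 : (fun k => (PowerSeries.coeff N (integralDwork p c f g (h : Series R n))).coeff k) =
      (p : R) • act (fσ ^ N) (χ N) := by
    rw [hχ, ← hy, PowerSeries.coeff_smul]
    rfl
  rw [h3, Submodule.coe_smul, map_smul, map_smul, ← Module.End.mul_apply, ← map_mul, ← pow_add,
    Nat.sub_add_cancel (by omega), smul_comm]

end Comparison

/-! ### The operator on completed modules and the induced map on quotients -/

section Main

variable {R : Type*} [CommRing R] {n : ℕ} (p : ℕ) [hp : Fact p.Prime] {Δ : Set (Fin n → ℝ)}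

/-- Division of the coefficients of `integralDwork` by `p` in positive degree. -/
lemma smul_integralDwork {c₁ c₂ : ℕ → ℕ → ℕ → R}
    (hc : ∀ N i j, N ≠ 0 → (p : R) * c₂ N i j = c₁ N i j) (f g : LaurentPoly R n)
    {h : Series R n} (hh : PowerSeries.coeff 0 h = 0) :
    (p : R) • integralDwork p c₂ f g h = integralDwork p c₁ f g h := by
  ext1 N
  rw [PowerSeries.coeff_smul, coeff_integralDwork, coeff_integralDwork, Finset.smul_sum]
  refine Finset.sum_congr rfl fun x hx => ?_
  rw [Finset.smul_sum]
  refine Finset.sum_congr rfl fun y hy => ?_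
  rw [Finset.HasAntidiagonal.mem_antidiagonal] at hx hy
  rcases Nat.eq_zero_or_pos N with rfl | hN
  · have hy0 : y.2 = 0 := by
      rw [show x.2 = 0 by omega, mul_zero] at hy
      omega
    rw [hy0, hh, mul_zero, cartierPoly_zero, smul_zero, smul_zero, smul_zero]
  · rw [smul_smul, hc N _ _ hN.ne']

/-- The operator of `integralDwork` on the completed module of series without constant term. -/
def completedDwork {c : ℕ → ℕ → ℕ → R} (hc : ∀ s : ℕ, ∃ N₀, ∀ N, N₀ ≤ N → ∀ i j, (p : R) ^ s ∣ c N i j)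
    (hΔ : Convex ℝ Δ) {f g : LaurentPoly R n} (hf : f ∈ layer R Δ 1) (hg : g ∈ layer R Δ p) :
    completedSeriesPlus p R Δ →ₗ[R] completedSeriesPlus p R Δ :=
  (integralDwork p c f g).restrict fun h hh =>
    ⟨⟨integralDwork_mem_coneSeries p hΔ c hf hg hh.1.1,
      coeffAt_integralDwork_zero p c f g hh.1.2⟩, integralDwork_mem_nullSeries p hc f g h⟩

lemma exists_pow_dvd_of_le {c d : ℕ → ℕ → ℕ → R} {e : ℕ → ℕ} (he : ∀ N, depth N ≤ e N + 1)
    (hc : ∀ N i j, c N i j = (p : R) ^ e N * d N i j) (s : ℕ) :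
    ∃ N₀, ∀ N, N₀ ≤ N → ∀ i j, (p : R) ^ s ∣ c N i j := by
  refine ⟨6 * (s + 1), fun N hN i j => ?_⟩
  have h1 := (le_depth (s + 1)).trans (depth_mono hN)
  have h2 := he N
  rw [hc]
  exact Dvd.dvd.mul_right (pow_dvd_pow _ (by omega)) _

/-- A linear map out of the source of a surjection that vanishes on its kernel factors. -/
lemma exists_linearMap_comp_eq {M N P : Type*} [AddCommGroup M] [AddCommGroup N] [AddCommGroup P]
    [Module R M] [Module R N] [Module R P] {u : M →ₗ[R] N} (hu : Function.Surjective u)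
    (v : M →ₗ[R] P) (huv : ∀ x, u x = 0 → v x = 0) : ∃ w : N →ₗ[R] P, ∀ x, w (u x) = v x := by
  refine ⟨(LinearMap.ker u).liftQ v (fun x hx => huv x hx) ∘ₗ
    (u.quotKerEquivOfSurjective hu).symm.toLinearMap, fun x => ?_⟩
  have h : (u.quotKerEquivOfSurjective hu).symm (u x) = Submodule.Quotient.mk x :=
    (LinearEquiv.symm_apply_eq _).2 rfl
  rw [LinearMap.comp_apply, LinearEquiv.coe_coe, h]
  rfl

end Main

end DworkCrystal

end

open DworkCrystal
theorem theoremA4 {R K : Type*} [CommRing R] [CommRing K] [Algebra ℚ K] [Algebra R K]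
    (hRK : Function.Injective (algebraMap R K))
    (p : ℕ) [Fact p.Prime] (hp : 2 < p) [IsAdicComplete (Ideal.span {(p : R)}) R]
    (σ : R →+* R) (hσ : ∀ r, (p : R) ∣ σ r - r ^ p)
    {n : ℕ} (f : LaurentPoly R n) :
    let Δ := newtonPolytope f
    let fσ := mapCoeff σ f
    let ι : Series R n →+* Series K n := mapSeries (algebraMap R K)
    -- the operator `𝒱_σ = e^{-F^σ} ∘ V_p ∘ e^F` on power series over `K`
    let V : Series K n → Series K n :=
      dworkOperator p (mapCoeff (algebraMap R K) f) (mapCoeff (algebraMap R K) fσ)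
    -- `𝒱_σ` maps `R⟦Δ⟧` to itself
    (∀ h ∈ coneSeries R Δ, ∃ h' ∈ coneSeries R Δ, ι h' = V (ι h)) ∧
    -- `𝒱_σ` preserves `R⟦Δ⟧⁺` and is divisible by `p` on it
    (∀ h ∈ coneSeriesPlus R Δ, ∃ h' ∈ coneSeriesPlus R Δ, ι (p • h') = V (ι h)) ∧
    -- the commutation relation with the twisted derivatives
    (∀ (i : Fin (n + 1)) (h : Series K n),
      V (twistedDeriv i (mapCoeff (algebraMap R K) f) h) =
        p • twistedDeriv i (mapCoeff (algebraMap R K) fσ) (V h)) ∧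
    -- `𝒱_σ` preserves the `p`-adic completion of `R[Δ]`
    (∀ h ∈ completedSeries p R Δ, ∃ h' ∈ completedSeries p R Δ, ι h' = V (ι h)) ∧
    -- `Ψ = p⁻¹ 𝒱_σ` on the series without constant term
    ∃ Ψ : completedSeriesPlus p R Δ →ₗ[R] completedSeriesPlus p R Δ,
      (∀ h : completedSeriesPlus p R Δ, ι (p • (Ψ h : Series R n)) = V (ι h)) ∧
      -- for each vertex `b` of `Δ` at which the coefficient of `f` is a unit
      ∀ (b : Fin n → ℤ) (hb : toReal b ∈ Δ.extremePoints ℝ) (hu : IsUnit (f.coeff b)),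
        -- the completed modules `Ω_f` and `Ω_{f^σ}` are the quotients of the module of series
        -- without constant term by the image of the twisted derivative with index `0`
        Function.Surjective (laplace p Δ f) ∧
        (∀ h, laplace p Δ f h = 0 ↔ ∃ h₁ : completedSeriesPlus p R Δ,
          (h : Series R n) = twistedDeriv 0 f h₁) ∧
        Function.Surjective (laplace p Δ fσ) ∧
        (∀ h, laplace p Δ fσ h = 0 ↔ ∃ h₁ : completedSeriesPlus p R Δ,
          (h : Series R n) = twistedDeriv 0 fσ h₁) ∧
        -- there is exactly one Cartier operator, and it is the map induced by `Ψ`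
        ∃ C : PCompletion p R (Omega Δ f) →ₗ[R] PCompletion p R (Omega Δ fσ),
          (∀ C' : PCompletion p R (Omega Δ f) →ₗ[R] PCompletion p R (Omega Δ fσ),
            IsCartierOperator p (IsUnitVertex.of_newtonPolytope hb hu)
              ((IsUnitVertex.of_newtonPolytope hb hu).map σ) C' ↔ C' = C) ∧
          ∀ h, C (laplace p Δ f h) = laplace p Δ fσ (Ψ h) := by
  intro Δ fσ ι V
  have : IsAddTorsionFree R := isAddTorsionFree_of_injective hRK
  have hp0 : p ≠ 0 := (Fact.out : p.Prime).ne_zero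
  have hΔ : Convex ℝ Δ := convex_convexHull ℝ _
  have hbdd : Bornology.IsBounded Δ :=
    isBounded_convexHull.2 ((Finset.finite_toSet _).image _).isBounded
  have hf : f ∈ layer R Δ 1 := mem_layer_newtonPolytope f
  obtain ⟨g, hg⟩ := exists_frobenius_lift p σ hσ f
  have hgΔ : g ∈ layer R Δ p := layer_frobenius_lift p hΔ hf (layer_mapCoeff σ hf) hg
  obtain ⟨d, hd⟩ := exists_integral_dworkCoeff (R := R) (K := K) p hp
  let c₁ : ℕ → ℕ → ℕ → R := fun N i j => (p : R) ^ depth N * d N i j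
  -- The coefficients of p⁻¹ 𝒱_σ. In degree 0 the depth is 0 and nothing is divided out, which does
  -- no harm on series without constant term.
  let c₂ : ℕ → ℕ → ℕ → R := fun N i j => (p : R) ^ (depth N - 1) * d N i j
  have hc₁ : ∀ s : ℕ, ∃ N₀, ∀ N, N₀ ≤ N → ∀ i j, (p : R) ^ s ∣ c₁ N i j :=
    exists_pow_dvd_of_le p (e := depth) (fun N => Nat.le_succ _) fun _ _ _ => rfl
  have hc₂ : ∀ s : ℕ, ∃ N₀, ∀ N, N₀ ≤ N → ∀ i j, (p : R) ^ s ∣ c₂ N i j :=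
    exists_pow_dvd_of_le p (e := fun N => depth N - 1) (fun N => by omega) fun _ _ _ => rfl
  have hc₁₂ : ∀ N i j, N ≠ 0 → (p : R) * c₂ N i j = c₁ N i j := fun N i j hN => by
    rw [← mul_assoc, ← pow_succ', Nat.sub_add_cancel (one_le_depth hN)]
  have hV : ∀ h, ι (integralDwork p c₁ f g h) = V (ι h) := fun h =>
    mapSeries_integralDwork p hd hg h
  have hV₂ : ∀ h ∈ coneSeriesPlus R Δ, ι (p • integralDwork p c₂ f g h) = V (ι h) := by
    intro h hh
    rw [← hV, ← smul_integralDwork p hc₁₂ f g (coeff_zero_eq_zero hh), Nat.cast_smul_eq_nsmul]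
  refine ⟨fun h hh => ⟨_, integralDwork_mem_coneSeries p hΔ c₁ hf hgΔ hh, hV h⟩,
    fun h hh => ⟨_, ⟨integralDwork_mem_coneSeries p hΔ c₂ hf hgΔ hh.1,
      coeffAt_integralDwork_zero p c₂ f g hh.2⟩, hV₂ h hh⟩,
    fun i h => dworkOperator_twistedDeriv p _ _ i h,
    fun h hh => ⟨_, ⟨integralDwork_mem_coneSeries p hΔ c₁ hf hgΔ hh.1,
      integralDwork_mem_nullSeries p hc₁ f g h⟩, hV h⟩,
    completedDwork p hc₂ hΔ hf hgΔ, fun h => hV₂ h h.2.1, fun b hb hu => ?_⟩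
  have hVf : IsUnitVertex Δ f b := IsUnitVertex.of_newtonPolytope hb hu
  have hVfσ : IsUnitVertex Δ fσ b := hVf.map σ
  have key : ∀ h, completedExpansion p hVfσ (laplace p Δ fσ (completedDwork p hc₂ hΔ hf hgΔ h)) =
      completedCartierFormal p (completedExpansion p hVf (laplace p Δ f h)) := fun h =>
    completedExpansion_laplace_eq p hp hRK hd hg hVf hVfσ h _
      (smul_integralDwork p hc₁₂ f g (coeff_zero_eq_zero h.2.1))
  have hsurj := laplace_surjective p hbdd f
  -- Well-definedness of the induced map: if the transform of h is 0, then by `key` the transform of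
  -- its image has zero expansion, hence is 0 by injectivity.
  obtain ⟨C, hC⟩ := exists_linearMap_comp_eq hsurj
    (laplace p Δ fσ ∘ₗ completedDwork p hc₂ hΔ hf hgΔ) fun h h0 => by
      refine completedExpansion_injective p hVfσ ?_
      rw [LinearMap.comp_apply, key, h0]
      simp only [completedExpansion, completedCartierFormal, map_zero]
  refine ⟨hsurj, laplace_eq_zero_iff p hVf, laplace_surjective p hbdd fσ,
    laplace_eq_zero_iff p hVfσ, C, fun C' => ⟨fun hC' => ?_, ?_⟩, hC⟩
  · refine LinearMap.ext fun ω => ?_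
    obtain ⟨h, rfl⟩ := hsurj ω
    refine completedExpansion_injective p hVfσ ((hC' _).trans ?_)
    rw [hC, LinearMap.comp_apply, key]
  · rintro rfl ω
    obtain ⟨h, rfl⟩ := hsurj ω
    rw [hC]
    exact key h
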